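/- Let $\mathbb N=\{1,2,\dots\}$. Let $0<t_1<t_2<\cdots$ be the roots of $\mathrm{Ai}(-t)=0$, where $\mathrm{Ai}(s)=\frac1{2\pi}\int_{-\infty}^{\infty}e^{i(sx+x^3/3)}\,dx$ is the Airy function, and for $m,n\in\mathbb N$ put $F(m,n)=\sqrt{n^2+n^{4/3}t_m}$ (the square roots of the eigenvalues of the Friedlander operator). For $k,\ell\in\mathbb N$ let $L_{k,\ell}>0$ be the length of the closed geodesics of the Friedlander model with $k$ reflections and winding number $\ell$, that is, the number $L>0$ such that for some $\eta_0\in(-1,1)\setminus\{0\}$ $$L\,\frac{\eta_0^2}{\sqrt{1-\eta_0^2}}=4k,\qquad L\Bigl(\tfrac13\eta_0+\tfrac{2}{3\eta_0}\Bigr)=2\pi\ell ,$$ and for real $M$ let $\mathcal L_F(M)=\{L_{k,\ell}: k,\ell\in\mathbb N,\ 1\le k\le M\ell\}$. Given $0<\kappa_1<\kappa_2<\infty$, let $\Gamma_2=\{(\xi,\eta)\in\mathbb R^2:\ (\kappa_1/2)\eta<\xi<2\kappa_2\eta\}$, let $\chi_2\in S^0(\mathbb R^2)$ be a symbol of order $0$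 (that is, $\chi_2\in C^\infty(\mathbb R^2)$ and $|\partial^\alpha\chi_2(w)|\le C_\alpha(1+|w|)^{-|\alpha|}$ for all $\alpha$) that vanishes outside $\Gamma_2$, let $\psi\in C^\infty(\mathbb R)$ satisfy $\psi(\xi)=1$ for $\xi\ge1$ and $\psi(\xi)=0$ for $\xi\le\frac12$, and let $$I_2(t)=\sum_{(m,n)\in\mathbb Z^2}e^{itF(m,n)}\,\psi(m)\psi(n)\,\chi_2(m,n),$$ where the terms with $m\le0$ or $n\le0$ are zero. Proposition. (a) For every $\kappa_1>0$ there is $M_0=M_0(\kappa_1)$ such that for all $M\ge M_0$ and all $\kappa_2$, $\chi_2$, $\psi$ as above, the series $I_2$ converges (unconditionally) in the sense of tempered distributions on $\mathbb R$, and the distribution $I_2$ is $C^\infty$ on the complement of $$\mathcal L_F(M)\cup(-\mathcal L_F(M))\cup\{0\}.$$ (b) In particular, for every $\ell\in\mathbb N$ and every $\kappa_1>0$ there is $\varepsilon>0$ such that, for all $\kappa_2$, $\chi_2$, $\psi$ as above, $I_2$ is $C^\infty$ on $(2\pi\ell-\varepsilon,\,2\pi\ell+\varepsilon)$. -/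

import Mathlib

open Filter Set
open scoped Real ContDiff SchwartzMap

noncomputable section

namespace Friedlander

/-! ### The Airy function and its zeros -/

/-- The Airy function, as the (conditionally convergent) oscillatory integral
`Ai(s) = (1 / 2π) ∫_{-∞}^{∞} exp (i (s x + x ^ 3 / 3)) dx`. -/
def airyAi (s : ℝ) : ℂ :=
  limUnder atTop fun R : ℝ =>
    (1 / (2 * (π : ℂ))) *
      ∫ x in (-R)..R, Complex.exp (Complex.I * ((s * x + x ^ 3 / 3 : ℝ) : ℂ))

/-- `airyRoot m`, for `m = 1, 2, …`, is the `m`-th positive root `t_m` of `Ai(-t) = 0`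
(in increasing order). The value `airyRoot 0 = 0` only starts the recursion. -/
def airyRoot : ℕ → ℝ
  | 0 => 0
  | m + 1 => sInf {t : ℝ | airyRoot m < t ∧ airyAi (-t) = 0}

/-- The square root of the eigenvalue `λ(m, n) = n ^ 2 + |n| ^ (4/3) t_m` of the Friedlander
operator. For integers `m, n ≥ 1` this is the phase function `F(m, n)`; the other lattice
points carry the weight zero in the trace below. -/
def freq (m n : ℤ) : ℝ :=
  √((n : ℝ) ^ 2 + |(n : ℝ)| ^ (4 / 3 : ℝ) * airyRoot m.toNat)

/-! ### Symbols, sectors and the cutoff in the lattice variables -/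

/-- `a ∈ S^r(ℝ²)`: `a` is smooth and each derivative of order `j` is bounded by a multiple of
`(1 + |w|) ^ (r - j)` on all of `ℝ²`. (The choice of a norm on `ℝ²`, here the maximum norm, only
changes the constants, as does using the norm of the `j`-th derivative in place of all the partial
derivatives of order `j`.) -/
def IsSymbol (r : ℝ) (a : ℝ × ℝ → ℂ) : Prop :=
  ContDiff ℝ ∞ a ∧
    ∀ j : ℕ, ∃ C : ℝ, ∀ w : ℝ × ℝ, ‖iteratedFDeriv ℝ j a w‖ ≤ C * (1 + ‖w‖) ^ (r - j)

/-- The middle sector `Γ₂ = {(ξ, η) : (κ₁ / 2) η < ξ < 2 κ₂ η}`. -/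
def middleSector (κ₁ κ₂ : ℝ) : Set (ℝ × ℝ) :=
  {p | κ₁ / 2 * p.2 < p.1 ∧ p.1 < 2 * κ₂ * p.2}

/-- `ψ` is a smooth function on `ℝ`, equal to `1` for `ξ ≥ 1` and to `0` for `ξ ≤ 1/2`. -/
def IsPositiveCutoff (ψ : ℝ → ℂ) : Prop :=
  ContDiff ℝ ∞ ψ ∧ (∀ ξ, 1 ≤ ξ → ψ ξ = 1) ∧ (∀ ξ, ξ ≤ 1 / 2 → ψ ξ = 0)

/-! ### The localized trace as a tempered distribution -/

lemma hasTemperateGrowth_wave (a : ℝ) :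
    (fun t : ℝ => Complex.exp (Complex.I * ((t * a : ℝ) : ℂ))).HasTemperateGrowth := by
  have hder : ∀ n : ℕ,
      iteratedDeriv n (fun t : ℝ => Complex.exp (Complex.I * ((t * a : ℝ) : ℂ))) =
        fun t : ℝ => (Complex.I * a) ^ n * Complex.exp (Complex.I * ((t * a : ℝ) : ℂ)) := by
    intro n
    induction n with
    | zero => simp
    | succ n ih =>
      rw [iteratedDeriv_succ, ih]
      funext t
      have h1 : HasDerivAt (fun t : ℝ => Complex.I * ((t * a : ℝ) : ℂ)) (Complex.I * a) t := by
        have h := (((hasDerivAt_id t).mul_const a).ofReal_comp).const_mul Complex.I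
        simpa using h
      have h2 := (h1.cexp).const_mul ((Complex.I * a) ^ n)
      rw [h2.deriv]
      ring
  refine ⟨?_, fun n => ⟨0, |a| ^ n, fun t => ?_⟩⟩
  · exact (contDiff_const.mul
      (Complex.ofRealCLM.contDiff.comp (contDiff_id.mul contDiff_const))).cexp
  · rw [norm_iteratedFDeriv_eq_norm_iteratedDeriv, hder n]
    rw [norm_mul, norm_pow, mul_comm Complex.I (((t * a : ℝ) : ℂ)), Complex.norm_exp_ofReal_mul_I]
    simp

/-- The tempered distribution on `ℝ` given by the bounded smooth function `t ↦ exp (i t a)`. -/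
def wave (a : ℝ) : 𝓢'(ℝ, ℂ) :=
  (hasTemperateGrowth_wave a).toTemperedDistribution MeasureTheory.volume

/-- The term of index `(m, n)` in the localized trace, namely
`exp (i t F(m, n)) ψ(m) ψ(n) χ(m, n)` as a tempered distribution in `t`. -/
def traceTerm (ψ : ℝ → ℂ) (χ : ℝ × ℝ → ℂ) (p : ℤ × ℤ) : 𝓢'(ℝ, ℂ) :=
  (ψ p.1 * ψ p.2 * χ ((p.1 : ℝ), (p.2 : ℝ))) • wave (freq p.1 p.2)

/-- The part `I(t) = ∑_{(m, n) ∈ ℤ²} exp (i t F(m, n)) ψ(m) ψ(n) χ(m, n)` of the Friedlander wave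
trace localized by `χ`, a series of tempered distributions. -/
def localTrace (ψ : ℝ → ℂ) (χ : ℝ × ℝ → ℂ) : 𝓢'(ℝ, ℂ) :=
  ∑' p : ℤ × ℤ, traceTerm ψ χ p

/-- The distribution `u` is smooth on the open set `U`: on `U` it is integration against
a function of class `C^∞` on `U`. -/
def IsSmoothOn (u : 𝓢'(ℝ, ℂ)) (U : Set ℝ) : Prop :=
  ∃ g : ℝ → ℂ, ContDiffOn ℝ ∞ g U ∧
    ∀ φ : 𝓢(ℝ, ℂ), HasCompactSupport φ → tsupport φ ⊆ U → u φ = ∫ t, φ t * g t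

/-! ### The length spectrum -/

/-- `L` is the length `L_{k,ℓ}` of a closed geodesic of the Friedlander model with `k` reflections
and winding number `ℓ`: `L > 0` solves the two length equations for some `η₀ ∈ (-1, 1)`. -/
def IsGeodesicLength (k ℓ : ℕ) (L : ℝ) : Prop :=
  0 < L ∧ ∃ η₀ : ℝ, -1 < η₀ ∧ η₀ < 1 ∧ η₀ ≠ 0 ∧
    L * (η₀ ^ 2 / √(1 - η₀ ^ 2)) = 4 * k ∧
    L * (1 / 3 * η₀ + 2 / (3 * η₀)) = 2 * π * ℓ

/-- `ℒ_F(M) = {L_{k,ℓ} : k, ℓ ≥ 1, k ≤ M ℓ}`. -/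
def lengthSpectrum (M : ℝ) : Set ℝ :=
  {L | ∃ k ℓ : ℕ, 1 ≤ k ∧ 1 ≤ ℓ ∧ (k : ℝ) ≤ M * ℓ ∧ IsGeodesicLength k ℓ L}

end Friedlander

end

/-!
# Singularities of the localized wave trace of the Friedlander operator

The phase `F` is not smooth in any obvious sense in the integer variable `m`, so the singularities
are located without Poisson summation, by summation by parts on the lattice itself.

*The roots of the Airy function.* The function `w(t) = ∫ exp (-t v² - v⁶ / 12) dv` (`airyModulus`)
solves the equation `w''' + 4 t w' + 2 w = 0` of products of two solutions of `y'' + t y = 0`, and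
it has the first integral `2 w w'' - w'² + 4 t w² = 4 π`. Hence, with the phase `θ' = √π / w`, the
function `√w exp (i θ)` solves `y'' + t y = 0`, and `Ai(-t)` vanishes exactly where `θ(t)` lies in
a coset `c + π ℤ` (`exists_airyNeg_eq_zero_iff`). So `t_m = θ⁻¹(π m + c')` is the value at `m` of
a smooth function, and `w^(k)(t) = O(t ^ (-k - 1/2))` shows that this function is a symbol of order
`2/3`. On cones of lattice points `F` is therefore a symbol of order `1`, in the sense that each
difference lowers the order by one (`diffSymbol_freq`), and the first differences of `F` converge
along rays `m / n → r` to explicit slopes (`tendsto_freq_shift_fst`, `tendsto_freq_shift_snd`).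

*Bounds in the upper half plane.* For `Im z > 0` the sum `S(z) = ∑ a exp (i z F)` converges. Call
a real `t` non-resonant if `t` times the pair of slopes is never in `2 π ℤ²` for the rays in
question. Near such a `t`, and far out in the cone, one of the increments `exp (i z ΔF) - 1` is
bounded below, so the sum can be summed by parts as often as one likes; each step lowers the order
of the amplitude by one (`exists_bound_oscillatory_tsum`). Thus `S` and all its derivatives are
bounded near `t` in the upper half plane, `S` has smooth boundary values there
(`exists_smooth_boundaryValue`), and by Abel summation these represent the distribution
`∑ a exp (i t F)` (`isSmoothOn_localTrace`). The series converges in the tempered sense because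
its Fourier transform is a sum of point masses with bounded coefficients at points of at most
polynomial density (`hasSum_traceTerm`).

*Resonant times are lengths.* With `η₀ = (1 + σ)^(-1/2)`, where `σ = (3 π r / 2)^(2/3)`, the
resonance conditions on the ray of slope `r` are precisely the two length equations, and
`k / ℓ ≤ π / (2 √σ)`, which is bounded for `r ≥ κ₁ / 2` (`exists_isGeodesicLength_of_resonant`).

*The times `2πℓ`.* If `2πℓ` were resonant, then `π ^ 2` would be a root of a rational quadratic
polynomial whose other root is negative (`two_pi_mul_nat_ne`). A Hermite–Lindemann argument
excludes this (`int_mul_pi_pow_four_ne_zero`). Resonance being a closed condition, and steep rays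
being harmless for bounded times, a whole neighbourhood of `2πℓ` is non-resonant, uniformly in `κ₂`
(`exists_uniform_nonResonant`).
-/

open Filter Set
open scoped Real ContDiff SchwartzMap

noncomputable section

namespace Friedlander

open MeasureTheory Topology

/-! ### Integrals with Gaussian decay depending on a parameter -/

lemma integrable_one_add_abs_pow_mul_exp (k : ℕ) :
    Integrable fun x : ℝ => (1 + |x|) ^ k * Real.exp (-x ^ 2) := by
  have h := (integrable_exp_neg_mul_sq (b := 1 / 2) (by norm_num)).const_mul
    ((k.factorial : ℝ) * Real.exp 2)
  refine h.mono' (by fun_prop) (Eventually.of_forall fun x => ?_)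
  have h1 : (1 + |x|) ^ k ≤ k.factorial * Real.exp (1 + |x|) := by
    have := Real.pow_div_factorial_le_exp (1 + |x|) (by positivity) k
    rwa [div_le_iff₀' (by positivity)] at this
  have h2 : Real.exp (1 + |x|) * Real.exp (-x ^ 2) ≤ Real.exp 2 * Real.exp (-(1 / 2) * x ^ 2) := by
    rw [← Real.exp_add, ← Real.exp_add]
    apply Real.exp_le_exp.2
    nlinarith [sq_nonneg (|x| - 1), sq_abs x]
  rw [Real.norm_of_nonneg (by positivity)]
  calc (1 + |x|) ^ k * Real.exp (-x ^ 2)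
      ≤ (k.factorial * Real.exp (1 + |x|)) * Real.exp (-x ^ 2) := by gcongr
    _ = k.factorial * (Real.exp (1 + |x|) * Real.exp (-x ^ 2)) := by ring
    _ ≤ k.factorial * (Real.exp 2 * Real.exp (-(1 / 2) * x ^ 2)) := by gcongr
    _ = _ := by ring

lemma integrable_kernel {𝕜 : Type*} [RCLike 𝕜] {K : ℕ → ℝ → ℝ → 𝕜}
    (hc : ∀ k s, Continuous (K k s))
    (hb : ∀ k A, ∃ (C : ℝ) (j : ℕ), ∀ s x, |s| ≤ A →
      ‖K k s x‖ ≤ C * ((1 + |x|) ^ j * Real.exp (-x ^ 2)))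
    (k : ℕ) (s : ℝ) : Integrable (K k s) := by
  obtain ⟨C, j, h⟩ := hb k |s|
  exact ((integrable_one_add_abs_pow_mul_exp j).const_mul C).mono'
    (hc k s).aestronglyMeasurable (Eventually.of_forall fun x => h s x le_rfl)

/-- Differentiation under the integral sign, for a sequence of kernels each of which is the
derivative of the preceding one with respect to the parameter. -/
lemma hasDerivAt_integral_kernel {𝕜 : Type*} [RCLike 𝕜] {K : ℕ → ℝ → ℝ → 𝕜}
    (hK : ∀ k s x, HasDerivAt (fun s => K k s x) (K (k + 1) s x) s)
    (hc : ∀ k s, Continuous (K k s))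
    (hb : ∀ k A, ∃ (C : ℝ) (j : ℕ), ∀ s x, |s| ≤ A →
      ‖K k s x‖ ≤ C * ((1 + |x|) ^ j * Real.exp (-x ^ 2)))
    (k : ℕ) (s : ℝ) : HasDerivAt (fun s => ∫ x, K k s x) (∫ x, K (k + 1) s x) s := by
  obtain ⟨C, j, h⟩ := hb (k + 1) (|s| + 1)
  refine (hasDerivAt_integral_of_dominated_loc_of_deriv_le (F := K k) (F' := K (k + 1))
    (bound := fun x => C * ((1 + |x|) ^ j * Real.exp (-x ^ 2))) (Metric.ball_mem_nhds s one_pos)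
    (Eventually.of_forall fun s => (hc k s).aestronglyMeasurable) (integrable_kernel hc hb k s)
    (hc (k + 1) s).aestronglyMeasurable ?_
    ((integrable_one_add_abs_pow_mul_exp j).const_mul C) ?_).2
  · refine Eventually.of_forall fun x r hr => h r x ?_
    have := abs_sub_abs_le_abs_sub r s
    rw [Metric.mem_ball, Real.dist_eq] at hr
    linarith
  · exact Eventually.of_forall fun x r _ => hK k r x

/-! ### The Airy function -/

/-- The integrand of the Airy integral on the line `Im z = 1`, differentiated `k` times in `s`. -/
def airyKernel (k : ℕ) (s x : ℝ) : ℂ :=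
  (Complex.I * (x + Complex.I)) ^ k *
    Complex.exp (Complex.I * (s * (x + Complex.I) + (x + Complex.I) ^ 3 / 3))

/-- The `k`-th derivative of `2π Ai`, as an absolutely convergent integral over `Im z = 1`. -/
def airyIntegral (k : ℕ) (s : ℝ) : ℂ := ∫ x, airyKernel k s x

lemma norm_airy_integrand (s x y : ℝ) :
    ‖Complex.exp (Complex.I * (s * (x + y * Complex.I) + (x + y * Complex.I) ^ 3 / 3))‖ =
      Real.exp (-s * y - x ^ 2 * y + y ^ 3 / 3) := by
  rw [Complex.norm_exp]
  congr 1
  have : Complex.I * (s * (x + y * Complex.I) + (x + y * Complex.I) ^ 3 / 3) =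
      ((-s * y - x ^ 2 * y + y ^ 3 / 3 : ℝ) : ℂ) +
        ((s * x + x ^ 3 / 3 - x * y ^ 2 : ℝ) : ℂ) * Complex.I := by
    push_cast
    linear_combination (s * y + x ^ 2 * y + Complex.I * x * y ^ 2
      + (Complex.I ^ 2 - 1) * y ^ 3 / 3) * Complex.I_sq
  rw [this, Complex.add_re, Complex.ofReal_re, Complex.re_ofReal_mul, Complex.I_re, mul_zero,
    add_zero]

lemma hasDerivAt_airyKernel (k : ℕ) (s x : ℝ) :
    HasDerivAt (fun s => airyKernel k s x) (airyKernel (k + 1) s x) s := by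
  have h1 : HasDerivAt (fun s : ℝ => Complex.I * (s * (x + Complex.I) + (x + Complex.I) ^ 3 / 3))
      (Complex.I * (x + Complex.I)) s := by
    have h := (((hasDerivAt_id s).ofReal_comp.mul_const ((x : ℂ) + Complex.I)).add_const
      (((x : ℂ) + Complex.I) ^ 3 / 3)).const_mul Complex.I
    simpa using h
  refine (h1.cexp.const_mul ((Complex.I * (x + Complex.I)) ^ k)).congr_deriv ?_
  unfold airyKernel
  ring

lemma continuous_airyKernel (k : ℕ) (s : ℝ) : Continuous (airyKernel k s) := by
  unfold airyKernel
  fun_prop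

lemma norm_airyKernel_le (k : ℕ) (s x : ℝ) :
    ‖airyKernel k s x‖ ≤ Real.exp (|s| + 1) * ((1 + |x|) ^ k * Real.exp (-x ^ 2)) := by
  have h1 := norm_airy_integrand s x 1
  simp only [Complex.ofReal_one, one_mul] at h1
  rw [airyKernel, norm_mul, h1, norm_pow]
  have h2 : ‖Complex.I * ((x : ℂ) + Complex.I)‖ ≤ 1 + |x| := by
    rw [norm_mul, Complex.norm_I, one_mul]
    refine (norm_add_le _ _).trans ?_
    rw [Complex.norm_I, Complex.norm_real, Real.norm_eq_abs, add_comm]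
  have h3 : Real.exp (-s * 1 - x ^ 2 * 1 + 1 ^ 3 / 3) ≤ Real.exp (|s| + 1) * Real.exp (-x ^ 2) := by
    rw [← Real.exp_add]
    apply Real.exp_le_exp.2
    have := neg_abs_le s
    linarith
  calc _ ≤ (1 + |x|) ^ k * (Real.exp (|s| + 1) * Real.exp (-x ^ 2)) := by gcongr
    _ = _ := by ring

lemma airyKernel_bound (k : ℕ) (A : ℝ) : ∃ (C : ℝ) (j : ℕ), ∀ s x, |s| ≤ A →
    ‖airyKernel k s x‖ ≤ C * ((1 + |x|) ^ j * Real.exp (-x ^ 2)) :=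
  ⟨Real.exp (A + 1), k, fun s x hs => (norm_airyKernel_le k s x).trans (by gcongr)⟩

lemma integrable_airyKernel (k : ℕ) (s : ℝ) : Integrable (airyKernel k s) :=
  integrable_kernel continuous_airyKernel airyKernel_bound k s

lemma hasDerivAt_airyIntegral (k : ℕ) (s : ℝ) :
    HasDerivAt (airyIntegral k) (airyIntegral (k + 1) s) s :=
  hasDerivAt_integral_kernel hasDerivAt_airyKernel continuous_airyKernel airyKernel_bound k s

/-- Airy's equation `G'' = s G`: the difference of the two integrands is a total derivative. -/
lemma airyIntegral_two (s : ℝ) : airyIntegral 2 s = s * airyIntegral 0 s := by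
  have hd : ∀ x : ℝ, HasDerivAt (fun x : ℝ => airyKernel 0 s x)
      (Complex.I * (s * airyKernel 0 s x - airyKernel 2 s x)) x := by
    intro x
    have h0 : HasDerivAt (fun x : ℝ => (x : ℂ) + Complex.I) 1 x := by
      simpa using ((hasDerivAt_id x).ofReal_comp).add_const Complex.I
    have h1 : HasDerivAt (fun x : ℝ =>
        Complex.I * (s * ((x : ℂ) + Complex.I) + ((x : ℂ) + Complex.I) ^ 3 / 3))
        (Complex.I * (s + ((x : ℂ) + Complex.I) ^ 2)) x := by
      refine (((h0.const_mul (s : ℂ)).add ((h0.pow 3).div_const 3)).const_mul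
        Complex.I).congr_deriv ?_
      push_cast
      ring
    unfold airyKernel
    simp only [pow_zero, one_mul]
    refine h1.cexp.congr_deriv ?_
    rw [mul_pow, Complex.I_sq]
    ring
  have hint : Integrable fun x => Complex.I * (s * airyKernel 0 s x - airyKernel 2 s x) :=
    (((integrable_airyKernel 0 s).const_mul (s : ℂ)).sub (integrable_airyKernel 2 s)).const_mul _
  have h := integral_eq_zero_of_hasDerivAt_of_integrable hd hint (integrable_airyKernel 0 s)
  rw [integral_const_mul, integral_sub ((integrable_airyKernel 0 s).const_mul (s : ℂ))
    (integrable_airyKernel 2 s), integral_const_mul] at h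
  have h' := (mul_eq_zero.1 h).resolve_left Complex.I_ne_zero
  exact (sub_eq_zero.1 h').symm

/-- The vertical sides of the contour contribute nothing in the limit. -/
lemma tendsto_airy_side (s : ℝ) {σ : ℝ} (hσ : |σ| = 1) :
    Tendsto (fun R : ℝ => ∫ y in (0 : ℝ)..1, Complex.exp (Complex.I *
      (s * (((σ * R : ℝ) : ℂ) + y * Complex.I) +
        (((σ * R : ℝ) : ℂ) + y * Complex.I) ^ 3 / 3))) atTop (𝓝 0) := by
  have h0 : (0 : ℂ) = ∫ y in (0 : ℝ)..1, (0 : ℂ) := by simp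
  have hσ2 : σ ^ 2 = 1 := by rw [← sq_abs, hσ, one_pow]
  rw [h0]
  refine intervalIntegral.tendsto_integral_filter_of_dominated_convergence
    (fun _ => Real.exp (|s| + 1)) ?_ ?_ ?_ ?_
  · exact Eventually.of_forall fun R => Continuous.aestronglyMeasurable (by fun_prop)
  · refine Eventually.of_forall fun R => Eventually.of_forall fun y hy => ?_
    rw [uIoc_of_le zero_le_one] at hy
    rw [norm_airy_integrand]
    apply Real.exp_le_exp.2
    have h1 : -s * y ≤ |s| := by
      have := abs_le.1 (le_refl |s|)
      nlinarith [hy.1, hy.2, abs_nonneg s, neg_abs_le s]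
    have h2 : y ^ 3 ≤ 1 := pow_le_one₀ hy.1.le hy.2
    have h3 : 0 ≤ (σ * R) ^ 2 * y := mul_nonneg (sq_nonneg _) hy.1.le
    linarith
  · exact intervalIntegrable_const
  · refine Eventually.of_forall fun y hy => ?_
    rw [uIoc_of_le zero_le_one] at hy
    rw [tendsto_zero_iff_norm_tendsto_zero]
    simp_rw [norm_airy_integrand]
    refine Real.tendsto_exp_atBot.comp ?_
    have h1 : Tendsto (fun R : ℝ => R ^ 2 * y) atTop atTop :=
      (tendsto_pow_atTop two_ne_zero).atTop_mul_const hy.1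
    have h2 := tendsto_neg_atTop_atBot.comp h1
    have h3 := tendsto_atBot_add_const_left _ (-s * y + y ^ 3 / 3) h2
    refine h3.congr fun R => ?_
    simp only [Function.comp]
    rw [mul_pow, hσ2]
    ring

lemma tendsto_airy (s : ℝ) :
    Tendsto (fun R : ℝ => (1 / (2 * (π : ℂ))) *
      ∫ x in (-R)..R, Complex.exp (Complex.I * ((s * x + x ^ 3 / 3 : ℝ) : ℂ))) atTop
      (𝓝 ((1 / (2 * (π : ℂ))) * airyIntegral 0 s)) := by
  refine Tendsto.const_mul _ ?_
  have hline : Tendsto (fun R : ℝ => ∫ x in (-R)..R, airyKernel 0 s x) atTop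
      (𝓝 (airyIntegral 0 s)) :=
    intervalIntegral_tendsto_integral (integrable_airyKernel 0 s) tendsto_neg_atTop_atBot
      tendsto_id
  have h1 := (tendsto_airy_side s (σ := 1) (by simp)).const_mul Complex.I
  have h2 := (tendsto_airy_side s (σ := -1) (by simp)).const_mul Complex.I
  have h3 := (hline.sub h1).add h2
  simp only [mul_zero, sub_zero, add_zero] at h3
  refine h3.congr fun R => ?_
  have hrect := Complex.integral_boundary_rect_eq_zero_of_differentiableOn
    (fun z : ℂ => Complex.exp (Complex.I * (s * z + z ^ 3 / 3))) (((-R : ℝ) : ℂ))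
    (((R : ℝ) : ℂ) + Complex.I) (by fun_prop)
  simp only [Complex.ofReal_re, Complex.ofReal_im, Complex.add_re, Complex.add_im, Complex.I_re,
    Complex.I_im, add_zero, zero_add, Complex.ofReal_zero, zero_mul, Complex.ofReal_one, one_mul,
    smul_eq_mul] at hrect
  simp only [airyKernel, pow_zero, one_mul, neg_mul]
  have e : (∫ x in (-R)..R, Complex.exp (Complex.I * ((s * x + x ^ 3 / 3 : ℝ) : ℂ))) =
      ∫ x in (-R)..R, Complex.exp (Complex.I * (s * (x : ℂ) + (x : ℂ) ^ 3 / 3)) := by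
    push_cast
    rfl
  rw [e]
  linear_combination -hrect

lemma airyAi_eq (s : ℝ) : airyAi s = (1 / (2 * (π : ℂ))) * airyIntegral 0 s :=
  (tendsto_airy s).limUnder_eq

lemma airyAi_conj (s : ℝ) : (starRingEnd ℂ) (airyAi s) = airyAi s := by
  have h := tendsto_airy s
  rw [← airyAi_eq] at h
  have h1 := (Complex.continuous_conj.tendsto _).comp h
  refine tendsto_nhds_unique h1 (h.congr fun R => ?_)
  simp only [Function.comp, map_mul, map_div₀, map_one, map_ofNat, Complex.conj_ofReal]
  congr 1
  rw [← intervalIntegral.intervalIntegral_conj]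
  have e : ∀ x : ℝ, (starRingEnd ℂ) (Complex.exp (Complex.I * ((s * x + x ^ 3 / 3 : ℝ) : ℂ))) =
      Complex.exp (Complex.I * ((s * (-x) + (-x) ^ 3 / 3 : ℝ) : ℂ)) := by
    intro x
    rw [← Complex.exp_conj, map_mul, Complex.conj_I, Complex.conj_ofReal]
    congr 1
    push_cast
    ring
  simp_rw [e]
  rw [intervalIntegral.integral_comp_neg (fun x : ℝ =>
    Complex.exp (Complex.I * ((s * x + x ^ 3 / 3 : ℝ) : ℂ))), neg_neg]

/-- The Airy function is not identically zero: its Fourier transform is not. -/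
lemma exists_airyAi_ne_zero : ∃ s : ℝ, airyAi s ≠ 0 := by
  by_contra! hzero
  have hI : ∀ s, airyIntegral 0 s = 0 := fun s => by
    have h := hzero s
    rw [airyAi_eq] at h
    exact (mul_eq_zero.1 h).resolve_left (by simp [Real.pi_ne_zero])
  have hF : (FourierTransform.fourier (airyKernel 0 0) : ℝ → ℂ) = 0 := by
    funext v
    have h := hI (-2 * π * v)
    rw [Real.fourier_eq']
    have e : ∀ x : ℝ, Complex.exp ((↑(-2 * π * inner ℝ x v) : ℂ) * Complex.I) • airyKernel 0 0 x
        = Complex.exp (-2 * π * v) * airyKernel 0 (-2 * π * v) x := by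
      intro x
      simp only [airyKernel, pow_zero, one_mul, smul_eq_mul, ← Complex.exp_add, RCLike.inner_apply,
        conj_trivial]
      congr 1
      push_cast
      linear_combination (2 * π * v) * Complex.I_sq
    simp_rw [e]
    rw [integral_const_mul]
    exact mul_eq_zero_of_right _ h
  have hinv := (continuous_airyKernel 0 0).fourierInv_fourier_eq (integrable_airyKernel 0 0)
    (by rw [hF]; exact integrable_zero _ _ _)
  have h0 := congrFun hinv 0
  rw [hF] at h0
  have : airyKernel 0 0 0 = 0 := by
    rw [← h0, Real.fourierInv_eq']
    simp
  simp [airyKernel] at this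

/-- The real-valued function `t ↦ Ai (-t)`. -/
def airyNeg (t : ℝ) : ℝ := (airyAi (-t)).re

/-- The derivative of `t ↦ Ai (-t)`. -/
def airyNegDeriv (t : ℝ) : ℝ := -((1 / (2 * (π : ℂ))) * airyIntegral 1 (-t)).re

lemma airyAi_neg_eq (t : ℝ) : airyAi (-t) = airyNeg t :=
  (Complex.conj_eq_iff_re.1 (airyAi_conj (-t))).symm

lemma hasDerivAt_airyNeg (t : ℝ) : HasDerivAt airyNeg (airyNegDeriv t) t := by
  have h := ((hasDerivAt_airyIntegral 0 (-t)).scomp t (hasDerivAt_neg t)).const_mul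
    (1 / (2 * (π : ℂ)))
  have h2 := (Complex.reCLM.hasFDerivAt.comp_hasDerivAt t h)
  refine (h2.congr_deriv ?_).congr_of_eventuallyEq (Eventually.of_forall fun u => ?_)
  · simp [airyNegDeriv]
  · simp [airyNeg, airyAi_eq]

lemma hasDerivAt_airyNegDeriv (t : ℝ) : HasDerivAt airyNegDeriv (-t * airyNeg t) t := by
  have h := ((hasDerivAt_airyIntegral 1 (-t)).scomp t (hasDerivAt_neg t)).const_mul
    (1 / (2 * (π : ℂ)))
  have h2 := (Complex.reCLM.hasFDerivAt.comp_hasDerivAt t h).neg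
  refine (h2.congr_deriv ?_).congr_of_eventuallyEq (Eventually.of_forall fun u => ?_)
  · rw [airyNeg, airyAi_eq, airyIntegral_two]
    have : (1 / (2 * (π : ℂ)) * (((-t : ℝ) : ℂ) * airyIntegral 0 (-t))) =
      ((-t : ℝ) : ℂ) * (1 / (2 * (π : ℂ)) * airyIntegral 0 (-t)) := by ring
    simp only [neg_smul, one_smul, mul_neg, map_neg, neg_neg, Complex.reCLM_apply, this]
    rw [Complex.re_ofReal_mul]
  · simp [airyNegDeriv]

lemma exists_airyNeg_ne_zero : ∃ t : ℝ, airyNeg t ≠ 0 := by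
  obtain ⟨s, hs⟩ := exists_airyAi_ne_zero
  refine ⟨-s, fun h => hs ?_⟩
  have := airyAi_neg_eq (-s)
  rw [neg_neg, h] at this
  simpa using this

/-! ### Modulus and phase of the solutions of `y'' + t y = 0` -/

/-- The integrand of `airyModulus`. -/
def modulusKernel (k : ℕ) (t v : ℝ) : ℝ := (-v ^ 2) ^ k * Real.exp (-t * v ^ 2 - v ^ 6 / 12)

/-- `airyModulus 0 t = ∫ exp (-t v² - v⁶ / 12) dv` is, up to a constant factor, the squared modulus
`Ai(-t)² + Bi(-t)²`; `airyModulus k` is its `k`-th derivative. -/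
def airyModulus (k : ℕ) (t : ℝ) : ℝ := ∫ v, modulusKernel k t v

lemma hasDerivAt_modulusKernel (k : ℕ) (t v : ℝ) :
    HasDerivAt (fun t => modulusKernel k t v) (modulusKernel (k + 1) t v) t := by
  have h1 : HasDerivAt (fun t : ℝ => -t * v ^ 2 - v ^ 6 / 12) (-v ^ 2) t := by
    simpa using ((hasDerivAt_neg t).mul_const (v ^ 2)).sub_const (v ^ 6 / 12)
  refine (h1.exp.const_mul ((-v ^ 2) ^ k)).congr_deriv ?_
  unfold modulusKernel
  ring

lemma continuous_modulusKernel (k : ℕ) (t : ℝ) : Continuous (modulusKernel k t) := by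
  unfold modulusKernel
  fun_prop

lemma modulusKernel_bound (k : ℕ) (A : ℝ) : ∃ (C : ℝ) (j : ℕ), ∀ t v, |t| ≤ A →
    ‖modulusKernel k t v‖ ≤ C * ((1 + |v|) ^ j * Real.exp (-v ^ 2)) := by
  refine ⟨Real.exp ((A + 1) * (12 * (A + 1) + 1)), 2 * k, fun t v ht => ?_⟩
  have hA : 0 ≤ A := (abs_nonneg t).trans ht
  have h1 : (-t * v ^ 2 - v ^ 6 / 12) ≤ (A + 1) * (12 * (A + 1) + 1) + -v ^ 2 := by
    have e : v ^ 6 = v ^ 2 * (v ^ 2) ^ 2 := by ring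
    have hu := sq_nonneg v
    rw [e]
    generalize v ^ 2 = u at hu
    have h2 : -t * u ≤ A * u := by
      have := neg_abs_le t
      nlinarith
    rcases le_total u (12 * (A + 1) + 1) with h | h
    · nlinarith [mul_nonneg hu (sq_nonneg u)]
    · have h3 : 12 * (A + 1) ≤ u ^ 2 := by nlinarith
      nlinarith [mul_le_mul_of_nonneg_left h3 hu]
  have h2 : |v ^ 2| ^ k ≤ (1 + |v|) ^ (2 * k) := by
    rw [abs_pow, pow_mul]
    gcongr
    linarith
  rw [modulusKernel, norm_mul, Real.norm_of_nonneg (Real.exp_pos _).le, norm_pow, norm_neg,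
    Real.norm_eq_abs]
  calc _ ≤ (1 + |v|) ^ (2 * k) * Real.exp ((A + 1) * (12 * (A + 1) + 1) + -v ^ 2) := by gcongr
    _ = _ := by rw [Real.exp_add]; ring

lemma integrable_modulusKernel (k : ℕ) (t : ℝ) : Integrable (modulusKernel k t) :=
  integrable_kernel continuous_modulusKernel modulusKernel_bound k t

lemma hasDerivAt_airyModulus (k : ℕ) (t : ℝ) :
    HasDerivAt (airyModulus k) (airyModulus (k + 1) t) t :=
  hasDerivAt_integral_kernel hasDerivAt_modulusKernel continuous_modulusKernel
    modulusKernel_bound k t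

lemma continuous_airyModulus (k : ℕ) : Continuous (airyModulus k) :=
  continuous_iff_continuousAt.2 fun t => (hasDerivAt_airyModulus k t).continuousAt

lemma airyModulus_pos (t : ℝ) : 0 < airyModulus 0 t := by
  have hpos : ∀ v, 0 < modulusKernel 0 t v := fun v => by
    simp [modulusKernel, Real.exp_pos]
  refine (integral_pos_iff_support_of_nonneg (fun v => (hpos v).le)
    (integrable_modulusKernel 0 t)).2 ?_
  have : Function.support (modulusKernel 0 t) = univ :=
    Function.support_eq_univ fun v => (hpos v).ne'
  simp [this]

/-- The linear equation of third order satisfied by products of two solutions of `y'' + t y = 0`: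
the integrand of the left-hand side is a total derivative. -/
lemma airyModulus_three (t : ℝ) :
    airyModulus 3 t + 4 * t * airyModulus 1 t + 2 * airyModulus 0 t = 0 := by
  have hd : ∀ v : ℝ, HasDerivAt (fun v : ℝ => 2 * v * modulusKernel 0 t v)
      (modulusKernel 3 t v + 4 * t * modulusKernel 1 t v + 2 * modulusKernel 0 t v) v := by
    intro v
    have h1 : HasDerivAt (fun v : ℝ => -t * v ^ 2 - v ^ 6 / 12) (-t * (2 * v) - v ^ 5 / 2) v := by
      refine (((hasDerivAt_pow 2 v).const_mul (-t)).sub ((hasDerivAt_pow 6 v).div_const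
        12)).congr_deriv ?_
      push_cast
      ring
    simp only [modulusKernel, pow_zero, one_mul]
    refine (((hasDerivAt_id v).const_mul 2).mul h1.exp).congr_deriv ?_
    simp only [id, mul_one]
    ring
  have i3 := integrable_modulusKernel 3 t
  have i1 := (integrable_modulusKernel 1 t).const_mul (4 * t)
  have i0 := (integrable_modulusKernel 0 t).const_mul 2
  have iv : Integrable fun v : ℝ => 2 * v * modulusKernel 0 t v := by
    obtain ⟨C, j, h⟩ := modulusKernel_bound 0 |t|
    refine ((integrable_one_add_abs_pow_mul_exp (j + 1)).const_mul (2 * C)).mono'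
      (by unfold modulusKernel; fun_prop) (Eventually.of_forall fun v => ?_)
    have hv := h t v le_rfl
    have h1 : |v| ≤ 1 + |v| := by linarith
    rw [norm_mul, norm_mul, Real.norm_eq_abs v, Real.norm_eq_abs 2, abs_two]
    calc 2 * |v| * ‖modulusKernel 0 t v‖
        ≤ 2 * (1 + |v|) * (C * ((1 + |v|) ^ j * Real.exp (-v ^ 2))) := by gcongr
      _ = _ := by ring
  have h := integral_eq_zero_of_hasDerivAt_of_integrable hd ((i3.add i1).add i0) iv
  have h' := integral_add (i3.add i1) i0
  simp only [Pi.add_apply] at h'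
  rw [h', integral_add i3 i1, integral_const_mul, integral_const_mul] at h
  exact h

/-- The rescaled modulus: `airyModulus k t = t ^ (-k - 1/2) * scaledModulus k t`. -/
def scaledModulus (k : ℕ) (t : ℝ) : ℝ :=
  ∫ u : ℝ, (-u ^ 2) ^ k * Real.exp (-u ^ 2 - u ^ 6 / (12 * t ^ 3))

lemma airyModulus_eq_scaled (k : ℕ) {t : ℝ} (ht : 0 < t) :
    airyModulus k t = (t ^ k)⁻¹ * (√t)⁻¹ * scaledModulus k t := by
  have h := Measure.integral_comp_mul_left
    (fun u : ℝ => (-u ^ 2) ^ k * Real.exp (-u ^ 2 - u ^ 6 / (12 * t ^ 3))) (√t)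
  have hs := Real.sq_sqrt ht.le
  have e : ∀ v : ℝ, modulusKernel k t v = (t ^ k)⁻¹ *
      ((-(√t * v) ^ 2) ^ k * Real.exp (-(√t * v) ^ 2 - (√t * v) ^ 6 / (12 * t ^ 3))) := by
    intro v
    have e1 : (√t * v) ^ 6 = t ^ 3 * v ^ 6 := by
      rw [show (√t * v) ^ 6 = (√t ^ 2) ^ 3 * v ^ 6 by ring, hs]
    have e2 : (√t * v) ^ 2 = t * v ^ 2 := by rw [mul_pow, hs]
    rw [modulusKernel, e1, e2, show -(t * v ^ 2) = t * -v ^ 2 by ring, mul_pow,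
      show t * -v ^ 2 - t ^ 3 * v ^ 6 / (12 * t ^ 3) = -t * v ^ 2 - v ^ 6 / 12 by
        field_simp]
    field_simp
  rw [airyModulus]
  simp_rw [e]
  rw [integral_const_mul, h, abs_of_pos (by positivity), smul_eq_mul, scaledModulus, mul_assoc]

lemma norm_scaled_integrand_le (k : ℕ) {t : ℝ} (ht : 0 < t) (u : ℝ) :
    ‖(-u ^ 2) ^ k * Real.exp (-u ^ 2 - u ^ 6 / (12 * t ^ 3))‖ ≤
      (1 + |u|) ^ (2 * k) * Real.exp (-u ^ 2) := by
  rw [norm_mul, Real.norm_of_nonneg (Real.exp_pos _).le, norm_pow, norm_neg, Real.norm_eq_abs,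
    abs_pow, pow_mul]
  have : 0 ≤ u ^ 6 / (12 * t ^ 3) := by positivity
  gcongr
  · linarith
  · linarith

lemma abs_scaledModulus_le (k : ℕ) :
    ∃ C : ℝ, ∀ t : ℝ, 0 < t → |scaledModulus k t| ≤ C :=
  ⟨∫ u : ℝ, (1 + |u|) ^ (2 * k) * Real.exp (-u ^ 2), fun _ ht =>
    norm_integral_le_of_norm_le (integrable_one_add_abs_pow_mul_exp (2 * k))
      (Eventually.of_forall fun u => norm_scaled_integrand_le k ht u)⟩

lemma tendsto_scaledModulus_zero : Tendsto (scaledModulus 0) atTop (𝓝 √π) := by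
  have h1 : (√π : ℝ) = ∫ u : ℝ, Real.exp (-u ^ 2) := by
    have := integral_gaussian 1
    simp only [neg_mul, one_mul, div_one] at this
    exact this.symm
  rw [h1]
  refine tendsto_integral_filter_of_dominated_convergence
    (fun u => (1 + |u|) ^ (2 * 0) * Real.exp (-u ^ 2)) ?_ ?_
    (integrable_one_add_abs_pow_mul_exp (2 * 0)) ?_
  · exact Eventually.of_forall fun t => Continuous.aestronglyMeasurable (by fun_prop)
  · filter_upwards [eventually_gt_atTop 0] with t ht
    exact Eventually.of_forall fun u => norm_scaled_integrand_le 0 ht u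
  · refine Eventually.of_forall fun u => ?_
    simp only [pow_zero, one_mul]
    refine (Real.continuous_exp.tendsto _).comp ?_
    have : Tendsto (fun t : ℝ => u ^ 6 / (12 * t ^ 3)) atTop (𝓝 0) :=
      ((tendsto_pow_atTop three_ne_zero).const_mul_atTop (by norm_num)).const_div_atTop _
    simpa using this.const_sub (-u ^ 2)

/-- A first integral of `w''' + 4 t w' + 2 w = 0`, where `w` is `airyModulus 0`, with its value
found at infinity. -/
lemma airyModulus_first_integral (t : ℝ) :
    2 * airyModulus 0 t * airyModulus 2 t - airyModulus 1 t ^ 2 + 4 * t * airyModulus 0 t ^ 2 =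
      4 * π := by
  set c : ℝ → ℝ := fun t =>
    2 * airyModulus 0 t * airyModulus 2 t - airyModulus 1 t ^ 2 + 4 * t * airyModulus 0 t ^ 2
    with hc
  have hd : ∀ t, HasDerivAt c 0 t := by
    intro t
    have h0 := hasDerivAt_airyModulus 0 t
    have h1 := hasDerivAt_airyModulus 1 t
    have h2 := hasDerivAt_airyModulus 2 t
    refine ((((h0.const_mul 2).mul h2).sub (h1.pow 2)).add
      (((hasDerivAt_id t).const_mul 4).mul (h0.pow 2))).congr_deriv ?_
    simp only [id, Pi.pow_apply, Nat.cast_ofNat, zero_add, Nat.reduceAdd, mul_one,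
      Nat.add_one_sub_one, pow_one]
    linear_combination (2 * airyModulus 0 t) * airyModulus_three t
  have hconst : ∀ s, c s = c t := fun s =>
    is_const_of_deriv_eq_zero (fun x => (hd x).differentiableAt) (fun x => (hd x).deriv) s t
  have hlim : Tendsto c atTop (𝓝 (4 * π)) := by
    obtain ⟨C0, h0⟩ := abs_scaledModulus_le 0
    obtain ⟨C1, h1⟩ := abs_scaledModulus_le 1
    obtain ⟨C2, h2⟩ := abs_scaledModulus_le 2
    have hmain : Tendsto (fun t => 4 * scaledModulus 0 t ^ 2) atTop (𝓝 (4 * π)) := by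
      have := (tendsto_scaledModulus_zero.pow 2).const_mul 4
      rwa [Real.sq_sqrt Real.pi_pos.le] at this
    have herr : Tendsto (fun t => (t ^ 3)⁻¹ *
        (2 * scaledModulus 0 t * scaledModulus 2 t - scaledModulus 1 t ^ 2)) atTop (𝓝 0) := by
      refine Tendsto.zero_mul_isBoundedUnder_le
        (tendsto_inv_atTop_zero.comp (tendsto_pow_atTop three_ne_zero))
        (isBoundedUnder_of_eventually_le (a := 2 * C0 * C2 + C1 ^ 2) ?_)
      filter_upwards [eventually_gt_atTop 0] with t ht
      have a0 := h0 t ht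
      have a1 := h1 t ht
      have a2 := h2 t ht
      have b0 := (abs_nonneg _).trans a0
      simp only [Function.comp, Real.norm_eq_abs]
      refine (abs_sub _ _).trans ?_
      rw [abs_mul, abs_mul, abs_two, abs_pow]
      gcongr
    have h := hmain.add herr
    rw [add_zero] at h
    refine h.congr' ?_
    filter_upwards [eventually_gt_atTop 0] with t ht
    have hs := Real.sq_sqrt ht.le
    have hs0 : √t ≠ 0 := by positivity
    simp only [hc, airyModulus_eq_scaled _ ht]
    generalize scaledModulus 0 t = m0
    generalize scaledModulus 1 t = m1
    generalize scaledModulus 2 t = m2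
    generalize √t = r at hs hs0
    subst hs
    field_simp
    ring
  have := tendsto_nhds_unique (hlim.congr hconst) tendsto_const_nhds
  exact this.symm

lemma abs_airyModulus_le (k : ℕ) :
    ∃ C : ℝ, ∀ t : ℝ, 0 < t → |airyModulus k t| ≤ C * ((t ^ k)⁻¹ * (√t)⁻¹) := by
  obtain ⟨C, hC⟩ := abs_scaledModulus_le k
  refine ⟨C, fun t ht => ?_⟩
  rw [airyModulus_eq_scaled k ht, abs_mul, abs_of_nonneg (by positivity), mul_comm]
  exact mul_le_mul_of_nonneg_right (hC t ht) (by positivity)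

/-- The phase `θ`, normalized by `θ 0 = 0`. -/
def airyPhase (t : ℝ) : ℝ := ∫ u in (0 : ℝ)..t, √π / airyModulus 0 u

lemma hasDerivAt_airyPhase (t : ℝ) : HasDerivAt airyPhase (√π / airyModulus 0 t) t := by
  have hc : Continuous fun u => √π / airyModulus 0 u :=
    continuous_const.div (continuous_airyModulus 0) fun u => (airyModulus_pos u).ne'
  exact (hc.integral_hasStrictDerivAt 0 t).hasDerivAt

lemma strictMono_airyPhase : StrictMono airyPhase :=
  strictMono_of_hasDerivAt_pos (fun t => hasDerivAt_airyPhase t) fun t =>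
    div_pos (by positivity) (airyModulus_pos t)

lemma airyPhase_zero : airyPhase 0 = 0 := by simp [airyPhase]

lemma continuous_airyPhase : Continuous airyPhase :=
  continuous_iff_continuousAt.2 fun t => (hasDerivAt_airyPhase t).continuousAt

lemma airyModulus_antitone : Antitone (airyModulus 0) := by
  intro s t hst
  refine integral_mono (integrable_modulusKernel 0 t) (integrable_modulusKernel 0 s) fun v => ?_
  simp only [modulusKernel, pow_zero, one_mul]
  apply Real.exp_le_exp.2
  nlinarith [sq_nonneg v]

lemma tendsto_airyPhase : Tendsto airyPhase atTop atTop := by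
  have h0 := airyModulus_pos 0
  have hc : 0 < √π / airyModulus 0 0 := by positivity
  refine tendsto_atTop_mono' _ ?_ (tendsto_id.atTop_mul_const hc)
  filter_upwards [eventually_ge_atTop 0] with t ht
  have h := Convex.mul_sub_le_image_sub_of_le_deriv (convex_Ici (0 : ℝ))
    continuous_airyPhase.continuousOn
    (fun x _ => (hasDerivAt_airyPhase x).differentiableAt.differentiableWithinAt)
    (C := √π / airyModulus 0 0) (fun x hx => ?_) 0 self_mem_Ici t ht ht
  · rw [airyPhase_zero, sub_zero, sub_zero] at h
    simpa [mul_comm] using h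
  · rw [(hasDerivAt_airyPhase x).deriv]
    rw [interior_Ici] at hx
    exact div_le_div_of_nonneg_left (by positivity) (airyModulus_pos x)
      (airyModulus_antitone (le_of_lt hx))

/-- The solution of `y'' + t y = 0` with modulus `√w` and phase `θ`. -/
def airyWave (t : ℝ) : ℂ := √(airyModulus 0 t) * Complex.exp (airyPhase t * Complex.I)

/-- The logarithmic derivative of `airyWave`. -/
def airyWaveLog (t : ℝ) : ℂ :=
  ((airyModulus 1 t / (2 * airyModulus 0 t) : ℝ) : ℂ) + ((√π / airyModulus 0 t : ℝ) : ℂ) * Complex.I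

lemma hasDerivAt_airyWave (t : ℝ) : HasDerivAt airyWave (airyWaveLog t * airyWave t) t := by
  have hw := airyModulus_pos t
  have h1 := ((hasDerivAt_airyModulus 0 t).sqrt hw.ne').ofReal_comp
  have h2 := ((hasDerivAt_airyPhase t).ofReal_comp.mul_const Complex.I).cexp
  refine (h1.mul h2).congr_deriv ?_
  have hs := Real.mul_self_sqrt hw.le
  have hs0 : (√(airyModulus 0 t) : ℂ) ≠ 0 := by exact_mod_cast (Real.sqrt_pos.2 hw).ne'
  have hs' : (√(airyModulus 0 t) : ℂ) * √(airyModulus 0 t) = airyModulus 0 t := by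
    exact_mod_cast hs
  have hw0 : (airyModulus 0 t : ℂ) ≠ 0 := by exact_mod_cast hw.ne'
  unfold airyWave airyWaveLog
  push_cast
  field_simp
  linear_combination (-(airyModulus 1 t : ℂ)) * hs'

/-- The Riccati equation of `y'' + t y = 0`, a form of the first integral. -/
lemma hasDerivAt_airyWaveLog (t : ℝ) :
    HasDerivAt airyWaveLog (-t - airyWaveLog t ^ 2) t := by
  have hw := (airyModulus_pos t).ne'
  have h0 := hasDerivAt_airyModulus 0 t
  have h1 := hasDerivAt_airyModulus 1 t
  have h2 := (h1.div (h0.const_mul 2) (by positivity)).ofReal_comp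
  have h3 := (((hasDerivAt_const t √π).div h0 hw).ofReal_comp).mul_const Complex.I
  refine (h2.add h3).congr_deriv ?_
  have hw0 : (airyModulus 0 t : ℂ) ≠ 0 := by exact_mod_cast hw
  have hfi : 2 * (airyModulus 0 t : ℂ) * airyModulus 2 t - (airyModulus 1 t : ℂ) ^ 2 +
      4 * t * (airyModulus 0 t : ℂ) ^ 2 = 4 * π := by
    exact_mod_cast congrArg (fun x : ℝ => (x : ℂ)) (airyModulus_first_integral t)
  have hpi : (√π : ℂ) ^ 2 = π := by exact_mod_cast Real.sq_sqrt Real.pi_pos.le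
  unfold airyWaveLog
  push_cast
  field_simp
  linear_combination hfi + 4 * hpi * Complex.I ^ 2 + 4 * (π : ℂ) * Complex.I_sq

/-- `Ai (-t)` vanishes exactly where the phase lies in a coset of `π ℤ`. -/
lemma exists_airyNeg_eq_zero_iff :
    ∃ c ∈ Ioc 0 π, ∀ t, airyNeg t = 0 ↔ ∃ k : ℤ, airyPhase t = c + k * π := by
  -- The Wronskian of `airyNeg` and `airyWave` is constant.
  set K : ℝ → ℂ := fun t => (airyNeg t * airyWaveLog t - airyNegDeriv t) * airyWave t with hK
  have hd : ∀ t, HasDerivAt K 0 t := fun t => by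
    refine (((((hasDerivAt_airyNeg t).ofReal_comp).mul (hasDerivAt_airyWaveLog t)).sub
      (hasDerivAt_airyNegDeriv t).ofReal_comp).mul (hasDerivAt_airyWave t)).congr_deriv ?_
    push_cast
    simp only [Pi.sub_apply, Pi.mul_apply]
    ring
  have hconst : ∀ t, K t = K 0 := fun t =>
    is_const_of_deriv_eq_zero (fun x => (hd x).differentiableAt) (fun x => (hd x).deriv) t 0
  have key : ∀ t, airyNeg t * √π * √(airyModulus 0 t) = airyModulus 0 t *
      (‖K 0‖ * Real.sin ((K 0).arg - airyPhase t)) := by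
    intro t
    have hw := (airyModulus_pos t).ne'
    have h1 : K 0 * Complex.exp (-(airyPhase t) * Complex.I) =
        (airyNeg t * airyWaveLog t - airyNegDeriv t) * √(airyModulus 0 t) := by
      rw [← hconst t, hK]
      simp only [airyWave]
      have : Complex.exp (airyPhase t * Complex.I) *
          Complex.exp (-(airyPhase t) * Complex.I) = 1 := by
        rw [← Complex.exp_add]
        simp
      linear_combination ((airyNeg t * airyWaveLog t - airyNegDeriv t) * √(airyModulus 0 t)) * this
    have h2 : K 0 * Complex.exp (-(airyPhase t) * Complex.I) =
        (‖K 0‖ : ℂ) * Complex.exp ((((K 0).arg - airyPhase t : ℝ) : ℂ) * Complex.I) := by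
      conv_lhs => rw [← Complex.norm_mul_exp_arg_mul_I (K 0)]
      rw [mul_assoc, ← Complex.exp_add]
      push_cast
      ring_nf
    have h3 := congrArg Complex.im (h2.symm.trans h1)
    rw [Complex.im_ofReal_mul, Complex.exp_ofReal_mul_I_im, mul_comm _ (√(airyModulus 0 t) : ℂ),
      Complex.im_ofReal_mul] at h3
    rw [h3]
    simp only [airyWaveLog, Complex.sub_im, Complex.im_ofReal_mul, Complex.add_im,
      Complex.ofReal_im, Complex.I_im]
    field_simp
    ring
  have hK0 : K 0 ≠ 0 := by
    intro h
    obtain ⟨t, ht⟩ := exists_airyNeg_ne_zero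
    have h1 := key t
    rw [h, norm_zero, zero_mul, mul_zero] at h1
    have : √(airyModulus 0 t) ≠ 0 := (Real.sqrt_pos.2 (airyModulus_pos t)).ne'
    have hp : √π ≠ 0 := by positivity
    exact ht (by simpa only [mul_eq_zero, this, hp, or_false] using h1)
  refine ⟨toIocMod Real.pi_pos 0 (K 0).arg, by simpa using toIocMod_mem_Ioc Real.pi_pos 0 _,
    fun t => ?_⟩
  have hs : airyNeg t = 0 ↔ Real.sin ((K 0).arg - airyPhase t) = 0 := by
    have h1 := key t
    have h2 : √(airyModulus 0 t) ≠ 0 := (Real.sqrt_pos.2 (airyModulus_pos t)).ne'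
    have h3 := (airyModulus_pos t).ne'
    have h4 : ‖K 0‖ ≠ 0 := by simpa using hK0
    have hp : √π ≠ 0 := by positivity
    constructor
    · intro h
      rw [h, zero_mul, zero_mul] at h1
      simpa only [zero_eq_mul, mul_eq_zero, h3, h4, false_or] using h1
    · intro h
      rw [h, mul_zero, mul_zero] at h1
      simpa only [mul_eq_zero, h2, hp, or_false] using h1
  rw [hs, Real.sin_eq_zero_iff]
  have hm := toIocMod_add_toIocDiv_zsmul Real.pi_pos 0 (K 0).arg
  rw [zsmul_eq_mul] at hm
  constructor
  · rintro ⟨n, hn⟩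
    refine ⟨toIocDiv Real.pi_pos 0 (K 0).arg - n, ?_⟩
    push_cast
    linarith
  · rintro ⟨k, hk⟩
    refine ⟨toIocDiv Real.pi_pos 0 (K 0).arg - k, ?_⟩
    push_cast
    linarith

/-! ### The roots of the Airy function as values of a smooth function -/

/-- The inverse of the phase on the half line `[0, ∞)`. -/
def airyPhaseInv (x : ℝ) : ℝ := Function.invFunOn airyPhase (Ici 0) x

lemma surjOn_airyPhase : SurjOn airyPhase (Ici 0) (Ici 0) := by
  intro x hx
  obtain ⟨b, hb0, hb⟩ := ((eventually_ge_atTop 0).and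
    (tendsto_airyPhase.eventually_ge_atTop x)).exists
  have h := intermediate_value_Icc hb0 continuous_airyPhase.continuousOn
  rw [airyPhase_zero] at h
  obtain ⟨t, ht, rfl⟩ := h ⟨hx, hb⟩
  exact ⟨t, ht.1, rfl⟩

lemma airyPhaseInv_nonneg {x : ℝ} (hx : 0 ≤ x) : 0 ≤ airyPhaseInv x :=
  Function.invFunOn_mem (surjOn_airyPhase hx)

lemma airyPhase_airyPhaseInv {x : ℝ} (hx : 0 ≤ x) : airyPhase (airyPhaseInv x) = x :=
  Function.invFunOn_eq (surjOn_airyPhase hx)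

lemma airyPhaseInv_airyPhase {t : ℝ} (ht : 0 ≤ t) : airyPhaseInv (airyPhase t) = t := by
  have h : 0 ≤ airyPhase t := by
    rw [← airyPhase_zero]
    exact strictMono_airyPhase.monotone ht
  exact strictMono_airyPhase.injective (airyPhase_airyPhaseInv h)

lemma strictMonoOn_airyPhaseInv : StrictMonoOn airyPhaseInv (Ici 0) := by
  intro x hx y hy hxy
  rw [← strictMono_airyPhase.lt_iff_lt, airyPhase_airyPhaseInv hx, airyPhase_airyPhaseInv hy]
  exact hxy

lemma airyPhaseInv_zero : airyPhaseInv 0 = 0 := by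
  have h := airyPhaseInv_airyPhase le_rfl
  rwa [airyPhase_zero] at h

lemma airyPhaseInv_pos {x : ℝ} (hx : 0 < x) : 0 < airyPhaseInv x := by
  rw [← airyPhaseInv_zero]
  exact strictMonoOn_airyPhaseInv self_mem_Ici hx.le hx

lemma hasDerivAt_airyPhaseInv {x : ℝ} (hx : 0 < x) :
    HasDerivAt airyPhaseInv (airyModulus 0 (airyPhaseInv x) / √π) x := by
  have himg : airyPhaseInv '' Ici 0 ∈ 𝓝 (airyPhaseInv x) := by
    refine mem_of_superset (Ici_mem_nhds (airyPhaseInv_pos hx)) fun t ht => ?_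
    refine ⟨airyPhase t, ?_, airyPhaseInv_airyPhase ht⟩
    rw [mem_Ici, ← airyPhase_zero]
    exact strictMono_airyPhase.monotone ht
  have hcont : ContinuousAt airyPhaseInv x :=
    continuousAt_of_monotoneOn_of_image_mem_nhds strictMonoOn_airyPhaseInv.monotoneOn
      (Ici_mem_nhds hx) himg
  have hw := (airyModulus_pos (airyPhaseInv x)).ne'
  have hp : √π ≠ 0 := by positivity
  have h := HasDerivAt.of_local_left_inverse hcont (hasDerivAt_airyPhase (airyPhaseInv x))
    (div_ne_zero hp hw) (by
      filter_upwards [Ici_mem_nhds hx] with y hy using airyPhase_airyPhaseInv hy)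
  rwa [inv_div] at h

lemma tendsto_airyPhaseInv : Tendsto airyPhaseInv atTop atTop := by
  refine tendsto_atTop.2 fun b => ?_
  filter_upwards [eventually_ge_atTop (airyPhase (max b 0)), eventually_ge_atTop 0] with x hx hx0
  refine (le_max_left b 0).trans ?_
  rw [← strictMono_airyPhase.le_iff_le, airyPhase_airyPhaseInv hx0]
  exact hx

/-- Consecutive roots differ in phase by `π`, so that the `m`-th root is the value of a smooth
function at `m`. -/
lemma exists_airyRoot_eq :
    ∃ c : ℝ, ∀ m : ℕ, 1 ≤ m → airyRoot m = airyPhaseInv (π * m + c) := by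
  obtain ⟨c, ⟨hc0, hcπ⟩, hc⟩ := exists_airyNeg_eq_zero_iff
  have hzero : ∀ t, airyAi (-t) = 0 ↔ ∃ k : ℤ, airyPhase t = c + k * π := fun t => by
    rw [airyAi_neg_eq, Complex.ofReal_eq_zero, hc]
  have hpos : ∀ m : ℕ, 0 < c + m * π := fun m => by positivity
  -- If the phase at the preceding root exceeds `c + (m - 1) π - π`, the next root has
  -- phase `c + m π`.
  have hstep : ∀ m : ℕ, 0 ≤ airyRoot m → airyPhase (airyRoot m) < c + m * π →
      c + m * π - π ≤ airyPhase (airyRoot m) →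
      airyRoot (m + 1) = airyPhaseInv (c + m * π) := by
    intro m h0 h1 h2
    rw [airyRoot]
    refine IsLeast.csInf_eq ⟨⟨?_, ?_⟩, ?_⟩
    · rw [← strictMono_airyPhase.lt_iff_lt, airyPhase_airyPhaseInv (hpos m).le]
      exact h1
    · rw [hzero]
      exact ⟨m, by rw [airyPhase_airyPhaseInv (hpos m).le]; simp⟩
    · rintro t ⟨ht, hz⟩
      obtain ⟨k, hk⟩ := (hzero t).1 hz
      rw [← strictMono_airyPhase.lt_iff_lt, hk] at ht
      rw [← strictMono_airyPhase.le_iff_le, airyPhase_airyPhaseInv (hpos m).le, hk]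
      have hlt : ((m : ℤ) : ℝ) - 1 < k := by
        push_cast
        nlinarith [Real.pi_pos]
      have : (m : ℤ) ≤ k := by
        have : (m : ℤ) - 1 < k := by exact_mod_cast hlt
        omega
      have : ((m : ℤ) : ℝ) ≤ k := by exact_mod_cast this
      push_cast at this
      gcongr
  have hall : ∀ m : ℕ, airyRoot (m + 1) = airyPhaseInv (c + m * π) := by
    intro m
    induction m with
    | zero =>
      refine hstep 0 le_rfl ?_ ?_
      · rw [airyRoot, airyPhase_zero]
        exact hpos 0
      · rw [airyRoot, airyPhase_zero]
        simp [hcπ]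
    | succ m ih =>
      have h := airyPhase_airyPhaseInv (hpos m).le
      refine hstep (m + 1) ?_ ?_ ?_
      · rw [ih]
        exact airyPhaseInv_nonneg (hpos m).le
      · rw [ih, h]
        push_cast
        linarith [Real.pi_pos]
      · rw [ih, h]
        push_cast
        linarith
  refine ⟨c - π, fun m hm => ?_⟩
  obtain ⟨k, rfl⟩ := Nat.exists_eq_add_of_le' hm
  rw [hall]
  push_cast
  ring_nf

/-- If a derivative has the limit `c` at infinity, so has the quotient `f x / x`. -/
lemma tendsto_div_of_tendsto_deriv {f f' : ℝ → ℝ} {c : ℝ}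
    (hf : ∀ᶠ x in atTop, HasDerivAt f (f' x) x) (hc : Tendsto f' atTop (𝓝 c)) :
    Tendsto (fun x => f x / x) atTop (𝓝 c) := by
  rw [Metric.tendsto_atTop]
  intro ε hε
  have h1 := hf.and ((Metric.tendsto_nhds.1 hc) (ε / 3) (by positivity))
  obtain ⟨x₀, hx₀⟩ := eventually_atTop.1 h1
  have hlim : Tendsto (fun x : ℝ => (f x₀ - c * x₀) / x) atTop (𝓝 0) :=
    tendsto_id.const_div_atTop _
  obtain ⟨x₁, hx₁⟩ := eventually_atTop.1 ((Metric.tendsto_nhds.1 hlim) (ε / 3) (by positivity))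
  refine ⟨max (max x₀ x₁) (max 1 (-x₀)), fun x hx => ?_⟩
  simp only [ge_iff_le, max_le_iff] at hx
  obtain ⟨⟨hxa, hxb⟩, hxc, hxd⟩ := hx
  have hpos : 0 < x := by linarith
  have hder : ∀ y ∈ Icc x₀ x, HasDerivWithinAt (fun y => f y - c * y) (f' y - c) (Icc x₀ x) y :=
    fun y hy => ((hx₀ y hy.1).1.sub ((hasDerivAt_id y).const_mul c)).hasDerivWithinAt.congr_deriv
      (by simp)
  have hmv := (convex_Icc x₀ x).norm_image_sub_le_of_norm_hasDerivWithin_le (C := ε / 3) hder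
    (fun y hy => (hx₀ y hy.1).2.le) (left_mem_Icc.2 hxa) (right_mem_Icc.2 hxa)
  have h2 := hx₁ x hxb
  rw [Real.dist_eq, sub_zero, abs_div, abs_of_pos hpos, div_lt_iff₀ hpos] at h2
  rw [Real.norm_eq_abs, Real.norm_eq_abs, abs_of_nonneg (by linarith : 0 ≤ x - x₀)] at hmv
  rw [Real.dist_eq, div_sub' hpos.ne', abs_div, abs_of_pos hpos, div_lt_iff₀ hpos]
  have h3 : |f x - x * c| ≤ |f x - c * x - (f x₀ - c * x₀)| + |f x₀ - c * x₀| := by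
    have := abs_add_le (f x - c * x - (f x₀ - c * x₀)) (f x₀ - c * x₀)
    rw [sub_add_cancel] at this
    rwa [mul_comm x c]
  nlinarith

lemma tendsto_sqrt_mul_airyModulus :
    Tendsto (fun t => √t * airyModulus 0 t) atTop (𝓝 √π) := by
  refine tendsto_scaledModulus_zero.congr' ?_
  filter_upwards [eventually_gt_atTop 0] with t ht
  have : √t ≠ 0 := by positivity
  rw [airyModulus_eq_scaled 0 ht]
  field_simp

lemma airyModulus_isBigO (k : ℕ) :
    airyModulus k =O[atTop] fun t : ℝ => t ^ (-(k : ℝ) - 1 / 2) := by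
  obtain ⟨C, hC⟩ := abs_airyModulus_le k
  refine Asymptotics.IsBigO.of_bound C ?_
  filter_upwards [eventually_gt_atTop 0] with t ht
  refine (hC t ht).trans_eq ?_
  rw [Real.norm_of_nonneg (by positivity), sub_eq_add_neg, Real.rpow_add ht, Real.rpow_neg ht.le,
    Real.rpow_natCast, Real.rpow_neg ht.le, Real.sqrt_eq_rpow]

/-! ### Real functions whose derivatives lose one order of growth each -/

/-- `f` and its first `k` derivatives, near infinity, are of order `r, r - 1, …, r - k`. -/
def DerivSymbol : ℕ → ℝ → (ℝ → ℝ) → Prop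
  | 0, r, f => f =O[atTop] fun x : ℝ => x ^ r
  | k + 1, r, f => (f =O[atTop] fun x : ℝ => x ^ r) ∧
      ∃ f' : ℝ → ℝ, (∀ᶠ x in atTop, HasDerivAt f (f' x) x) ∧ DerivSymbol k (r - 1) f'

lemma DerivSymbol.isBigO {k : ℕ} {r : ℝ} {f : ℝ → ℝ} (h : DerivSymbol k r f) :
    f =O[atTop] fun x : ℝ => x ^ r := by
  cases k with
  | zero => exact h
  | succ k => exact h.1

lemma DerivSymbol.of_succ {k : ℕ} {r : ℝ} {f : ℝ → ℝ} (h : DerivSymbol (k + 1) r f) :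
    DerivSymbol k r f := by
  induction k generalizing r f with
  | zero => exact h.1
  | succ k ih =>
    obtain ⟨h0, f', hf', h1⟩ := h
    exact ⟨h0, f', hf', ih h1⟩

lemma DerivSymbol.add {k : ℕ} {r : ℝ} {f g : ℝ → ℝ} (hf : DerivSymbol k r f)
    (hg : DerivSymbol k r g) : DerivSymbol k r fun x => f x + g x := by
  induction k generalizing r f g with
  | zero => exact Asymptotics.IsBigO.add hf hg
  | succ k ih =>
    obtain ⟨h0, f', hf', h1⟩ := hf
    obtain ⟨k0, g', hg', k1⟩ := hg
    exact ⟨h0.add k0, _, (hf'.and hg').mono fun x hx => hx.1.add hx.2, ih h1 k1⟩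

lemma isBigO_rpow_mul {f g : ℝ → ℝ} {r s : ℝ} (hf : f =O[atTop] fun x : ℝ => x ^ r)
    (hg : g =O[atTop] fun x : ℝ => x ^ s) :
    (fun x => f x * g x) =O[atTop] fun x : ℝ => x ^ (r + s) := by
  refine (hf.mul hg).congr' EventuallyEq.rfl ?_
  filter_upwards [eventually_gt_atTop 0] with x hx
  rw [Real.rpow_add hx]

lemma DerivSymbol.mul {k : ℕ} {r s : ℝ} {f g : ℝ → ℝ} (hf : DerivSymbol k r f)
    (hg : DerivSymbol k s g) : DerivSymbol k (r + s) fun x => f x * g x := by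
  induction k generalizing r s f g with
  | zero => exact isBigO_rpow_mul hf hg
  | succ k ih =>
    have hf0 := hf.of_succ
    have hg0 := hg.of_succ
    obtain ⟨h0, f', hf', h1⟩ := hf
    obtain ⟨k0, g', hg', k1⟩ := hg
    refine ⟨isBigO_rpow_mul h0 k0, _, (hf'.and hg').mono fun x hx => hx.1.mul hx.2, ?_⟩
    have e1 := ih h1 hg0
    have e2 := ih hf0 k1
    rw [show r - 1 + s = r + s - 1 by ring] at e1
    rw [show r + (s - 1) = r + s - 1 by ring] at e2
    exact e1.add e2

lemma DerivSymbol.const_mul {k : ℕ} {r : ℝ} {f : ℝ → ℝ} (c : ℝ) (hf : DerivSymbol k r f) :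
    DerivSymbol k r fun x => c * f x := by
  induction k generalizing r f with
  | zero => exact Asymptotics.IsBigO.const_mul_left hf c
  | succ k ih =>
    obtain ⟨h0, f', hf', h1⟩ := hf
    exact ⟨h0.const_mul_left c, _, hf'.mono fun x hx => hx.const_mul c, ih h1⟩

lemma derivSymbol_rpow (k : ℕ) (p : ℝ) : DerivSymbol k p fun x => x ^ p := by
  induction k generalizing p with
  | zero => exact Asymptotics.isBigO_refl _ _
  | succ k ih =>
    refine ⟨Asymptotics.isBigO_refl _ _, _, ?_, (ih (p - 1)).const_mul p⟩
    filter_upwards [eventually_gt_atTop 0] with x hx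
    exact Real.hasDerivAt_rpow_const (Or.inl hx.ne')

/-- The smooth function whose value at `m` is the `m`-th root, for the appropriate `c`. -/
def airyRootFun (c x : ℝ) : ℝ := airyPhaseInv (π * x + c)

lemma tendsto_affine (c : ℝ) : Tendsto (fun x : ℝ => π * x + c) atTop atTop :=
  tendsto_atTop_add_const_right _ _ (tendsto_id.const_mul_atTop Real.pi_pos)

lemma tendsto_airyRootFun (c : ℝ) : Tendsto (airyRootFun c) atTop atTop :=
  tendsto_airyPhaseInv.comp (tendsto_affine c)

lemma hasDerivAt_airyRootFun (c : ℝ) : ∀ᶠ x in atTop,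
    HasDerivAt (airyRootFun c) (√π * airyModulus 0 (airyRootFun c x)) x := by
  filter_upwards [(tendsto_affine c).eventually_gt_atTop 0] with x hx
  have h := (hasDerivAt_airyPhaseInv hx).comp x
    (((hasDerivAt_id x).const_mul π).add_const c)
  refine h.congr_deriv ?_
  simp only [airyRootFun, mul_one]
  have h1 : √π * √π = π := Real.mul_self_sqrt Real.pi_pos.le
  have hp : √π ≠ 0 := by positivity
  field_simp
  linear_combination (-airyModulus 0 (airyPhaseInv (π * x + c))) * h1

/-- The leading term `t_m ∼ (3 π m / 2) ^ (2/3)`, for the smooth function through the roots. -/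
lemma tendsto_airyRootFun_div (c : ℝ) :
    Tendsto (fun x => airyRootFun c x / x ^ (2 / 3 : ℝ)) atTop (𝓝 ((3 * π / 2) ^ (2 / 3 : ℝ))) := by
  have hT := tendsto_airyRootFun c
  have hlim : Tendsto (fun x => airyRootFun c x ^ (3 / 2 : ℝ) / x) atTop (𝓝 (3 * π / 2)) := by
    refine tendsto_div_of_tendsto_deriv
      (f' := fun x => 3 / 2 * √π * (√(airyRootFun c x) * airyModulus 0 (airyRootFun c x))) ?_ ?_
    · filter_upwards [hasDerivAt_airyRootFun c, hT.eventually_gt_atTop 0] with x hx hx0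
      refine (hx.rpow_const (p := 3 / 2) (Or.inl hx0.ne')).congr_deriv ?_
      rw [show (3 / 2 : ℝ) - 1 = 1 / 2 by norm_num, ← Real.sqrt_eq_rpow]
      ring
    · have h := (tendsto_sqrt_mul_airyModulus.comp hT).const_mul (3 / 2 * √π)
      rwa [mul_assoc (3 / 2 : ℝ) √π √π, Real.mul_self_sqrt Real.pi_pos.le,
        show 3 / 2 * π = 3 * π / 2 by ring] at h
  have h := hlim.rpow_const (p := 2 / 3) (Or.inr (by norm_num))
  refine h.congr' ?_
  filter_upwards [eventually_gt_atTop 0, hT.eventually_gt_atTop 0] with x hx hx0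
  rw [Real.div_rpow (by positivity) hx.le, ← Real.rpow_mul hx0.le]
  norm_num

lemma airyModulus_airyRootFun_isBigO (c : ℝ) (k : ℕ) :
    (fun x => airyModulus k (airyRootFun c x)) =O[atTop]
      fun x : ℝ => x ^ (-(2 * k + 1 : ℝ) / 3) := by
  have h1 := (airyModulus_isBigO k).comp_tendsto (tendsto_airyRootFun c)
  refine h1.trans ?_
  have hpos : (0 : ℝ) < (3 * π / 2) ^ (2 / 3 : ℝ) := by positivity
  have h2 := (tendsto_airyRootFun_div c).rpow_const (p := -(k : ℝ) - 1 / 2) (Or.inl hpos.ne')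
  refine (h2.isBigO_one ℝ |>.mul (Asymptotics.isBigO_refl
    (fun x : ℝ => x ^ (-(2 * k + 1 : ℝ) / 3)) atTop)).congr' ?_ ?_
  · filter_upwards [eventually_gt_atTop 0, (tendsto_airyRootFun c).eventually_gt_atTop 0]
      with x hx hx0
    have e : x ^ (-(2 * k + 1 : ℝ) / 3) = (x ^ (2 / 3 : ℝ)) ^ (-(k : ℝ) - 1 / 2) := by
      rw [← Real.rpow_mul hx.le]
      congr 1
      ring
    have : (0 : ℝ) < x ^ (2 / 3 : ℝ) := by positivity
    rw [e, ← Real.mul_rpow (by positivity) this.le, div_mul_cancel₀ _ this.ne']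
    rfl
  · exact Eventually.of_forall fun x => by simp

lemma derivSymbol_airyModulus (c : ℝ) (j k : ℕ) :
    DerivSymbol j (-(2 * k + 1 : ℝ) / 3) fun x => airyModulus k (airyRootFun c x) := by
  induction j generalizing k with
  | zero => exact airyModulus_airyRootFun_isBigO c k
  | succ j ih =>
    refine ⟨airyModulus_airyRootFun_isBigO c k, fun x => √π *
      (airyModulus (k + 1) (airyRootFun c x) * airyModulus 0 (airyRootFun c x)), ?_, ?_⟩
    · filter_upwards [hasDerivAt_airyRootFun c] with x hx
      exact ((hasDerivAt_airyModulus k _).comp x hx).congr_deriv (by ring)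
    · have h := ((ih (k + 1)).mul (ih 0)).const_mul √π
      convert h using 1
      push_cast
      ring

lemma derivSymbol_airyRootFun (c : ℝ) (j : ℕ) : DerivSymbol j (2 / 3) (airyRootFun c) := by
  have h0 : (airyRootFun c) =O[atTop] fun x : ℝ => x ^ (2 / 3 : ℝ) := by
    have h := ((tendsto_airyRootFun_div c).isBigO_one ℝ).mul (Asymptotics.isBigO_refl
      (fun x : ℝ => x ^ (2 / 3 : ℝ)) atTop)
    refine h.congr' ?_ (Eventually.of_forall fun x => by simp)
    filter_upwards [eventually_gt_atTop 0] with x hx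
    rw [div_mul_cancel₀ _ (by positivity)]
  cases j with
  | zero => exact h0
  | succ j =>
    refine ⟨h0, _, hasDerivAt_airyRootFun c, ?_⟩
    have h := (derivSymbol_airyModulus c j 0).const_mul √π
    convert h using 1
    norm_num

/-! ### Symbols on a lattice, defined through finite differences -/

/-- Commuting maps `T i` on a space `X`, a filter `l` that they preserve, and a weight `N` tending
to infinity along `l` that they change only by a factor tending to `1`. The example in mind is
a lattice with its translations, and a filter of neighbourhoods of infinity in a cone. -/
structure ShiftSystem {ι X : Type*} (l : Filter X) (N : X → ℝ) (T : ι → X → X) : Prop where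
  tendsto : ∀ i, Tendsto (T i) l l
  comm : ∀ i j x, T i (T j x) = T j (T i x)
  weight : Tendsto N l atTop
  weight_shift : ∀ i, Tendsto (fun x => N (T i x) / N x) l (𝓝 1)

/-- `a` is `O(N ^ r)` along `l` and its iterated differences of order `j ≤ k` with respect to the
maps `T i` are `O(N ^ (r - j))`. -/
def DiffSymbol {ι X 𝕜 : Type*} [NormedField 𝕜] (l : Filter X) (N : X → ℝ) (T : ι → X → X) :
    ℕ → ℝ → (X → 𝕜) → Prop
  | 0, r, a => a =O[l] fun x => N x ^ r
  | k + 1, r, a => (a =O[l] fun x => N x ^ r) ∧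
      ∀ i, DiffSymbol l N T k (r - 1) fun x => a (T i x) - a x

section DiffSymbol

variable {ι X 𝕜 : Type*} [NormedField 𝕜] {l : Filter X} {N : X → ℝ} {T : ι → X → X}
  {k : ℕ} {r s : ℝ} {a b : X → 𝕜}

lemma DiffSymbol.isBigO (h : DiffSymbol l N T k r a) : a =O[l] fun x => N x ^ r := by
  cases k with
  | zero => exact h
  | succ k => exact h.1

lemma DiffSymbol.of_succ (h : DiffSymbol l N T (k + 1) r a) : DiffSymbol l N T k r a := by
  induction k generalizing r a with
  | zero => exact h.1
  | succ k ih => exact ⟨h.1, fun i => ih (h.2 i)⟩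

lemma ShiftSystem.weight_pos (hS : ShiftSystem l N T) : ∀ᶠ x in l, 0 < N x :=
  hS.weight.eventually_gt_atTop 0

lemma ShiftSystem.rpow_isBigO (hS : ShiftSystem l N T) (h : r ≤ s) :
    (fun x => N x ^ r) =O[l] fun x => N x ^ s := by
  refine Asymptotics.IsBigO.of_bound 1 ?_
  filter_upwards [hS.weight.eventually_ge_atTop 1] with x hx
  rw [one_mul, Real.norm_of_nonneg (by positivity), Real.norm_of_nonneg (by positivity)]
  exact Real.rpow_le_rpow_of_exponent_le hx h

lemma ShiftSystem.rpow_shift_isBigO (hS : ShiftSystem l N T) (i : ι) (r : ℝ) :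
    (fun x => N (T i x) ^ r) =O[l] fun x => N x ^ r := by
  have h := ((hS.weight_shift i).rpow_const (p := r) (Or.inl one_ne_zero)).isBigO_one ℝ
  refine (h.mul (Asymptotics.isBigO_refl (fun x => N x ^ r) l)).congr' ?_
    (Eventually.of_forall fun x => one_mul _)
  filter_upwards [hS.weight_pos, (hS.tendsto i).eventually hS.weight_pos] with x hx hx'
  rw [Real.div_rpow hx'.le hx.le, div_mul_cancel₀ _ (by positivity)]

lemma DiffSymbol.mono (hS : ShiftSystem l N T) (hrs : r ≤ s) (h : DiffSymbol l N T k r a) :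
    DiffSymbol l N T k s a := by
  induction k generalizing r s a with
  | zero => exact Asymptotics.IsBigO.trans h (hS.rpow_isBigO hrs)
  | succ k ih => exact ⟨h.1.trans (hS.rpow_isBigO hrs), fun i => ih (by linarith) (h.2 i)⟩

lemma DiffSymbol.congr (hS : ShiftSystem l N T) (h : DiffSymbol l N T k r a) (hab : a =ᶠ[l] b) :
    DiffSymbol l N T k r b := by
  induction k generalizing r a b with
  | zero => exact Asymptotics.IsBigO.congr' h hab EventuallyEq.rfl
  | succ k ih =>
    refine ⟨h.1.congr' hab EventuallyEq.rfl, fun i => ih (h.2 i) ?_⟩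
    filter_upwards [hab, (hS.tendsto i).eventually hab] with x h1 h2
    rw [h1, h2]

lemma DiffSymbol.add (ha : DiffSymbol l N T k r a) (hb : DiffSymbol l N T k r b) :
    DiffSymbol l N T k r fun x => a x + b x := by
  induction k generalizing r a b with
  | zero => exact Asymptotics.IsBigO.add ha hb
  | succ k ih =>
    refine ⟨ha.1.add hb.1, fun i => ?_⟩
    have h := ih (ha.2 i) (hb.2 i)
    convert h using 2
    ring

lemma DiffSymbol.const_mul (c : 𝕜) (ha : DiffSymbol l N T k r a) :
    DiffSymbol l N T k r fun x => c * a x := by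
  induction k generalizing r a with
  | zero => exact Asymptotics.IsBigO.const_mul_left ha c
  | succ k ih =>
    refine ⟨ha.1.const_mul_left c, fun i => ?_⟩
    have h := ih (ha.2 i)
    convert h using 2
    ring

lemma DiffSymbol.neg (ha : DiffSymbol l N T k r a) : DiffSymbol l N T k r fun x => -a x := by
  simpa using ha.const_mul (-1)

lemma DiffSymbol.sub (ha : DiffSymbol l N T k r a) (hb : DiffSymbol l N T k r b) :
    DiffSymbol l N T k r fun x => a x - b x := by
  simpa [sub_eq_add_neg] using ha.add hb.neg

lemma diffSymbol_zero : DiffSymbol l N T k r fun _ => (0 : 𝕜) := by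
  induction k generalizing r with
  | zero => exact Asymptotics.isBigO_zero _ _
  | succ k ih => exact ⟨Asymptotics.isBigO_zero _ _, fun i => by simpa using ih⟩

/-- A bounded function that is invariant under the shifts is a symbol of order zero. -/
lemma diffSymbol_of_invariant (ha : a =O[l] fun _ => (1 : ℝ)) (hT : ∀ i x, a (T i x) = a x) :
    DiffSymbol l N T k 0 a := by
  cases k with
  | zero => simpa [DiffSymbol] using ha
  | succ k => exact ⟨by simpa using ha, fun i => by simpa [hT] using diffSymbol_zero⟩

lemma diffSymbol_const (c : 𝕜) : DiffSymbol l N T k 0 fun _ => c :=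
  diffSymbol_of_invariant (Asymptotics.isBigO_const_const _ one_ne_zero _) fun _ _ => rfl

lemma DiffSymbol.shift (hS : ShiftSystem l N T) (i : ι) (ha : DiffSymbol l N T k r a) :
    DiffSymbol l N T k r fun x => a (T i x) := by
  induction k generalizing r a with
  | zero =>
    exact (Asymptotics.IsBigO.comp_tendsto ha (hS.tendsto i)).trans (hS.rpow_shift_isBigO i r)
  | succ k ih =>
    refine ⟨(ha.1.comp_tendsto (hS.tendsto i)).trans (hS.rpow_shift_isBigO i r), fun j => ?_⟩
    have h := ih (ha.2 j)
    convert h using 3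
    rw [hS.comm]

lemma DiffSymbol.mul (hS : ShiftSystem l N T) (ha : DiffSymbol l N T k r a)
    (hb : DiffSymbol l N T k s b) : DiffSymbol l N T k (r + s) fun x => a x * b x := by
  have key : ∀ {a b : X → 𝕜} {r s : ℝ}, (a =O[l] fun x => N x ^ r) → (b =O[l] fun x => N x ^ s) →
      (fun x => a x * b x) =O[l] fun x => N x ^ (r + s) := by
    intro a b r s h1 h2
    refine (h1.mul h2).congr' EventuallyEq.rfl ?_
    filter_upwards [hS.weight_pos] with x hx
    rw [Real.rpow_add hx]
  induction k generalizing r s a b with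
  | zero => exact key ha hb
  | succ k ih =>
    refine ⟨key ha.1 hb.1, fun i => ?_⟩
    have e1 := ih (ha.2 i) (hb.of_succ.shift hS i)
    have e2 := ih ha.of_succ (hb.2 i)
    rw [show r - 1 + s = r + s - 1 by ring] at e1
    rw [show r + (s - 1) = r + s - 1 by ring] at e2
    have h := e1.add e2
    convert h using 2
    ring

lemma DiffSymbol.pow (hS : ShiftSystem l N T) (ha : DiffSymbol l N T k r a) (n : ℕ) :
    DiffSymbol l N T k (n * r) fun x => a x ^ n := by
  induction n with
  | zero => simpa using diffSymbol_const 1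
  | succ n ih =>
    have h := ih.mul hS ha
    simp only [← pow_succ] at h
    convert h using 1
    push_cast
    ring

lemma DiffSymbol.inv (hS : ShiftSystem l N T) (ha : DiffSymbol l N T k r a)
    (hlow : (fun x => N x ^ r) =O[l] a) : DiffSymbol l N T k (-r) fun x => (a x)⁻¹ := by
  have hne : ∀ᶠ x in l, a x ≠ 0 := by
    filter_upwards [hS.weight_pos, hlow.eq_zero_imp] with x hx h h0
    have := Real.rpow_pos_of_pos hx r
    exact this.ne' (h h0)
  have h0 : (fun x => (a x)⁻¹) =O[l] fun x => N x ^ (-r) := by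
    refine (hlow.inv_rev ?_).congr' EventuallyEq.rfl ?_
    · filter_upwards [hS.weight_pos] with x hx h
      exact absurd h (Real.rpow_pos_of_pos hx r).ne'
    · filter_upwards [hS.weight_pos] with x hx
      rw [Real.rpow_neg hx.le]
  induction k with
  | zero => exact h0
  | succ k ih =>
    refine ⟨h0, fun i => ?_⟩
    have h1 := ih ha.of_succ
    have h := ((ha.2 i).mul hS (h1.mul hS (h1.shift hS i))).neg
    rw [show r - 1 + (-r + -r) = -r - 1 by ring] at h
    refine h.congr hS ?_
    filter_upwards [hne, (hS.tendsto i).eventually hne] with x h1 h2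
    field_simp
    ring

lemma DiffSymbol.ofReal {a : X → ℝ} (ha : DiffSymbol l N T k r a) :
    DiffSymbol l N T k r fun x => (a x : ℂ) := by
  have key : ∀ {a : X → ℝ} {r : ℝ}, (a =O[l] fun x => N x ^ r) →
      (fun x => (a x : ℂ)) =O[l] fun x => N x ^ r := fun h =>
    (Asymptotics.isBigO_norm_left.1 (by simpa using h.norm_left))
  induction k generalizing r a with
  | zero => exact key ha
  | succ k ih =>
    refine ⟨key ha.1, fun i => ?_⟩
    have h := ih (ha.2 i)
    convert h using 2
    push_cast
    ring

lemma DiffSymbol.conj {a : X → ℂ} (ha : DiffSymbol l N T k r a) :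
    DiffSymbol l N T k r fun x => (starRingEnd ℂ) (a x) := by
  have key : ∀ {a : X → ℂ} {r : ℝ}, (a =O[l] fun x => N x ^ r) →
      (fun x => (starRingEnd ℂ) (a x)) =O[l] fun x => N x ^ r := fun h =>
    (Asymptotics.isBigO_norm_left.1 (by simpa using h.norm_left))
  induction k generalizing r a with
  | zero => exact key ha
  | succ k ih =>
    refine ⟨key ha.1, fun i => ?_⟩
    have h := ih (ha.2 i)
    convert h using 2
    rw [map_sub]

/-- Exponentials of symbols of order `r ≤ 0`. The difference of `exp h` is
`exp h (exp (Δh) - 1)`, where `Δh` has order `r - 1`; hence the two assertions are proved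
together. -/
lemma DiffSymbol.exp_and_exp_sub_one (hS : ShiftSystem l N T) {h : X → ℂ} (hr : r ≤ 0)
    (hh : DiffSymbol l N T k r h) :
    (DiffSymbol l N T k 0 fun x => Complex.exp (h x)) ∧
      DiffSymbol l N T k r fun x => Complex.exp (h x) - 1 := by
  have hbdd : ∀ {h : X → ℂ} {r : ℝ}, r ≤ 0 → (h =O[l] fun x => N x ^ r) →
      ∃ C, ∀ᶠ x in l, ‖h x‖ ≤ C := by
    intro h r hr hh
    have := (hh.trans (hS.rpow_isBigO hr)).bound
    obtain ⟨C, hC⟩ := this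
    refine ⟨C, hC.mono fun x hx => by simpa using hx⟩
  have h1 : ∀ {h : X → ℂ} {r : ℝ}, r ≤ 0 → (h =O[l] fun x => N x ^ r) →
      (fun x => Complex.exp (h x)) =O[l] fun x => N x ^ (0 : ℝ) := by
    intro h r hr hh
    obtain ⟨C, hC⟩ := hbdd hr hh
    refine Asymptotics.IsBigO.of_bound (Real.exp C) (hC.mono fun x hx => ?_)
    rw [Real.rpow_zero, norm_one, mul_one]
    exact (Complex.norm_exp_le_exp_norm _).trans (Real.exp_le_exp.2 hx)
  have h2 : ∀ {h : X → ℂ} {r : ℝ}, r ≤ 0 → (h =O[l] fun x => N x ^ r) →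
      (fun x => Complex.exp (h x) - 1) =O[l] fun x => N x ^ r := by
    intro h r hr hh
    obtain ⟨C, hC⟩ := hbdd hr hh
    refine (Asymptotics.IsBigO.of_bound (Real.exp C) (hC.mono fun x hx => ?_)).trans hh
    have := Complex.norm_exp_sub_sum_le_norm_mul_exp (h x) 1
    simp only [Finset.range_one, Finset.sum_singleton, pow_zero, Nat.factorial_zero, Nat.cast_one,
      div_one, pow_one] at this
    refine this.trans ?_
    rw [mul_comm]
    gcongr
  induction k generalizing r h with
  | zero => exact ⟨h1 hr hh, h2 hr hh⟩
  | succ k ih =>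
    have hd : ∀ i, DiffSymbol l N T k (r - 1)
        fun x => Complex.exp (h (T i x)) - Complex.exp (h x) := by
      intro i
      have e := (ih hr hh.of_succ).1.mul hS (ih (by linarith) (hh.2 i)).2
      rw [zero_add] at e
      convert e using 2
      rw [mul_sub, ← Complex.exp_add]
      ring_nf
    refine ⟨⟨h1 hr hh.1, fun i => (hd i).mono hS (by linarith)⟩, ⟨h2 hr hh.1, fun i => ?_⟩⟩
    simpa using hd i

/-- The square root of an elliptic symbol, since `Δ√G = ΔG / (√G + √(TG))`. -/
lemma DiffSymbol.of_sq (hS : ShiftSystem l N T) {a : X → ℝ} (h0 : ∀ x, 0 ≤ a x)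
    (hsq : DiffSymbol l N T k (2 * r) fun x => a x ^ 2)
    (hlow : (fun x => N x ^ r) =O[l] a) : DiffSymbol l N T k r a := by
  have hO : a =O[l] fun x => N x ^ r := by
    refine Asymptotics.IsBigO.of_pow two_ne_zero (hsq.isBigO.congr' EventuallyEq.rfl ?_)
    filter_upwards [hS.weight_pos] with x hx
    rw [Pi.pow_apply, ← Real.rpow_natCast, ← Real.rpow_mul hx.le, mul_comm]
    norm_num
  have hpos : ∀ᶠ x in l, 0 < a x := by
    filter_upwards [hS.weight_pos, hlow.eq_zero_imp] with x hx h
    refine (h0 x).lt_of_ne fun h' => ?_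
    exact (Real.rpow_pos_of_pos hx r).ne' (h h'.symm)
  induction k with
  | zero => exact hO
  | succ k ih =>
    refine ⟨hO, fun i => ?_⟩
    have h1 := ih hsq.of_succ
    have h2 := (h1.add (h1.shift hS i)).inv hS (hlow.trans (Asymptotics.IsBigO.of_bound 1
      (Eventually.of_forall fun x => by
        rw [one_mul, Real.norm_of_nonneg (h0 x),
          Real.norm_of_nonneg (add_nonneg (h0 x) (h0 (T i x)))]
        exact le_add_of_nonneg_right (h0 (T i x)))))
    have h := (hsq.2 i).mul hS h2
    rw [show 2 * r - 1 + -r = r - 1 by ring] at h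
    refine h.congr hS ?_
    filter_upwards [hpos] with x hx
    have : a x + a (T i x) ≠ 0 := (add_pos_of_pos_of_nonneg hx (h0 _)).ne'
    field_simp
    ring

lemma DiffSymbol.comp {Y : Type*} {l' : Filter Y} {N' : Y → ℝ} {T' : ι → Y → Y} {p : Y → X}
    (hp : Tendsto p l' l) (hN : ∀ y, N (p y) = N' y) (hT : ∀ i y, p (T' i y) = T i (p y))
    (ha : DiffSymbol l N T k r a) : DiffSymbol l' N' T' k r fun y => a (p y) := by
  have key : ∀ {a : X → 𝕜} {r : ℝ}, (a =O[l] fun x => N x ^ r) →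
      (fun y => a (p y)) =O[l'] fun y => N' y ^ r := fun h => by
    simpa only [Function.comp_def, hN] using h.comp_tendsto hp
  induction k generalizing r a with
  | zero => exact key ha
  | succ k ih =>
    refine ⟨key ha.1, fun i => ?_⟩
    simp only [hT]
    exact ih (ha.2 i)

end DiffSymbol

/-! ### Smooth symbols restrict to symbols on the lattice -/

lemma rpow_le_of_comparable {x y c : ℝ} (p : ℝ) (hx : 0 < x) (hy : 0 < y) (hc : 1 ≤ c)
    (h1 : y ≤ c * x) (h2 : x ≤ c * y) : y ^ p ≤ c ^ |p| * x ^ p := by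
  rcases le_total 0 p with hp | hp
  · rw [abs_of_nonneg hp, ← Real.mul_rpow (by positivity) hx.le]
    exact Real.rpow_le_rpow hy.le h1 hp
  · rw [abs_of_nonpos hp, Real.rpow_neg (by positivity), ← Real.inv_rpow (by positivity),
      ← Real.mul_rpow (by positivity) hx.le]
    refine Real.rpow_le_rpow_of_nonpos (by positivity) ?_ hp
    rwa [inv_mul_le_iff₀ (by positivity)]

lemma DerivSymbol.shift_sub {k : ℕ} {r : ℝ} {f : ℝ → ℝ} (hf : DerivSymbol (k + 1) r f) (c : ℝ) :
    DerivSymbol k (r - 1) fun x => f (x + c) - f x := by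
  have hO : ∀ {r : ℝ} {f f' : ℝ → ℝ}, (∀ᶠ x in atTop, HasDerivAt f (f' x) x) →
      (f' =O[atTop] fun x : ℝ => x ^ (r - 1)) →
      (fun x => f (x + c) - f x) =O[atTop] fun x : ℝ => x ^ (r - 1) := by
    intro r f f' hd hf'
    obtain ⟨C, hC⟩ := hf'.bound
    obtain ⟨x₀, hx₀⟩ := eventually_atTop.1 (hd.and hC)
    refine Asymptotics.IsBigO.of_bound (C * (2 ^ |r - 1|) * |c|) ?_
    filter_upwards [eventually_ge_atTop (x₀ + |c|), eventually_gt_atTop (2 * |c|)] with x hx hxc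
    have hc0 := abs_nonneg c
    have hx0 : 0 < x := by linarith
    have hmem : ∀ y ∈ uIcc x (x + c), x - |c| ≤ y ∧ y ≤ x + |c| := by
      intro y hy
      rw [mem_uIcc] at hy
      have := le_abs_self c
      have := neg_abs_le c
      rcases hy with ⟨h1, h2⟩ | ⟨h1, h2⟩ <;> constructor <;> linarith
    have hmv := (convex_uIcc x (x + c)).norm_image_sub_le_of_norm_hasDerivWithin_le
      (f := f) (f' := f') (C := C * (2 ^ |r - 1| * x ^ (r - 1))) (x := x) (y := x + c)
      (fun y hy => (hx₀ y (by linarith [(hmem y hy).1])).1.hasDerivWithinAt)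
      (fun y hy => ?_) left_mem_uIcc right_mem_uIcc
    · rw [add_sub_cancel_left, Real.norm_eq_abs c] at hmv
      rw [Real.norm_of_nonneg (by positivity : 0 ≤ x ^ (r - 1))]
      linarith
    · obtain ⟨h1, h2⟩ := hmem y hy
      have hy0 : 0 < y := by linarith
      have h3 := (hx₀ y (by linarith)).2
      rw [Real.norm_of_nonneg (by positivity : 0 ≤ y ^ (r - 1))] at h3
      have hC0 : 0 ≤ C := by
        by_contra! hneg
        have := Real.rpow_pos_of_pos hy0 (r - 1)
        nlinarith [norm_nonneg (f' y)]
      refine h3.trans (mul_le_mul_of_nonneg_left ?_ hC0)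
      exact rpow_le_of_comparable _ hx0 hy0 one_le_two (by linarith) (by linarith)
  induction k generalizing r f with
  | zero =>
    obtain ⟨-, f', hf', h1⟩ := hf
    exact hO hf' h1.isBigO
  | succ k ih =>
    obtain ⟨-, f', hf', h1⟩ := hf
    refine ⟨hO hf' h1.isBigO, fun x => f' (x + c) - f' x, ?_, ih h1⟩
    filter_upwards [hf', (tendsto_atTop_add_const_right _ c tendsto_id).eventually hf']
      with x hx hx'
    exact (hx'.comp_add_const x c).sub hx

lemma DerivSymbol.diffSymbol {ι X : Type*} {l : Filter X} {N : X → ℝ} {T : ι → X → X}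
    {k : ℕ} {r : ℝ} {f : ℝ → ℝ} {x : X → ℝ} {c : ι → ℝ} (hx : Tendsto x l atTop)
    (hxN : ∀ r : ℝ, (fun p => x p ^ r) =O[l] fun p => N p ^ r) (hT : ∀ i p, x (T i p) = x p + c i)
    (hf : DerivSymbol k r f) : DiffSymbol l N T k r fun p => f (x p) := by
  induction k generalizing r f with
  | zero => exact (Asymptotics.IsBigO.comp_tendsto hf hx).trans (hxN r)
  | succ k ih =>
    refine ⟨(Asymptotics.IsBigO.comp_tendsto hf.isBigO hx).trans (hxN r), fun i => ?_⟩
    simp only [hT]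
    exact ih (hf.shift_sub (c i))

lemma IsSymbol.shift_sub {r : ℝ} {a : ℝ × ℝ → ℂ} (ha : IsSymbol r a) (v : ℝ × ℝ) :
    IsSymbol (r - 1) fun w => a (w + v) - a w := by
  obtain ⟨hsm, hb⟩ := ha
  have hsv : ContDiff ℝ ∞ fun w => a (w + v) := hsm.comp (contDiff_id.add contDiff_const)
  refine ⟨hsv.sub hsm, fun j => ?_⟩
  obtain ⟨C, hC⟩ := hb (j + 1)
  have hC0 : 0 ≤ C := by
    have := (norm_nonneg _).trans (hC 0)
    simpa using this
  refine ⟨C * (1 + ‖v‖) ^ |r - (j + 1 : ℕ)| * ‖v‖, fun w => ?_⟩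
  have hjle : ∀ n : ℕ, (n : WithTop ℕ∞) ≤ ∞ := fun n => mod_cast le_top
  have e : iteratedFDeriv ℝ j (fun w => a (w + v) - a w) w =
      iteratedFDeriv ℝ j a (w + v) - iteratedFDeriv ℝ j a w := by
    rw [← iteratedFDeriv_comp_add_right]
    exact iteratedFDeriv_sub_apply (hsv.of_le (hjle j)).contDiffAt (hsm.of_le (hjle j)).contDiffAt
  rw [e]
  have hd : Differentiable ℝ (iteratedFDeriv ℝ j a) :=
    hsm.differentiable_iteratedFDeriv (by exact_mod_cast WithTop.coe_lt_top j)
  have hmv := (convex_segment w (w + v)).norm_image_sub_le_of_norm_fderiv_le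
    (f := iteratedFDeriv ℝ j a) (𝕜 := ℝ)
    (C := C * ((1 + ‖v‖) ^ |r - (j + 1 : ℕ)| * (1 + ‖w‖) ^ (r - (j + 1 : ℕ))))
    (fun y _ => hd y) (fun y hy => ?_) (left_mem_segment ℝ _ _) (right_mem_segment ℝ _ _)
  · rw [add_sub_cancel_left] at hmv
    refine hmv.trans_eq ?_
    push_cast
    ring_nf
  · rw [norm_fderiv_iteratedFDeriv]
    refine (hC y).trans (mul_le_mul_of_nonneg_left ?_ hC0)
    have hyw : ‖y - w‖ ≤ ‖v‖ := by
      have := norm_sub_le_of_mem_segment hy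
      simpa using this
    have h1 := norm_le_norm_add_norm_sub' y w
    have h2 := norm_le_norm_add_norm_sub' w y
    rw [norm_sub_rev] at h2
    have := norm_nonneg w
    have := norm_nonneg y
    have := norm_nonneg v
    exact rpow_le_of_comparable _ (by positivity) (by positivity) (by linarith)
      (by nlinarith) (by nlinarith)

lemma IsSymbol.diffSymbol {ι X : Type*} {l : Filter X} {N : X → ℝ} {T : ι → X → X}
    {r : ℝ} {a : ℝ × ℝ → ℂ} {w : X → ℝ × ℝ} {c : ι → ℝ × ℝ}
    (hwN : ∀ r : ℝ, (fun p => (1 + ‖w p‖) ^ r) =O[l] fun p => N p ^ r)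
    (hT : ∀ i p, w (T i p) = w p + c i)
    (ha : IsSymbol r a) (k : ℕ) : DiffSymbol l N T k r fun p => a (w p) := by
  have hO : ∀ {r : ℝ} {a : ℝ × ℝ → ℂ}, IsSymbol r a →
      (fun p => a (w p)) =O[l] fun p => N p ^ r := by
    intro r a ha
    obtain ⟨C, hC⟩ := ha.2 0
    refine (Asymptotics.IsBigO.of_bound C (Eventually.of_forall fun p => ?_)).trans (hwN r)
    have := hC (w p)
    rw [norm_iteratedFDeriv_zero, Nat.cast_zero, sub_zero] at this
    rwa [Real.norm_of_nonneg (by positivity)]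
  induction k generalizing r a with
  | zero => exact hO ha
  | succ k ih =>
    refine ⟨hO ha, fun i => ?_⟩
    simp only [hT]
    exact ih (ha.shift_sub (c i))

/-! ### Neighbourhoods of infinity in a cone of lattice points -/

/-- The pair `(m / n, n)` attached to a lattice point `(m, n)`. -/
def coneCoord (p : ℤ × ℤ) : ℝ × ℝ := ((p.1 : ℝ) / p.2, p.2)

/-- The filter of lattice points `(m, n)` with `n → ∞` and `m / n → r`. -/
def rayFilter (r : ℝ) : Filter (ℤ × ℤ) := comap coneCoord (𝓝 r ×ˢ atTop)

/-- The filter generated by the sets `{(m, n) : m / n ∈ U, n ≥ R}`, where `U` is a neighbourhood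
of `[α, β]`. -/
def coneFilter (α β : ℝ) : Filter (ℤ × ℤ) := comap coneCoord (𝓝ˢ (Icc α β) ×ˢ atTop)

lemma coneFilter_eq_iSup (α β : ℝ) : coneFilter α β = ⨆ r ∈ Icc α β, rayFilter r := by
  simp only [coneFilter, rayFilter, (isCompact_Icc).nhdsSet_prod_eq_biSup, comap_iSup]

lemma tendsto_coneFilter_iff {α β : ℝ} {Y : Type*} {f : ℤ × ℤ → Y} {l : Filter Y} :
    Tendsto f (coneFilter α β) l ↔ ∀ r ∈ Icc α β, Tendsto f (rayFilter r) l := by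
  simp only [coneFilter_eq_iSup, tendsto_iSup]

lemma rayFilter_le {α β r : ℝ} (hr : r ∈ Icc α β) : rayFilter r ≤ coneFilter α β := by
  rw [coneFilter_eq_iSup]
  exact le_iSup₂_of_le r hr le_rfl

lemma tendsto_ratio_rayFilter (r : ℝ) :
    Tendsto (fun p : ℤ × ℤ => (p.1 : ℝ) / p.2) (rayFilter r) (𝓝 r) :=
  tendsto_fst.comp tendsto_comap

lemma tendsto_snd_rayFilter (r : ℝ) :
    Tendsto (fun p : ℤ × ℤ => (p.2 : ℝ)) (rayFilter r) atTop :=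
  tendsto_snd.comp tendsto_comap

lemma tendsto_ratio_coneFilter (α β : ℝ) :
    Tendsto (fun p : ℤ × ℤ => (p.1 : ℝ) / p.2) (coneFilter α β) (𝓝ˢ (Icc α β)) :=
  tendsto_fst.comp tendsto_comap

lemma tendsto_snd_coneFilter (α β : ℝ) :
    Tendsto (fun p : ℤ × ℤ => (p.2 : ℝ)) (coneFilter α β) atTop :=
  tendsto_snd.comp tendsto_comap

/-- The weight changes under a translation by a factor tending to `1`. -/
lemma tendsto_shift_div {l : Filter (ℤ × ℤ)} (hl : Tendsto (fun p : ℤ × ℤ => (p.2 : ℝ)) l atTop)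
    (v : ℤ × ℤ) : Tendsto (fun p : ℤ × ℤ => ((p + v).2 : ℝ) / p.2) l (𝓝 1) := by
  have h := (hl.const_div_atTop (v.2 : ℝ)).const_add 1
  rw [add_zero] at h
  refine h.congr' ?_
  filter_upwards [hl.eventually_gt_atTop 0] with p hp
  rw [Prod.snd_add]
  push_cast
  field_simp

lemma tendsto_shift_rayFilter (r : ℝ) (v : ℤ × ℤ) :
    Tendsto (fun p => p + v) (rayFilter r) (rayFilter r) := by
  have hn := tendsto_snd_rayFilter r
  have hr := tendsto_ratio_rayFilter r
  refine tendsto_comap_iff.2 (Tendsto.prodMk ?_ ?_)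
  · have h := (hr.add (hn.const_div_atTop (v.1 : ℝ))).div (tendsto_shift_div hn v) one_ne_zero
    rw [add_zero, div_one] at h
    refine h.congr' ?_
    filter_upwards [hn.eventually_gt_atTop 0] with p hp
    have := hp.ne'
    simp only [Pi.div_apply, Prod.fst_add, Int.cast_add]
    rw [← add_div, div_div_div_cancel_right₀ this]
  · have h := tendsto_atTop_add_const_right _ (v.2 : ℝ) hn
    refine h.congr fun p => ?_
    simp

lemma shiftSystem_coneFilter (α β : ℝ) :
    ShiftSystem (coneFilter α β) (fun p => (p.2 : ℝ)) (fun (v : ℤ × ℤ) p => p + v) where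
  tendsto v := tendsto_coneFilter_iff.2 fun r hr =>
    (tendsto_shift_rayFilter r v).mono_right (rayFilter_le hr)
  comm u v p := by ring
  weight := tendsto_snd_coneFilter α β
  weight_shift v := tendsto_shift_div (tendsto_snd_coneFilter α β) v

lemma eventually_coneFilter {α β : ℝ} (hα : 0 < α) (hβ : 0 < β) : ∀ᶠ p in coneFilter α β,
    (1 : ℝ) ≤ p.2 ∧ α / 2 * (p.2 : ℝ) ≤ p.1 ∧ (p.1 : ℝ) ≤ 2 * β * p.2 := by
  have h : Ioo (α / 2) (2 * β) ∈ 𝓝ˢ (Icc α β) :=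
    isOpen_Ioo.mem_nhdsSet.2 fun x hx => ⟨by linarith [hx.1], by linarith [hx.2]⟩
  filter_upwards [(tendsto_ratio_coneFilter α β).eventually h,
    (tendsto_snd_coneFilter α β).eventually_ge_atTop 1] with p hp h1
  have h0 : (0 : ℝ) < p.2 := by linarith
  refine ⟨h1, ?_, ?_⟩
  · exact ((lt_div_iff₀ h0).1 hp.1).le
  · exact ((div_lt_iff₀ h0).1 hp.2).le

lemma tendsto_fst_coneFilter {α β : ℝ} (hα : 0 < α) (hβ : 0 < β) :
    Tendsto (fun p : ℤ × ℤ => (p.1 : ℝ)) (coneFilter α β) atTop := by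
  refine tendsto_atTop_mono' _ ?_ ((tendsto_snd_coneFilter α β).const_mul_atTop (half_pos hα))
  filter_upwards [eventually_coneFilter hα hβ] with p hp using hp.2.1

lemma isBigO_rpow_of_comparable {X : Type*} {l : Filter X} {N x : X → ℝ} {c : ℝ} (hc : 1 ≤ c)
    (h : ∀ᶠ p in l, 0 < N p ∧ 0 < x p ∧ x p ≤ c * N p ∧ N p ≤ c * x p) (r : ℝ) :
    (fun p => x p ^ r) =O[l] fun p => N p ^ r := by
  refine Asymptotics.IsBigO.of_bound (c ^ |r|) (h.mono fun p hp => ?_)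
  obtain ⟨h1, h2, h3, h4⟩ := hp
  rw [Real.norm_of_nonneg (by positivity), Real.norm_of_nonneg (by positivity)]
  exact rpow_le_of_comparable r h1 h2 hc h3 h4

lemma fst_rpow_isBigO {α β : ℝ} (hα : 0 < α) (hβ : 0 < β) (r : ℝ) :
    (fun p : ℤ × ℤ => (p.1 : ℝ) ^ r) =O[coneFilter α β] fun p => (p.2 : ℝ) ^ r := by
  refine isBigO_rpow_of_comparable (c := 1 + 2 * β + 2 / α) (by
    have : 0 < 2 / α := by positivity
    linarith) ?_ r
  filter_upwards [eventually_coneFilter hα hβ] with p hp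
  obtain ⟨h1, h2, h3⟩ := hp
  have h0 : (0 : ℝ) < p.2 := by linarith
  have h5 : (0 : ℝ) < p.1 := lt_of_lt_of_le (by positivity) h2
  have h4 : (0 : ℝ) < 2 / α := by positivity
  refine ⟨h0, h5, by nlinarith, ?_⟩
  have : (p.2 : ℝ) ≤ 2 / α * p.1 := by
    rw [div_mul_eq_mul_div, le_div_iff₀ hα]
    linarith
  nlinarith

lemma norm_rpow_isBigO {α β : ℝ} (hα : 0 < α) (hβ : 0 < β) (r : ℝ) :
    (fun p : ℤ × ℤ => (1 + ‖((p.1 : ℝ), (p.2 : ℝ))‖) ^ r) =O[coneFilter α β]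
      fun p => (p.2 : ℝ) ^ r := by
  refine isBigO_rpow_of_comparable (c := 2 + 2 * β) (by linarith) ?_ r
  filter_upwards [eventually_coneFilter hα hβ] with p hp
  obtain ⟨h1, h2, h3⟩ := hp
  have h0 : (0 : ℝ) < p.2 := by linarith
  have h5 : (0 : ℝ) < p.1 := lt_of_lt_of_le (by positivity) h2
  rw [Prod.norm_def, Real.norm_of_nonneg h5.le, Real.norm_of_nonneg h0.le]
  have h6 : max (p.1 : ℝ) p.2 ≤ (1 + 2 * β) * p.2 := max_le (by nlinarith) (by nlinarith)
  have h7 := le_max_right (p.1 : ℝ) (p.2 : ℝ)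
  exact ⟨h0, by positivity, by nlinarith, by nlinarith⟩

/-! ### The phase function `F` is a symbol of order one -/

lemma freq_nonneg (p : ℤ × ℤ) : 0 ≤ freq p.1 p.2 := Real.sqrt_nonneg _

lemma airyRoot_nonneg (m : ℕ) : 0 ≤ airyRoot m := by
  cases m with
  | zero => exact le_rfl
  | succ m =>
    induction m with
    | zero => exact Real.sInf_nonneg fun t ht => ht.1.le
    | succ m ih => exact Real.sInf_nonneg fun t ht => ih.trans ht.1.le

lemma sq_freq (p : ℤ × ℤ) : freq p.1 p.2 ^ 2 =
    (p.2 : ℝ) ^ 2 + |(p.2 : ℝ)| ^ (4 / 3 : ℝ) * airyRoot p.1.toNat :=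
  Real.sq_sqrt (add_nonneg (sq_nonneg _)
    (mul_nonneg (Real.rpow_nonneg (abs_nonneg _) _) (airyRoot_nonneg _)))

lemma abs_snd_le_freq (p : ℤ × ℤ) : |(p.2 : ℝ)| ≤ freq p.1 p.2 := by
  refine Real.le_sqrt_of_sq_le ?_
  rw [sq_abs]
  exact le_add_of_nonneg_right
    (mul_nonneg (Real.rpow_nonneg (abs_nonneg _) _) (airyRoot_nonneg _))

lemma exists_airyRoot_eq_airyRootFun :
    ∃ c, ∀ m : ℤ, (1 : ℝ) ≤ m → airyRoot m.toNat = airyRootFun c m := by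
  obtain ⟨c, hc⟩ := exists_airyRoot_eq
  refine ⟨c, fun m hm => ?_⟩
  have hm' : 1 ≤ m := by exact_mod_cast hm
  have h1 : (m.toNat : ℝ) = m := by
    exact_mod_cast congrArg (Int.cast (R := ℝ)) (Int.toNat_of_nonneg (by omega : 0 ≤ m))
  rw [hc m.toNat (by omega), airyRootFun, h1]

/-- `F` is the square root of the elliptic symbol `n ^ 2 + n ^ (4/3) t_m` of order two. -/
lemma diffSymbol_freq {α β : ℝ} (hα : 0 < α) (hβ : 0 < β) (k : ℕ) :
    DiffSymbol (coneFilter α β) (fun p => (p.2 : ℝ)) (fun (v : ℤ × ℤ) p => p + v) k 1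
      fun p => freq p.1 p.2 := by
  have hS := shiftSystem_coneFilter α β
  have hn : ∀ (v : ℤ × ℤ) (p : ℤ × ℤ), ((p + v).2 : ℝ) = p.2 + v.2 := fun v p => by simp
  have hm : ∀ (v : ℤ × ℤ) (p : ℤ × ℤ), ((p + v).1 : ℝ) = p.1 + v.1 := fun v p => by simp
  obtain ⟨c, hc⟩ := exists_airyRoot_eq_airyRootFun
  have h2 := (derivSymbol_rpow k 2).diffSymbol (T := fun (v : ℤ × ℤ) p => p + v)
    (tendsto_snd_coneFilter α β) (fun r => Asymptotics.isBigO_refl _ _) hn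
  have h43 := (derivSymbol_rpow k (4 / 3)).diffSymbol (T := fun (v : ℤ × ℤ) p => p + v)
    (tendsto_snd_coneFilter α β) (fun r => Asymptotics.isBigO_refl _ _) hn
  have hroot := (derivSymbol_airyRootFun c k).diffSymbol (T := fun (v : ℤ × ℤ) p => p + v)
    (tendsto_fst_coneFilter hα hβ) (fst_rpow_isBigO hα hβ) hm
  have hG := h43.mul hS hroot
  rw [show (4 / 3 + 2 / 3 : ℝ) = 2 by norm_num] at hG
  refine DiffSymbol.of_sq hS (fun p => freq_nonneg p) (((h2.add hG).congr hS ?_).mono hS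
    (by norm_num)) ?_
  · filter_upwards [hS.weight_pos,
      (tendsto_fst_coneFilter hα hβ).eventually_ge_atTop 1] with p hp hp1
    rw [sq_freq, hc _ hp1, abs_of_pos hp, Real.rpow_ofNat]
  · refine Asymptotics.IsBigO.of_bound 1 (Eventually.of_forall fun p => ?_)
    rw [Real.rpow_one, one_mul, Real.norm_of_nonneg (freq_nonneg p)]
    exact abs_snd_le_freq p

/-! ### The limits of the differences of `F` along rays -/

/-- If `x ^ p f' x` converges, so does `x ^ p (f (x + 1) - f x)`, to the same limit. -/
lemma tendsto_rpow_mul_shift_sub {f f' : ℝ → ℝ} {p c : ℝ}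
    (hf : ∀ᶠ x in atTop, HasDerivAt f (f' x) x)
    (hc : Tendsto (fun x => x ^ p * f' x) atTop (𝓝 c)) :
    Tendsto (fun x => x ^ p * (f (x + 1) - f x)) atTop (𝓝 c) := by
  obtain ⟨x₀, hx₀⟩ := eventually_atTop.1 hf
  have hex : ∀ x, ∃ ξ, x₀ ≤ x → x ≤ ξ ∧ ξ ≤ x + 1 ∧ f' ξ = f (x + 1) - f x := by
    intro x
    by_cases hx : x₀ ≤ x
    · obtain ⟨ξ, hξ, h⟩ := exists_hasDerivAt_eq_slope f f' (lt_add_one x)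
        (fun y hy => (hx₀ y (hx.trans hy.1)).continuousAt.continuousWithinAt)
        (fun y hy => hx₀ y (hx.trans hy.1.le))
      exact ⟨ξ, fun _ => ⟨hξ.1.le, hξ.2.le, by rw [h, add_sub_cancel_left, div_one]⟩⟩
    · exact ⟨0, fun h => absurd h hx⟩
  choose ξ hξ using hex
  have hξt : Tendsto ξ atTop atTop := by
    refine tendsto_atTop_mono' _ ?_ tendsto_id
    filter_upwards [eventually_ge_atTop x₀] with x hx using (hξ x hx).1
  have hratio : Tendsto (fun x => ξ x / x) atTop (𝓝 1) := by
    have hu : Tendsto (fun x : ℝ => 1 + 1 / x) atTop (𝓝 1) := by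
      simpa using (tendsto_id.const_div_atTop (1 : ℝ)).const_add 1
    refine tendsto_of_tendsto_of_tendsto_of_le_of_le' tendsto_const_nhds hu ?_ ?_
    · filter_upwards [eventually_ge_atTop x₀, eventually_gt_atTop 0] with x hx h0
      rw [le_div_iff₀ h0, one_mul]
      exact (hξ x hx).1
    · filter_upwards [eventually_ge_atTop x₀, eventually_gt_atTop 0] with x hx h0
      rw [div_le_iff₀ h0, add_mul, one_mul, one_div, inv_mul_cancel₀ h0.ne']
      exact (hξ x hx).2.1
  have h := (hratio.rpow_const (p := -p) (Or.inl one_ne_zero)).mul (hc.comp hξt)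
  rw [Real.one_rpow, one_mul] at h
  refine h.congr' ?_
  filter_upwards [eventually_ge_atTop x₀, eventually_gt_atTop 0, hξt.eventually_gt_atTop 0]
    with x hx h0 h1
  simp only [Function.comp]
  rw [← (hξ x hx).2.2, Real.div_rpow h1.le h0.le, Real.rpow_neg h1.le, Real.rpow_neg h0.le]
  have := (Real.rpow_pos_of_pos h1 p).ne'
  have := (Real.rpow_pos_of_pos h0 p).ne'
  field_simp

/-- The limit of `t_m / n ^ (2/3)` as `m / n → r`. -/
def raySq (r : ℝ) : ℝ := (3 * π / 2 * r) ^ (2 / 3 : ℝ)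

/-- The limit of `∂F/∂m` as `m / n → r`. -/
def slopeFst (r : ℝ) : ℝ := π / √(raySq r) / (2 * √(1 + raySq r))

/-- The limit of `∂F/∂n` as `m / n → r`. -/
def slopeSnd (r : ℝ) : ℝ := (2 + 4 / 3 * raySq r) / (2 * √(1 + raySq r))

lemma raySq_pos {r : ℝ} (hr : 0 < r) : 0 < raySq r := by
  unfold raySq
  positivity

section Ray

variable {r : ℝ}

lemma tendsto_fst_rayFilter (hr : 0 < r) :
    Tendsto (fun p : ℤ × ℤ => (p.1 : ℝ)) (rayFilter r) atTop :=
  (tendsto_fst_coneFilter hr hr).mono_left (rayFilter_le ⟨le_rfl, le_rfl⟩)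

lemma tendsto_airyRoot_div (hr : 0 < r) {c : ℝ} :
    Tendsto (fun p : ℤ × ℤ => airyRootFun c p.1 / (p.2 : ℝ) ^ (2 / 3 : ℝ)) (rayFilter r)
      (𝓝 (raySq r)) := by
  have h1 := (tendsto_airyRootFun_div c).comp (tendsto_fst_rayFilter hr)
  have h2 := (tendsto_ratio_rayFilter r).rpow_const (p := 2 / 3) (Or.inl hr.ne')
  have h := h1.mul h2
  rw [← Real.mul_rpow (by positivity) hr.le] at h
  refine h.congr' ?_
  filter_upwards [(tendsto_fst_rayFilter hr).eventually_gt_atTop 0,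
    (tendsto_snd_rayFilter r).eventually_gt_atTop 0] with p hm hn
  rw [Real.div_rpow hm.le hn.le]
  have := (Real.rpow_pos_of_pos hm (2 / 3)).ne'
  simp only [Function.comp]
  field_simp

lemma tendsto_freq_div (hr : 0 < r) :
    Tendsto (fun p : ℤ × ℤ => freq p.1 p.2 / p.2) (rayFilter r) (𝓝 √(1 + raySq r)) := by
  obtain ⟨c, hc⟩ := exists_airyRoot_eq_airyRootFun
  have h := ((tendsto_airyRoot_div hr (c := c)).const_add 1).sqrt
  refine h.congr' ?_
  filter_upwards [(tendsto_fst_rayFilter hr).eventually_ge_atTop 1,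
    (tendsto_snd_rayFilter r).eventually_gt_atTop 0] with p hm hn
  rw [freq, hc _ hm, abs_of_pos hn]
  have e : (p.2 : ℝ) ^ (4 / 3 : ℝ) * (p.2 : ℝ) ^ (2 / 3 : ℝ) = (p.2 : ℝ) ^ 2 := by
    rw [← Real.rpow_add hn, ← Real.rpow_natCast]
    norm_num
  have := (Real.rpow_pos_of_pos hn (2 / 3)).ne'
  have e' : (p.2 : ℝ) ^ 2 + (p.2 : ℝ) ^ (4 / 3 : ℝ) * airyRootFun c p.1 =
      (p.2 : ℝ) ^ 2 * (1 + airyRootFun c p.1 / (p.2 : ℝ) ^ (2 / 3 : ℝ)) := by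
    rw [← e]
    field_simp
  rw [e', Real.sqrt_mul (sq_nonneg _), Real.sqrt_sq hn.le, mul_div_cancel_left₀ _ hn.ne']

/-- Passage from differences of `F ^ 2` to differences of `F`. -/
lemma tendsto_freq_shift_sub (hr : 0 < r) (v : ℤ × ℤ) {d : ℝ}
    (hd : Tendsto (fun p : ℤ × ℤ => (freq (p + v).1 (p + v).2 ^ 2 - freq p.1 p.2 ^ 2) / p.2)
      (rayFilter r) (𝓝 d)) :
    Tendsto (fun p : ℤ × ℤ => freq (p + v).1 (p + v).2 - freq p.1 p.2) (rayFilter r)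
      (𝓝 (d / (2 * √(1 + raySq r)))) := by
  have h0 := tendsto_freq_div hr
  have h1 := (h0.comp (tendsto_shift_rayFilter r v)).mul
    (tendsto_shift_div (tendsto_snd_rayFilter r) v)
  rw [mul_one] at h1
  have hpos : 0 < √(1 + raySq r) := Real.sqrt_pos.2 (by linarith [raySq_pos hr])
  have h := hd.div (h1.add h0) (by positivity)
  rw [← two_mul] at h
  refine h.congr' ?_
  filter_upwards [(tendsto_snd_rayFilter r).eventually_gt_atTop 0,
    ((tendsto_snd_rayFilter r).comp (tendsto_shift_rayFilter r v)).eventually_gt_atTop 0]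
    with p hp hp'
  have hlow := abs_snd_le_freq p
  rw [abs_of_pos hp] at hlow
  have hlow' := freq_nonneg (p + v)
  have hne : freq (p + v).1 (p + v).2 + freq p.1 p.2 ≠ 0 := by
    have : 0 < freq (p + v).1 (p + v).2 + freq p.1 p.2 := by linarith
    exact this.ne'
  simp only [Function.comp] at hp' ⊢
  have e : freq (p + v).1 (p + v).2 / ((p + v).2 : ℝ) * (((p + v).2 : ℝ) / p.2) +
      freq p.1 p.2 / p.2 = (freq (p + v).1 (p + v).2 + freq p.1 p.2) / p.2 := by
    field_simp
  simp only [Pi.div_apply]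
  rw [e, div_div_div_cancel_right₀ hp.ne', div_eq_iff hne]
  ring

lemma tendsto_freq_shift_fst (hr : 0 < r) :
    Tendsto (fun p : ℤ × ℤ => freq (p + (1, 0)).1 (p + (1, 0)).2 - freq p.1 p.2) (rayFilter r)
      (𝓝 (slopeFst r)) := by
  obtain ⟨c, hc⟩ := exists_airyRoot_eq_airyRootFun
  refine tendsto_freq_shift_sub hr (1, 0) ?_
  have hT := tendsto_airyRootFun c
  have hκ : (0 : ℝ) < (3 * π / 2) ^ (2 / 3 : ℝ) := by positivity
  have hder : Tendsto (fun x => x ^ (1 / 3 : ℝ) * (√π * airyModulus 0 (airyRootFun c x))) atTop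
      (𝓝 (√π * √π * ((3 * π / 2) ^ (2 / 3 : ℝ)) ^ (-(1 / 2) : ℝ))) := by
    have h := ((tendsto_sqrt_mul_airyModulus.comp hT).const_mul √π).mul
      ((tendsto_airyRootFun_div c).rpow_const (p := -(1 / 2)) (Or.inl hκ.ne'))
    refine h.congr' ?_
    filter_upwards [eventually_gt_atTop 0, hT.eventually_gt_atTop 0] with x hx hx0
    rw [Real.div_rpow hx0.le (by positivity), ← Real.rpow_mul hx.le, Real.rpow_neg hx0.le,
      ← Real.sqrt_eq_rpow, show (2 / 3 : ℝ) * -(1 / 2) = -(1 / 3) by norm_num,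
      Real.rpow_neg hx.le]
    have h1 : √(airyRootFun c x) ≠ 0 := by positivity
    have h2 : x ^ (1 / 3 : ℝ) ≠ 0 := by positivity
    simp only [Function.comp]
    field_simp
  have h1 := (tendsto_rpow_mul_shift_sub (hasDerivAt_airyRootFun c) hder).comp
    (tendsto_fst_rayFilter hr)
  have h2 := (tendsto_ratio_rayFilter r).rpow_const (p := -(1 / 3)) (Or.inl hr.ne')
  have h := h1.mul h2
  have e : √π * √π * ((3 * π / 2) ^ (2 / 3 : ℝ)) ^ (-(1 / 2) : ℝ) * r ^ (-(1 / 3) : ℝ) =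
      π / √(raySq r) := by
    have h3 : (0 : ℝ) ≤ 3 * π / 2 := by positivity
    have h4 : (0 : ℝ) ≤ 3 * π / 2 * r := by positivity
    rw [Real.mul_self_sqrt Real.pi_pos.le, raySq, Real.sqrt_eq_rpow, ← Real.rpow_mul h3,
      ← Real.rpow_mul h4, mul_assoc, show (2 / 3 : ℝ) * -(1 / 2) = -(1 / 3) by norm_num,
      ← Real.mul_rpow h3 hr.le, Real.rpow_neg h4, show (2 / 3 : ℝ) * (1 / 2) = 1 / 3 by norm_num]
    exact (div_eq_mul_inv _ _).symm
  rw [e] at h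
  refine h.congr' ?_
  filter_upwards [(tendsto_fst_rayFilter hr).eventually_ge_atTop 1,
    (tendsto_snd_rayFilter r).eventually_gt_atTop 0] with p hm hn
  have hm0 : (0 : ℝ) < p.1 := by linarith
  rw [sq_freq, sq_freq]
  simp only [Function.comp, Prod.fst_add, Prod.snd_add, add_zero]
  rw [hc _ hm, hc (p.1 + 1) (by push_cast; linarith), abs_of_pos hn,
    Real.div_rpow hm0.le hn.le, Real.rpow_neg hm0.le, Real.rpow_neg hn.le]
  push_cast
  have e2 : (p.2 : ℝ) ^ (4 / 3 : ℝ) = (p.2 : ℝ) * (p.2 : ℝ) ^ (1 / 3 : ℝ) := by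
    rw [← Real.rpow_one_add' hn.le (by norm_num)]
    norm_num
  rw [e2]
  have h5 := (Real.rpow_pos_of_pos hm0 (1 / 3)).ne'
  have h6 := (Real.rpow_pos_of_pos hn (1 / 3)).ne'
  field_simp
  ring

lemma tendsto_freq_shift_snd (hr : 0 < r) :
    Tendsto (fun p : ℤ × ℤ => freq (p + (0, 1)).1 (p + (0, 1)).2 - freq p.1 p.2) (rayFilter r)
      (𝓝 (slopeSnd r)) := by
  obtain ⟨c, hc⟩ := exists_airyRoot_eq_airyRootFun
  refine tendsto_freq_shift_sub hr (0, 1) ?_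
  have hder : Tendsto (fun x : ℝ => x ^ (-(1 / 3) : ℝ) * (4 / 3 * x ^ (4 / 3 - 1 : ℝ))) atTop
      (𝓝 (4 / 3)) := by
    refine tendsto_const_nhds.congr' ?_
    filter_upwards [eventually_gt_atTop 0] with x hx
    rw [mul_left_comm, ← Real.rpow_add hx]
    norm_num
  have hd : ∀ᶠ x in atTop, HasDerivAt (fun x : ℝ => x ^ (4 / 3 : ℝ))
      (4 / 3 * x ^ (4 / 3 - 1 : ℝ)) x := by
    filter_upwards [eventually_gt_atTop 0] with x hx
    exact Real.hasDerivAt_rpow_const (Or.inl hx.ne')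
  have h1 := (tendsto_rpow_mul_shift_sub hd hder).comp (tendsto_snd_rayFilter r)
  have h2 := (h1.mul (tendsto_airyRoot_div hr (c := c))).const_add 2
  have h := h2.add ((tendsto_snd_rayFilter r).const_div_atTop 1)
  rw [add_zero] at h
  refine h.congr' ?_
  filter_upwards [(tendsto_fst_rayFilter hr).eventually_ge_atTop 1,
    (tendsto_snd_rayFilter r).eventually_gt_atTop 0] with p hm hn
  rw [sq_freq, sq_freq]
  simp only [Function.comp, Prod.fst_add, Prod.snd_add, add_zero]
  push_cast
  rw [hc _ hm, abs_of_pos hn, abs_of_pos (by linarith : (0 : ℝ) < p.2 + 1), Real.rpow_neg hn.le]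
  have e2 : (p.2 : ℝ) ^ (1 / 3 : ℝ) * (p.2 : ℝ) ^ (2 / 3 : ℝ) = p.2 := by
    rw [← Real.rpow_add hn]
    norm_num
  have h5 := (Real.rpow_pos_of_pos hn (2 / 3)).ne'
  have h6 := (Real.rpow_pos_of_pos hn (1 / 3)).ne'
  generalize (p.2 : ℝ) ^ (4 / 3 : ℝ) = a
  generalize ((p.2 : ℝ) + 1) ^ (4 / 3 : ℝ) = b
  have e3 : ((p.2 : ℝ) ^ (1 / 3 : ℝ))⁻¹ * (b - a) * (airyRootFun c p.1 / (p.2 : ℝ) ^ (2 / 3 : ℝ)) =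
      (b - a) * airyRootFun c p.1 / ((p.2 : ℝ) ^ (1 / 3 : ℝ) * (p.2 : ℝ) ^ (2 / 3 : ℝ)) := by
    field_simp
  rw [e3, e2]
  field_simp
  ring

end Ray

/-! ### Summation over conic sets of lattice points -/

/-- `A` is contained in the cone of `coneFilter α β` up to finitely many points, for each
neighbourhood of that cone. -/
def IsConic (α β : ℝ) (A : Set (ℤ × ℤ)) : Prop :=
  ∀ W ∈ coneFilter α β, (A \ W).Finite

lemma IsConic.union {α β : ℝ} {A B : Set (ℤ × ℤ)} (hA : IsConic α β A) (hB : IsConic α β B) :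
    IsConic α β (A ∪ B) := fun W hW => by
  rw [union_sdiff_distrib]
  exact (hA W hW).union (hB W hW)

lemma IsConic.preimage_add {α β : ℝ} {A : Set (ℤ × ℤ)} (hA : IsConic α β A) (v : ℤ × ℤ) :
    IsConic α β {p | p + v ∈ A} := fun W hW => by
  have h := hA _ ((shiftSystem_coneFilter α β).tendsto (-v) hW)
  refine (h.preimage (add_left_injective v).injOn).subset fun p hp => ⟨hp.1, fun hp' => hp.2 ?_⟩
  simpa using hp'

lemma isConic_sector {α β : ℝ} (hα : 0 < α) (hαβ : α < β) :
    IsConic α β {p : ℤ × ℤ | α * (p.2 : ℝ) < p.1 ∧ (p.1 : ℝ) < β * p.2} := by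
  intro W hW
  obtain ⟨U, hU, hUW⟩ := mem_comap.1 hW
  obtain ⟨S, hS, R, hR, hSR⟩ := mem_prod_iff.1 hU
  obtain ⟨n₀, hn₀⟩ := mem_atTop_sets.1 hR
  refine (finite_Icc ((0, 0) : ℤ × ℤ) (⌈β * n₀⌉, ⌈n₀⌉)).subset ?_
  rintro p ⟨⟨h1, h2⟩, hpW⟩
  have hn : (0 : ℝ) < p.2 := by
    by_contra! hneg
    nlinarith
  have hlt : (p.2 : ℝ) < n₀ := by
    by_contra! hge
    refine hpW (hUW (hSR ⟨subset_of_mem_nhdsSet hS ⟨?_, ?_⟩, hn₀ _ hge⟩))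
    · exact ((lt_div_iff₀ hn).2 h1).le
    · exact ((div_lt_iff₀ hn).2 h2).le
  have hm : (0 : ℝ) < p.1 := lt_trans (by positivity) h1
  have hm' : (p.1 : ℝ) ≤ β * n₀ := by nlinarith
  refine ⟨⟨?_, ?_⟩, ?_, ?_⟩
  · exact_mod_cast hm.le
  · exact_mod_cast hn.le
  · exact_mod_cast hm'.trans (Int.le_ceil _)
  · exact_mod_cast hlt.le.trans (Int.le_ceil _)

/-- A summable weight on the lattice, comparable to `n ^ (-4)` in cones. -/
def latticeWeight (p : ℤ × ℤ) : ℝ := ((1 + |(p.1 : ℝ)|) ^ 2)⁻¹ * ((1 + |(p.2 : ℝ)|) ^ 2)⁻¹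

lemma latticeWeight_pos (p : ℤ × ℤ) : 0 < latticeWeight p := by
  unfold latticeWeight
  positivity

lemma summable_latticeWeight : Summable latticeWeight := by
  have h : Summable fun n : ℤ => ((1 + |(n : ℝ)|) ^ 2)⁻¹ := by
    have h1 := (Real.summable_one_div_int_pow (p := 2)).2 one_lt_two
    refine h1.of_norm_bounded_eventually ?_
    filter_upwards [(finite_singleton (0 : ℤ)).compl_mem_cofinite] with n hn
    have hn0 : (n : ℝ) ≠ 0 := by exact_mod_cast hn
    rw [Real.norm_of_nonneg (by positivity), one_div, ← sq_abs (n : ℝ)]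
    have := abs_pos.2 hn0
    gcongr
    linarith
  exact h.mul_of_nonneg h (fun _ => by positivity) (fun _ => by positivity)

lemma rpow_neg_four_isBigO {α β : ℝ} (hα : 0 < α) (hβ : 0 < β) :
    (fun p : ℤ × ℤ => (p.2 : ℝ) ^ (-4 : ℝ)) =O[coneFilter α β] latticeWeight := by
  refine Asymptotics.IsBigO.of_bound ((2 * (1 + 2 * β)) ^ 2) ?_
  filter_upwards [eventually_coneFilter hα hβ] with p hp
  obtain ⟨h1, h2, h3⟩ := hp
  have hn : (0 : ℝ) < p.2 := by linarith
  have hm : (0 : ℝ) < p.1 := lt_of_lt_of_le (by positivity) h2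
  rw [Real.norm_of_nonneg (by positivity), Real.norm_of_nonneg (latticeWeight_pos p).le,
    latticeWeight, abs_of_pos hm, abs_of_pos hn, Real.rpow_neg hn.le, ← mul_inv,
    ← div_eq_mul_inv, le_div_iff₀ (by positivity), inv_mul_le_iff₀ (by positivity),
    show (4 : ℝ) = ((4 : ℕ) : ℝ) by norm_num, Real.rpow_natCast]
  have ha : 1 + (p.1 : ℝ) ≤ (1 + 2 * β) * p.2 := by linarith
  have hb : 1 + (p.2 : ℝ) ≤ 2 * p.2 := by linarith
  calc (1 + (p.1 : ℝ)) ^ 2 * (1 + (p.2 : ℝ)) ^ 2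
      ≤ ((1 + 2 * β) * p.2) ^ 2 * (2 * p.2) ^ 2 := by gcongr
    _ = _ := by ring

lemma IsConic.summable {α β : ℝ} {A : Set (ℤ × ℤ)} (hA : IsConic α β A) {f : ℤ × ℤ → ℂ}
    (hf : ∀ p, f p ≠ 0 → p ∈ A) (hO : f =O[coneFilter α β] latticeWeight) : Summable f := by
  obtain ⟨C, hC0, hC⟩ := hO.exists_nonneg
  rw [Asymptotics.isBigOWith_iff] at hC
  refine summable_of_isBigO summable_latticeWeight (Asymptotics.IsBigO.of_bound C ?_)
  refine (hA _ hC).subset fun p hp => ⟨hf p fun h => hp ?_, fun h => hp h⟩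
  change ‖f p‖ ≤ C * ‖latticeWeight p‖
  rw [h, norm_zero]
  positivity

/-! ### Oscillatory sums -/

/-- The value `exp (i z F(m, n))` of the wave at complex time `z`. -/
def phaseExp (z : ℂ) (p : ℤ × ℤ) : ℂ := Complex.exp (Complex.I * z * freq p.1 p.2)

/-- The relative increment of `phaseExp` under translation by `v`. -/
def phaseIncr (v : ℤ × ℤ) (z : ℂ) (p : ℤ × ℤ) : ℂ :=
  Complex.exp (Complex.I * z * ((freq (p + v).1 (p + v).2 - freq p.1 p.2 : ℝ) : ℂ)) - 1

/-- The sum of the squares of the moduli of the two increments. -/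
def phaseEnergy (z : ℂ) (p : ℤ × ℤ) : ℝ :=
  ‖phaseIncr (1, 0) z p‖ ^ 2 + ‖phaseIncr (0, 1) z p‖ ^ 2

lemma phaseIncr_mul_phaseExp (v : ℤ × ℤ) (z : ℂ) (p : ℤ × ℤ) :
    phaseIncr v z p * phaseExp z p = phaseExp z (p + v) - phaseExp z p := by
  unfold phaseIncr phaseExp
  rw [sub_mul, ← Complex.exp_add, one_mul]
  congr 2
  push_cast
  ring

lemma norm_phaseExp (z : ℂ) (p : ℤ × ℤ) : ‖phaseExp z p‖ = Real.exp (-(z.im * freq p.1 p.2)) := by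
  rw [phaseExp, Complex.norm_exp]
  congr 1
  simp

lemma norm_phaseExp_le_one {z : ℂ} (hz : 0 ≤ z.im) (p : ℤ × ℤ) : ‖phaseExp z p‖ ≤ 1 := by
  rw [norm_phaseExp, Real.exp_le_one_iff]
  have := mul_nonneg hz (freq_nonneg p)
  linarith

/-- The shift system on pairs of a parameter `z ∈ V` and a lattice point. -/
lemma shiftSystem_prod (α β : ℝ) (V : Set ℂ) :
    ShiftSystem (𝓟 V ×ˢ coneFilter α β) (fun x : ℂ × (ℤ × ℤ) => (x.2.2 : ℝ))
      (fun (v : ℤ × ℤ) x => (x.1, x.2 + v)) where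
  tendsto v := tendsto_id.prodMap ((shiftSystem_coneFilter α β).tendsto v)
  comm u v x := by rw [add_right_comm]
  weight := (shiftSystem_coneFilter α β).weight.comp tendsto_snd
  weight_shift v := ((shiftSystem_coneFilter α β).weight_shift v).comp tendsto_snd

/-- Symbols of order `r` on the lattice, uniformly in the parameter `z ∈ V`. -/
abbrev LatticeSymbol (α β : ℝ) (V : Set ℂ) (k : ℕ) (r : ℝ) (b : ℂ × (ℤ × ℤ) → ℂ) : Prop :=
  DiffSymbol (𝓟 V ×ˢ coneFilter α β) (fun x : ℂ × (ℤ × ℤ) => (x.2.2 : ℝ))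
    (fun (v : ℤ × ℤ) x => (x.1, x.2 + v)) k r b

lemma DiffSymbol.latticeSymbol {α β : ℝ} (V : Set ℂ) {k : ℕ} {r : ℝ} {a : ℤ × ℤ → ℂ}
    (ha : DiffSymbol (coneFilter α β) (fun p => (p.2 : ℝ)) (fun (v : ℤ × ℤ) p => p + v) k r a) :
    LatticeSymbol α β V k r fun x => a x.2 :=
  ha.comp (p := Prod.snd) tendsto_snd (fun _ => rfl) fun _ _ => rfl

lemma latticeSymbol_phaseIncr {α β : ℝ} (hα : 0 < α) (hβ : 0 < β) {V : Set ℂ} {B : ℝ}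
    (hV : ∀ z ∈ V, ‖z‖ ≤ B) (k : ℕ) (v : ℤ × ℤ) :
    LatticeSymbol α β V k 0 fun x => phaseIncr v x.1 x.2 := by
  have hS := shiftSystem_prod α β V
  have hF := ((diffSymbol_freq hα hβ (k + 1)).2 v).ofReal.latticeSymbol V
  rw [sub_self] at hF
  have hz : LatticeSymbol α β V k 0 fun x => x.1 := by
    refine diffSymbol_of_invariant (Asymptotics.IsBigO.of_bound B ?_) fun _ _ => rfl
    filter_upwards [tendsto_fst.eventually (mem_principal_self V)] with x hx
    simpa using hV x.1 hx
  have h := (hz.const_mul Complex.I).mul hS hF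
  rw [zero_add] at h
  exact (h.exp_and_exp_sub_one hS le_rfl).2

lemma summable_mul_phaseExp {α β : ℝ} (hα : 0 < α) (hβ : 0 < β) {A : Set (ℤ × ℤ)}
    (hA : IsConic α β A) {V : Set ℂ} {k : ℕ} {r : ℝ} {b : ℂ × (ℤ × ℤ) → ℂ}
    (hb : LatticeSymbol α β V k r b) (hsupp : ∀ x, b x ≠ 0 → x.2 ∈ A) {z : ℂ} (hz : z ∈ V)
    (hz0 : 0 < z.im) : Summable fun p => b (z, p) * phaseExp z p := by
  refine hA.summable (fun p hp => hsupp (z, p) (left_ne_zero_of_mul hp)) ?_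
  have h1 : (fun p => b (z, p)) =O[coneFilter α β] fun p => (p.2 : ℝ) ^ r :=
    hb.isBigO.comp_tendsto (tendsto_const_pure.mono_right (by simpa using hz) |>.prodMk tendsto_id)
  have h2 : (fun x : ℝ => x ^ r * Real.exp (-z.im * x)) =O[atTop] fun x : ℝ => x ^ (-4 : ℝ) := by
    have h := (isLittleO_exp_neg_mul_rpow_atTop hz0 (-4 - r)).isBigO
    refine ((Asymptotics.isBigO_refl (fun x : ℝ => x ^ r) atTop).mul h).congr'
      EventuallyEq.rfl ?_
    filter_upwards [eventually_gt_atTop 0] with x hx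
    rw [← Real.rpow_add hx]
    ring_nf
  have h3 : (phaseExp z) =O[coneFilter α β] fun p => Real.exp (-z.im * p.2) := by
    refine Asymptotics.IsBigO.of_bound 1 (Eventually.of_forall fun p => ?_)
    rw [norm_phaseExp, one_mul, Real.norm_of_nonneg (Real.exp_pos _).le]
    apply Real.exp_le_exp.2
    have := (le_abs_self _).trans (abs_snd_le_freq p)
    nlinarith
  exact ((h1.mul h3).trans (h2.comp_tendsto (tendsto_snd_coneFilter α β))).trans
    (rpow_neg_four_isBigO hα hβ)

/-- Sums of symbols of order `-4` are bounded, without use of the oscillation. -/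
lemma exists_bound_tsum {α β : ℝ} (hα : 0 < α) (hβ : 0 < β) {A : Set (ℤ × ℤ)}
    (hA : IsConic α β A) {V : Set ℂ} (hV : ∀ z ∈ V, 0 < z.im) {k : ℕ} {r : ℝ} (hr : r ≤ -4)
    {b : ℂ × (ℤ × ℤ) → ℂ} (hb : LatticeSymbol α β V k r b) (hsupp : ∀ x, b x ≠ 0 → x.2 ∈ A)
    (hbdd : ∀ p, ∃ C, ∀ z ∈ V, ‖b (z, p)‖ ≤ C) :
    ∃ C, ∀ z ∈ V, ‖∑' p, b (z, p) * phaseExp z p‖ ≤ C := by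
  have hO : b =O[𝓟 V ×ˢ coneFilter α β] fun x => latticeWeight x.2 :=
    (hb.mono (shiftSystem_prod α β V) hr).isBigO.trans
      ((rpow_neg_four_isBigO hα hβ).comp_tendsto tendsto_snd)
  obtain ⟨C, hC0, hC⟩ := hO.exists_nonneg
  rw [Asymptotics.isBigOWith_iff, eventually_prod_iff] at hC
  obtain ⟨P, hP, Q, hQ, hPQ⟩ := hC
  rw [eventually_principal] at hP
  choose B hB using hbdd
  classical
  set S : Set (ℤ × ℤ) := A \ {p | Q p} with hSdef
  have hS : S.Finite := hA _ hQ
  set H : ℤ × ℤ → ℝ := fun p => C * latticeWeight p + S.indicator (fun p => |B p|) p with hH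
  have hHs : Summable H := (summable_latticeWeight.mul_left C).add
    (summable_of_hasFiniteSupport (hS.subset (support_indicator_subset)))
  have hle : ∀ z ∈ V, ∀ p, ‖b (z, p) * phaseExp z p‖ ≤ H p := by
    intro z hz p
    have h1 : ‖b (z, p) * phaseExp z p‖ ≤ ‖b (z, p)‖ := by
      rw [norm_mul]
      exact mul_le_of_le_one_right (norm_nonneg _) (norm_phaseExp_le_one (hV z hz).le p)
    have h2 := mul_nonneg hC0 (latticeWeight_pos p).le
    have h3 : 0 ≤ S.indicator (fun p => |B p|) p := indicator_nonneg (fun _ _ => abs_nonneg _) p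
    refine h1.trans ?_
    by_cases hb0 : b (z, p) = 0
    · rw [hb0, norm_zero]
      exact add_nonneg h2 h3
    by_cases hq : Q p
    · have := hPQ (hP z hz) hq
      rw [Real.norm_of_nonneg (latticeWeight_pos p).le] at this
      exact this.trans (le_add_of_nonneg_right h3)
    · have hpS : p ∈ S := ⟨hsupp _ hb0, hq⟩
      rw [hH]
      simp only [indicator_of_mem hpS]
      exact ((hB p z hz).trans (le_abs_self _)).trans (le_add_of_nonneg_left h2)
  exact ⟨∑' p, H p, fun z hz => tsum_of_norm_bounded hHs.hasSum (hle z hz)⟩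

/-- Sums over a finite set of lattice points are bounded. -/
lemma exists_bound_tsum_of_finite {S : Set (ℤ × ℤ)} (hS : S.Finite) {V : Set ℂ}
    (hV : ∀ z ∈ V, 0 < z.im) {b : ℂ × (ℤ × ℤ) → ℂ} (hsupp : ∀ x, b x ≠ 0 → x.2 ∈ S)
    (hbdd : ∀ p, ∃ C, ∀ z ∈ V, ‖b (z, p)‖ ≤ C) :
    ∃ C, ∀ z ∈ V, ‖∑' p, b (z, p) * phaseExp z p‖ ≤ C := by
  choose B hB using hbdd
  refine ⟨∑ p ∈ hS.toFinset, B p, fun z hz => ?_⟩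
  rw [tsum_eq_sum (s := hS.toFinset)]
  · refine (norm_sum_le _ _).trans (Finset.sum_le_sum fun p _ => ?_)
    rw [norm_mul]
    exact (mul_le_of_le_one_right (norm_nonneg _)
      (norm_phaseExp_le_one (hV z hz).le p)).trans (hB p z hz)
  · intro p hp
    rw [Finite.mem_toFinset] at hp
    by_contra h
    exact hp (hsupp (z, p) (left_ne_zero_of_mul h))

/-- Uniform bounds by repeated summation by parts. On `W` the amplitude is
`b = ∑ᵢ b (conj qᵢ / ∑ⱼ |qⱼ|²) qᵢ`, where `qᵢ` is the increment of the phase in the `i`-th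
direction, and each summation by parts replaces an amplitude by a difference of it, whose order is
lower by one. -/
theorem exists_bound_oscillatory_tsum {α β : ℝ} (hα : 0 < α) (hβ : 0 < β) {V : Set ℂ} {B : ℝ}
    (hV : ∀ z ∈ V, 0 < z.im) (hVB : ∀ z ∈ V, ‖z‖ ≤ B) {W : Set (ℤ × ℤ)}
    (hW : W ∈ coneFilter α β) {δ : ℝ} (hδ : 0 < δ) (hQ : ∀ z ∈ V, ∀ p ∈ W, δ ≤ phaseEnergy z p)
    {k : ℕ} {r : ℝ} (hr : r - k ≤ -4) {A : Set (ℤ × ℤ)} (hA : IsConic α β A)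
    {b : ℂ × (ℤ × ℤ) → ℂ} (hb : LatticeSymbol α β V k r b) (hsupp : ∀ x, b x ≠ 0 → x.2 ∈ A)
    (hbdd : ∀ p, ∃ C, ∀ z ∈ V, ‖b (z, p)‖ ≤ C) :
    ∃ C, ∀ z ∈ V, ‖∑' p, b (z, p) * phaseExp z p‖ ≤ C := by
  induction k generalizing r A b with
  | zero => exact exists_bound_tsum hα hβ hA hV (by simpa using hr) hb hsupp hbdd
  | succ k ih =>
    classical
    have hS := shiftSystem_prod α β V
    have hWl : ∀ᶠ x in 𝓟 V ×ˢ coneFilter α β, x.1 ∈ V ∧ x.2 ∈ W :=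
      (tendsto_fst.eventually (mem_principal_self V)).and (tendsto_snd.eventually hW)
    have hq := latticeSymbol_phaseIncr hα hβ hVB (k + 1)
    -- the symbols `conj qᵢ / ∑ⱼ |qⱼ|²`
    have hQs : LatticeSymbol α β V (k + 1) 0 fun x => ((phaseEnergy x.1 x.2 : ℝ) : ℂ) := by
      have h := ((hq (1, 0)).mul hS (hq (1, 0)).conj).add ((hq (0, 1)).mul hS (hq (0, 1)).conj)
      rw [zero_add] at h
      convert h using 2 with x
      rw [Complex.mul_conj, Complex.mul_conj, Complex.normSq_eq_norm_sq,
        Complex.normSq_eq_norm_sq, phaseEnergy]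
      push_cast
      ring
    have hQi := hQs.inv hS (Asymptotics.IsBigO.of_bound δ⁻¹ (hWl.mono fun x hx => by
      have h := hQ x.1 hx.1 x.2 hx.2
      rw [Real.rpow_zero, norm_one, Complex.norm_real, Real.norm_of_nonneg (hδ.le.trans h),
        ← inv_mul_cancel₀ hδ.ne']
      gcongr))
    rw [neg_zero] at hQi
    set c : ℤ × ℤ → ℂ × (ℤ × ℤ) → ℂ := fun v x => if x.2 ∈ W then
      (starRingEnd ℂ) (phaseIncr v x.1 x.2) * ((phaseEnergy x.1 x.2 : ℝ) : ℂ)⁻¹ * b x else 0 with hc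
    have hcsym : ∀ v, LatticeSymbol α β V (k + 1) r (c v) := by
      intro v
      have h := ((hq v).conj.mul hS hQi).mul hS hb
      rw [zero_add, zero_add] at h
      refine h.congr hS (hWl.mono fun x hx => ?_)
      simp only [hc, if_pos hx.2]
    have hcsupp : ∀ v x, c v x ≠ 0 → x.2 ∈ A := by
      intro v x hx
      refine hsupp x fun h0 => hx ?_
      simp [hc, h0]
    have hcbdd : ∀ v ∈ ({(1, 0), (0, 1)} : Set (ℤ × ℤ)), ∀ p, ∃ C, ∀ z ∈ V, ‖c v (z, p)‖ ≤ C := by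
      intro v hv p
      obtain ⟨C, hC⟩ := hbdd p
      refine ⟨(1 / δ + 1) * C, fun z hz => ?_⟩
      have hC0 : 0 ≤ C := (norm_nonneg _).trans (hC z hz)
      simp only [hc]
      split_ifs with hpW
      · have hE := hQ z hz p hpW
        have hE0 : 0 < phaseEnergy z p := hδ.trans_le hE
        have hqE : ‖phaseIncr v z p‖ ≤ 1 + phaseEnergy z p := by
          have h2 : ‖phaseIncr v z p‖ ^ 2 ≤ phaseEnergy z p := by
            rcases hv with rfl | rfl
            · exact le_add_of_nonneg_right (sq_nonneg _)
            · exact le_add_of_nonneg_left (sq_nonneg _)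
          nlinarith [sq_nonneg (‖phaseIncr v z p‖ - 1)]
        rw [norm_mul, norm_mul, RCLike.norm_conj, norm_inv, Complex.norm_real,
          Real.norm_of_nonneg hE0.le]
        refine mul_le_mul ?_ (hC z hz) (norm_nonneg _) (by positivity)
        calc ‖phaseIncr v z p‖ * (phaseEnergy z p)⁻¹
            ≤ (1 + phaseEnergy z p) * (phaseEnergy z p)⁻¹ := by gcongr
          _ = 1 / phaseEnergy z p + 1 := by field_simp
          _ ≤ 1 / δ + 1 := by gcongr
      · rw [norm_zero]
        positivity
    -- the amplitude after summation by parts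
    set d : ℤ × ℤ → ℂ × (ℤ × ℤ) → ℂ := fun v x => c v (x.1, x.2 + -v) - c v x with hd
    have hdsym : ∀ v, LatticeSymbol α β V k (r - 1) (d v) := fun v => (hcsym v).2 (-v)
    have hshift : ∀ v, ∀ z ∈ V, Summable fun p => c v (z, p + -v) * phaseExp z p := fun v z hz =>
      summable_mul_phaseExp hα hβ (hA.preimage_add (-v)) ((hcsym v).shift hS (-v))
        (fun x hx => hcsupp v _ hx) hz (hV z hz)
    have hcsum : ∀ v, ∀ z ∈ V, Summable fun p => c v (z, p) * phaseExp z p := fun v z hz =>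
      summable_mul_phaseExp hα hβ hA (hcsym v) (fun x hx => hcsupp v _ hx) hz (hV z hz)
    have hparts : ∀ v, ∀ z ∈ V, HasSum (fun p => c v (z, p) * phaseIncr v z p * phaseExp z p)
        (∑' p, d v (z, p) * phaseExp z p) := by
      intro v z hz
      have h1 := (hshift v z hz).hasSum
      have h2 := (Equiv.addRight v).hasSum_iff.2 h1
      have h3 := h2.sub (hcsum v z hz).hasSum
      have e1 : ∑' p, d v (z, p) * phaseExp z p =
          ∑' p, c v (z, p + -v) * phaseExp z p - ∑' p, c v (z, p) * phaseExp z p := by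
        rw [← (hshift v z hz).tsum_sub (hcsum v z hz)]
        simp only [hd, sub_mul]
      rw [e1]
      refine h3.congr_fun fun p => ?_
      simp only [Function.comp, Equiv.coe_addRight, add_neg_cancel_right]
      rw [mul_assoc, phaseIncr_mul_phaseExp, mul_sub]
    obtain ⟨C₁, hC₁⟩ := ih (r := r - 1) (by push_cast at hr ⊢; linarith)
      (A := A ∪ {p | p + -(1, 0) ∈ A} ∪ {p | p + -(0, 1) ∈ A})
      (hA.union (hA.preimage_add _) |>.union (hA.preimage_add _))
      (b := fun x => d (1, 0) x + d (0, 1) x) ((hdsym _).add (hdsym _))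
      (fun x hx => by
        by_contra hnot
        simp only [mem_union, not_or] at hnot
        obtain ⟨⟨h0, h1⟩, h2⟩ := hnot
        refine hx ?_
        have e0 : ∀ v, c v x = 0 := fun v => by
          by_contra h
          exact h0 (hcsupp v x h)
        have e1 : c (1, 0) (x.1, x.2 + -(1, 0)) = 0 := by
          by_contra h
          exact h1 (hcsupp _ _ h)
        have e2 : c (0, 1) (x.1, x.2 + -(0, 1)) = 0 := by
          by_contra h
          exact h2 (hcsupp _ _ h)
        simp only [hd, e0, e1, e2, sub_zero, add_zero])
      (fun p => by
        obtain ⟨D₁, h1⟩ := hcbdd (1, 0) (by simp) p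
        obtain ⟨D₂, h2⟩ := hcbdd (1, 0) (by simp) (p + -(1, 0))
        obtain ⟨D₃, h3⟩ := hcbdd (0, 1) (by simp) p
        obtain ⟨D₄, h4⟩ := hcbdd (0, 1) (by simp) (p + -(0, 1))
        refine ⟨D₂ + D₁ + (D₄ + D₃), fun z hz => (norm_add_le _ _).trans (add_le_add ?_ ?_)⟩
        · exact (norm_sub_le _ _).trans (add_le_add (h2 z hz) (h1 z hz))
        · exact (norm_sub_le _ _).trans (add_le_add (h4 z hz) (h3 z hz)))
    -- the finitely many lattice points outside `W`
    obtain ⟨C₂, hC₂⟩ := exists_bound_tsum_of_finite (hA W hW) hV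
      (b := fun x => if x.2 ∈ W then 0 else b x)
      (fun x hx => by
        split_ifs at hx with h
        · exact absurd rfl hx
        · exact ⟨hsupp x hx, h⟩)
      (fun p => by
        obtain ⟨C, hC⟩ := hbdd p
        refine ⟨|C|, fun z hz => ?_⟩
        split_ifs
        · simp
        · exact (hC z hz).trans (le_abs_self C))
    refine ⟨C₁ + C₂, fun z hz => ?_⟩
    have hdsum : ∀ v, Summable fun p => d v (z, p) * phaseExp z p := fun v => by
      have := (hshift v z hz).sub (hcsum v z hz)
      simpa only [hd, sub_mul] using this
    have hfin : Summable fun p => (if p ∈ W then 0 else b (z, p)) * phaseExp z p := by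
      refine summable_of_hasFiniteSupport ((hA W hW).subset fun p hp => ?_)
      rw [Function.mem_support] at hp
      have h := left_ne_zero_of_mul hp
      split_ifs at h with hpW
      · exact absurd rfl h
      · exact ⟨hsupp _ h, hpW⟩
    have htot := ((hparts (1, 0) z hz).add (hparts (0, 1) z hz)).add hfin.hasSum
    have hfun : ∀ p, b (z, p) * phaseExp z p =
        c (1, 0) (z, p) * phaseIncr (1, 0) z p * phaseExp z p +
          c (0, 1) (z, p) * phaseIncr (0, 1) z p * phaseExp z p +
          (if p ∈ W then 0 else b (z, p)) * phaseExp z p := by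
      intro p
      simp only [hc]
      split_ifs with hpW
      · have hE : (phaseEnergy z p : ℂ) ≠ 0 := by
          exact_mod_cast (hδ.trans_le (hQ z hz p hpW)).ne'
        have e : (phaseEnergy z p : ℂ) =
            (starRingEnd ℂ) (phaseIncr (1, 0) z p) * phaseIncr (1, 0) z p +
              (starRingEnd ℂ) (phaseIncr (0, 1) z p) * phaseIncr (0, 1) z p := by
          rw [Complex.conj_mul', Complex.conj_mul', phaseEnergy]
          push_cast
          ring
        have e' : (phaseEnergy z p : ℂ)⁻¹ *
            ((starRingEnd ℂ) (phaseIncr (1, 0) z p) * phaseIncr (1, 0) z p +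
              (starRingEnd ℂ) (phaseIncr (0, 1) z p) * phaseIncr (0, 1) z p) = 1 := by
          rw [← e, inv_mul_cancel₀ hE]
        linear_combination (-(b (z, p) * phaseExp z p)) * e'
      · ring
    simp only [hfun]
    rw [htot.tsum_eq, ← (hdsum (1, 0)).tsum_add (hdsum (0, 1))]
    refine (norm_add_le _ _).trans (add_le_add ?_ (hC₂ z hz))
    simpa only [add_mul] using hC₁ z hz

/-! ### Non-resonant times -/

/-- The time `t` is non-resonant for the slopes in `[α, β]`: there `t ∇F` avoids `2π ℤ²`. -/
def NonResonant (α β t : ℝ) : Prop :=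
  ∀ r ∈ Icc α β, ¬(Complex.exp (Complex.I * t * slopeFst r) = 1 ∧
    Complex.exp (Complex.I * t * slopeSnd r) = 1)

lemma continuousOn_slopeFst : ContinuousOn slopeFst (Ioi 0) := by
  have h : Continuous raySq :=
    (continuous_const.mul continuous_id).rpow_const fun _ => Or.inr (by norm_num)
  refine (continuousOn_const.div h.sqrt.continuousOn fun r hr => ?_).div
    (Continuous.continuousOn (by fun_prop)) fun r hr => ?_
  · exact (Real.sqrt_pos.2 (raySq_pos hr)).ne'
  · have := Real.sqrt_pos.2 (add_pos one_pos (raySq_pos hr))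
    positivity

lemma continuousOn_slopeSnd : ContinuousOn slopeSnd (Ioi 0) := by
  have h : Continuous raySq :=
    (continuous_const.mul continuous_id).rpow_const fun _ => Or.inr (by norm_num)
  refine ContinuousOn.div (Continuous.continuousOn (by fun_prop))
    (Continuous.continuousOn (by fun_prop)) fun r hr => ?_
  have := Real.sqrt_pos.2 (add_pos one_pos (raySq_pos hr))
  positivity

/-- The energy of the limiting increments. -/
def limitEnergy (z : ℂ) (d : ℝ × ℝ) : ℝ :=
  ‖Complex.exp (Complex.I * z * d.1) - 1‖ ^ 2 + ‖Complex.exp (Complex.I * z * d.2) - 1‖ ^ 2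

lemma continuous_limitEnergy : Continuous fun x : ℂ × (ℝ × ℝ) => limitEnergy x.1 x.2 := by
  unfold limitEnergy
  fun_prop

lemma limitEnergy_pos {z : ℂ} {d : ℝ × ℝ} (h : ¬(Complex.exp (Complex.I * z * d.1) = 1 ∧
    Complex.exp (Complex.I * z * d.2) = 1)) : 0 < limitEnergy z d := by
  rw [not_and_or] at h
  unfold limitEnergy
  rcases h with h | h
  · have := norm_pos_iff.2 (sub_ne_zero.2 h)
    positivity
  · have := norm_pos_iff.2 (sub_ne_zero.2 h)
    positivity

lemma isCompact_slopes {α β : ℝ} (hα : 0 < α) :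
    IsCompact ((fun r => (slopeFst r, slopeSnd r)) '' Icc α β) := by
  have hsub : Icc α β ⊆ Ioi 0 := fun r hr => hα.trans_le hr.1
  exact isCompact_Icc.image_of_continuousOn
    ((continuousOn_slopeFst.mono hsub).prodMk (continuousOn_slopeSnd.mono hsub))

lemma exists_pos_eventually_lt {Y Z : Type*} [TopologicalSpace Y] [TopologicalSpace Z] {K : Set Z}
    (hK : IsCompact K) {f : Y × Z → ℝ} (hf : Continuous f) {y : Y} (hpos : ∀ d ∈ K, 0 < f (y, d)) :
    ∃ δ > 0, ∀ᶠ x in 𝓝 y ×ˢ 𝓝ˢ K, δ < f x := by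
  obtain ⟨δ, hδ, hδK⟩ : ∃ δ > 0, ∀ d ∈ K, δ < f (y, d) := by
    rcases K.eq_empty_or_nonempty with h | h
    · exact ⟨1, one_pos, by simp [h]⟩
    · obtain ⟨d, hd, hmin⟩ := hK.exists_isMinOn h
        (hf.comp (continuous_const.prodMk continuous_id)).continuousOn
      refine ⟨f (y, d) / 2, half_pos (hpos d hd), fun e he => ?_⟩
      have h1 := hpos d hd
      have h2 : f (y, d) ≤ f (y, e) := isMinOn_iff.1 hmin e he
      linarith
  refine ⟨δ, hδ, ?_⟩
  rw [← nhdsSet_singleton, ← isCompact_singleton.nhdsSet_prod_eq hK]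
  refine (isOpen_lt continuous_const hf).mem_nhdsSet.2 ?_
  rintro ⟨z, d⟩ ⟨hz, hd⟩
  rw [mem_singleton_iff] at hz
  subst hz
  exact hδK d hd

lemma tendsto_freq_shift_coneFilter {α β : ℝ} (hα : 0 < α) :
    Tendsto (fun p : ℤ × ℤ => (freq (p + (1, 0)).1 (p + (1, 0)).2 - freq p.1 p.2,
      freq (p + (0, 1)).1 (p + (0, 1)).2 - freq p.1 p.2)) (coneFilter α β)
      (𝓝ˢ ((fun r => (slopeFst r, slopeSnd r)) '' Icc α β)) := by
  refine tendsto_coneFilter_iff.2 fun r hr => ?_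
  have hr0 : 0 < r := hα.trans_le hr.1
  exact ((tendsto_freq_shift_fst hr0).prodMk_nhds (tendsto_freq_shift_snd hr0)).mono_right
    (nhds_le_nhdsSet ⟨r, hr, rfl⟩)

lemma phaseEnergy_eq (z : ℂ) (p : ℤ × ℤ) : phaseEnergy z p =
    limitEnergy z (freq (p + (1, 0)).1 (p + (1, 0)).2 - freq p.1 p.2,
      freq (p + (0, 1)).1 (p + (0, 1)).2 - freq p.1 p.2) := by
  unfold phaseEnergy phaseIncr limitEnergy
  rfl

/-- The increments of the phase are bounded below near a non-resonant time, far out in the cone. -/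
lemma NonResonant.exists_lower_bound {α β t : ℝ} (hα : 0 < α) (ht : NonResonant α β t) :
    ∃ ρ > 0, ∃ δ > 0, ∃ W ∈ coneFilter α β, ∀ z ∈ Metric.ball (t : ℂ) ρ, ∀ p ∈ W,
      δ ≤ phaseEnergy z p := by
  obtain ⟨δ, hδ, hev⟩ := exists_pos_eventually_lt (isCompact_slopes hα) (y := (t : ℂ))
    (f := fun x => limitEnergy x.1 x.2) continuous_limitEnergy (by
      rintro d ⟨r, hr, rfl⟩
      exact limitEnergy_pos (ht r hr))
  obtain ⟨P, hP, D, hD, hPD⟩ := eventually_prod_iff.1 hev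
  obtain ⟨ρ, hρ, hρP⟩ := Metric.eventually_nhds_iff_ball.1 hP
  refine ⟨ρ, hρ, δ, hδ, _, (tendsto_freq_shift_coneFilter hα).eventually hD,
    fun z hz p hp => ?_⟩
  rw [phaseEnergy_eq]
  exact (hPD (hρP z hz) hp).le

/-! ### The trace in the upper half plane and its boundary values -/

/-- `a` is an amplitude of order zero on the lattice, carried by the cone of slopes in `[α, β]`. -/
structure ConicAmplitude (α β : ℝ) (a : ℤ × ℤ → ℂ) : Prop where
  diffSymbol : ∀ k, DiffSymbol (coneFilter α β) (fun p => (p.2 : ℝ))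
    (fun (v : ℤ × ℤ) p => p + v) k 0 a
  conic : IsConic α β (Function.support a)

/-- The sum `∑ a(p) (i F(p)) ^ k exp (i z F(p))`, for `z` in the upper half plane; formally the
`k`-th derivative of the trace. -/
def traceSum (a : ℤ × ℤ → ℂ) (k : ℕ) (z : ℂ) : ℂ :=
  ∑' p, a p * (Complex.I * freq p.1 p.2) ^ k * phaseExp z p

section Trace

variable {α β : ℝ} {a : ℤ × ℤ → ℂ}

lemma ConicAmplitude.latticeSymbol (hα : 0 < α) (hβ : 0 < β) (ha : ConicAmplitude α β a)
    (V : Set ℂ) (k n : ℕ) :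
    LatticeSymbol α β V n k fun x => a x.2 * (Complex.I * freq x.2.1 x.2.2) ^ k := by
  have hS := shiftSystem_coneFilter α β
  have h := (ha.diffSymbol n).mul hS
    (((diffSymbol_freq hα hβ n).ofReal.const_mul Complex.I).pow hS k)
  rw [zero_add, mul_one] at h
  exact h.latticeSymbol V

lemma ConicAmplitude.summable (hα : 0 < α) (hβ : 0 < β) (ha : ConicAmplitude α β a) (k : ℕ)
    {z : ℂ} (hz : 0 < z.im) :
    Summable fun p => a p * (Complex.I * freq p.1 p.2) ^ k * phaseExp z p :=
  summable_mul_phaseExp hα hβ ha.conic (ha.latticeSymbol hα hβ univ k 0)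
    (fun _ hx => left_ne_zero_of_mul hx) (mem_univ z) hz

lemma ConicAmplitude.hasDerivAt_traceSum (hα : 0 < α) (hβ : 0 < β) (ha : ConicAmplitude α β a)
    (k : ℕ) {z : ℂ} (hz : 0 < z.im) : HasDerivAt (traceSum a k) (traceSum a (k + 1) z) z := by
  have hc : 0 < (((z.im / 2 : ℝ) : ℂ) * Complex.I).im := by simpa using hz
  have hg : ∀ (p : ℤ × ℤ) (w : ℂ), w ∈ {w : ℂ | z.im / 2 < w.im} →
      HasDerivAt (fun w => a p * (Complex.I * freq p.1 p.2) ^ k * phaseExp w p)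
        (a p * (Complex.I * freq p.1 p.2) ^ (k + 1) * phaseExp w p) w := by
    intro p w _
    have h1 : HasDerivAt (fun w : ℂ => Complex.I * w * (freq p.1 p.2 : ℂ))
        (Complex.I * freq p.1 p.2) w := by
      simpa using ((hasDerivAt_id w).const_mul Complex.I).mul_const (freq p.1 p.2 : ℂ)
    refine (h1.cexp.const_mul (a p * (Complex.I * freq p.1 p.2) ^ k)).congr_deriv ?_
    rw [phaseExp]
    ring
  have hg' : ∀ (p : ℤ × ℤ) (w : ℂ), w ∈ {w : ℂ | z.im / 2 < w.im} →
      ‖a p * (Complex.I * freq p.1 p.2) ^ (k + 1) * phaseExp w p‖ ≤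
        ‖a p * (Complex.I * freq p.1 p.2) ^ (k + 1) *
          phaseExp (((z.im / 2 : ℝ) : ℂ) * Complex.I) p‖ := by
    intro p w hw
    have hw : z.im / 2 < w.im := hw
    rw [norm_mul, norm_mul _ (phaseExp _ _), norm_phaseExp, norm_phaseExp,
      show (((z.im / 2 : ℝ) : ℂ) * Complex.I).im = z.im / 2 by simp]
    have := mul_le_mul_of_nonneg_right hw.le (freq_nonneg p)
    gcongr
  have hzt : z ∈ {w : ℂ | z.im / 2 < w.im} := half_lt_self hz
  exact hasDerivAt_tsum_of_isPreconnected (ha.summable hα hβ (k + 1) hc).norm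
    (isOpen_lt continuous_const Complex.continuous_im)
    (convex_halfSpace_im_gt _).isPreconnected hg hg' hzt (ha.summable hα hβ k hz) hzt

/-- Near a non-resonant time the sums, and those of all their derivatives, are bounded up to the
real axis. -/
lemma NonResonant.exists_bound_traceSum (hα : 0 < α) (hβ : 0 < β) (ha : ConicAmplitude α β a)
    {t : ℝ} (ht : NonResonant α β t) :
    ∃ ρ > 0, ∀ k, ∃ C, ∀ z ∈ Metric.ball (t : ℂ) ρ, 0 < z.im → ‖traceSum a k z‖ ≤ C := by
  obtain ⟨ρ, hρ, δ, hδ, W, hW, hQ⟩ := ht.exists_lower_bound hα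
  have hB : ∀ z ∈ {z | z ∈ Metric.ball (t : ℂ) ρ ∧ 0 < z.im}, ‖z‖ ≤ ‖(t : ℂ)‖ + ρ := by
    intro z hz
    have h := norm_le_norm_add_norm_sub' z t
    have h2 := mem_ball_iff_norm.1 hz.1
    linarith
  refine ⟨ρ, hρ, fun k => ?_⟩
  obtain ⟨C, hC⟩ := exists_bound_oscillatory_tsum hα hβ (fun z hz => hz.2) hB hW hδ
    (fun z hz p hp => hQ z hz.1 p hp) (k := k + 4) (r := k) (by push_cast; linarith) ha.conic
    (ha.latticeSymbol hα hβ _ k _) (fun _ hx => left_ne_zero_of_mul hx)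
    (fun p => ⟨‖a p * (Complex.I * freq p.1 p.2) ^ k‖, fun z _ => le_rfl⟩)
  exact ⟨C, fun z hz hz0 => hC z ⟨hz, hz0⟩⟩

end Trace

/-- Functions in the upper half plane, each of which is the derivative of the preceding one, have
smooth boundary values on an interval near which they are all bounded. -/
lemma exists_smooth_boundaryValue {S : ℕ → ℂ → ℂ} {t₀ ρ : ℝ} (hρ : 0 < ρ)
    (hder : ∀ k z, 0 < z.im → HasDerivAt (S k) (S (k + 1) z) z)
    (hbd : ∀ k, ∃ C, ∀ z ∈ Metric.ball (t₀ : ℂ) ρ, 0 < z.im → ‖S k z‖ ≤ C) :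
    ∃ g : ℝ → ℂ, ContDiffOn ℝ ∞ g (Ioo (t₀ - ρ / 2) (t₀ + ρ / 2)) ∧
      ∀ t ∈ Ioo (t₀ - ρ / 2) (t₀ + ρ / 2),
        Tendsto (fun ε : ℝ => S 0 (t + ε * Complex.I)) (𝓝[>] 0) (𝓝 (g t)) := by
  choose C hC using hbd
  have hmem : ∀ t ∈ Ioo (t₀ - ρ / 2) (t₀ + ρ / 2), ∀ ε ∈ Ioo 0 (ρ / 2),
      (t + ε * Complex.I : ℂ) ∈ Metric.ball (t₀ : ℂ) ρ ∩ {z | 0 < z.im} := by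
    intro t ht ε hε
    refine ⟨?_, by simpa using hε.1⟩
    rw [mem_ball_iff_norm, show (t + ε * Complex.I - t₀ : ℂ) = ((t - t₀ : ℝ) : ℂ) + ε * Complex.I by
      push_cast; ring]
    refine (norm_add_le _ _).trans_lt ?_
    rw [Complex.norm_real, norm_mul, Complex.norm_I, mul_one, Complex.norm_real,
      Real.norm_of_nonneg hε.1.le, Real.norm_eq_abs]
    have : |t - t₀| < ρ / 2 := abs_lt.2 ⟨by linarith [ht.1], by linarith [ht.2]⟩
    linarith [hε.2]
  have hconv : Convex ℝ (Metric.ball (t₀ : ℂ) ρ ∩ {z | 0 < z.im}) :=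
    (convex_ball _ _).inter (convex_halfSpace_im_gt 0)
  have hlip : ∀ k, ∀ t ∈ Ioo (t₀ - ρ / 2) (t₀ + ρ / 2), ∀ ε ∈ Ioo 0 (ρ / 2), ∀ ε' ∈ Ioo 0 (ρ / 2),
      ‖S k (t + ε * Complex.I) - S k (t + ε' * Complex.I)‖ ≤ C (k + 1) * |ε - ε'| := by
    intro k t ht ε hε ε' hε'
    have h := hconv.norm_image_sub_le_of_norm_hasDerivWithin_le
      (fun z hz => (hder k z hz.2).hasDerivWithinAt) (fun z hz => hC (k + 1) z hz.1 hz.2)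
      (hmem t ht ε' hε') (hmem t ht ε hε)
    refine h.trans_eq ?_
    rw [show (t + ε * Complex.I - (t + ε' * Complex.I) : ℂ) = ((ε - ε' : ℝ) : ℂ) * Complex.I by
      push_cast; ring, norm_mul, Complex.norm_I, mul_one, Complex.norm_real, Real.norm_eq_abs]
  have hnhds : ∀ᶠ ε : ℝ in 𝓝[>] 0, ε ∈ Ioo 0 (ρ / 2) := Ioo_mem_nhdsGT (half_pos hρ)
  have hlim : ∀ k, ∀ t ∈ Ioo (t₀ - ρ / 2) (t₀ + ρ / 2), ∃ c,
      Tendsto (fun ε : ℝ => S k (t + ε * Complex.I)) (𝓝[>] 0) (𝓝 c) := by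
    intro k t ht
    have hL : LipschitzOnWith (C (k + 1)).toNNReal (fun ε : ℝ => S k (t + ε * Complex.I))
        (Ioo 0 (ρ / 2)) := LipschitzOnWith.of_dist_le_mul fun ε hε ε' hε' => by
      rw [dist_eq_norm, Real.dist_eq]
      exact (hlip k t ht ε hε ε' hε').trans
        (mul_le_mul_of_nonneg_right (Real.le_coe_toNNReal _) (abs_nonneg _))
    exact cauchy_map_iff_exists_tendsto.1
      (((cauchy_nhds (a := (0 : ℝ))).mono nhdsWithin_le_nhds).map_of_le hL.uniformContinuousOn
        (le_principal_iff.2 hnhds))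
  choose! g hg using hlim
  have hdist : ∀ k, ∀ t ∈ Ioo (t₀ - ρ / 2) (t₀ + ρ / 2), ∀ ε ∈ Ioo 0 (ρ / 2),
      ‖S k (t + ε * Complex.I) - g k t‖ ≤ C (k + 1) * ε := by
    intro k t ht ε hε
    have h1 : Tendsto (fun ε' : ℝ => C (k + 1) * |ε - ε'|) (𝓝[>] 0) (𝓝 (C (k + 1) * |ε - 0|)) :=
      (Continuous.tendsto (by fun_prop) 0).mono_left nhdsWithin_le_nhds
    rw [sub_zero, abs_of_pos hε.1] at h1
    exact le_of_tendsto_of_tendsto (tendsto_const_nhds.sub (hg k t ht)).norm h1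
      (hnhds.mono fun ε' hε' => hlip k t ht ε hε ε' hε')
  have hunif : ∀ k, TendstoUniformlyOn (fun (ε : ℝ) (t : ℝ) => S k (t + ε * Complex.I)) (g k)
      (𝓝[>] 0) (Ioo (t₀ - ρ / 2) (t₀ + ρ / 2)) := by
    intro k
    rw [Metric.tendstoUniformlyOn_iff]
    intro η hη
    have h1 : Tendsto (fun ε : ℝ => C (k + 1) * ε) (𝓝[>] 0) (𝓝 (C (k + 1) * 0)) :=
      (Continuous.tendsto (by fun_prop) 0).mono_left nhdsWithin_le_nhds
    rw [mul_zero] at h1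
    filter_upwards [hnhds, h1.eventually (gt_mem_nhds hη)] with ε hε hlt t ht
    rw [dist_comm, dist_eq_norm]
    exact (hdist k t ht ε hε).trans_lt hlt
  have hgder : ∀ k, ∀ t ∈ Ioo (t₀ - ρ / 2) (t₀ + ρ / 2), HasDerivAt (g k) (g (k + 1) t) t := by
    intro k t ht
    refine hasDerivAt_of_tendstoUniformlyOn isOpen_Ioo (hunif (k + 1)) ?_ (hg k) ht
    filter_upwards [hnhds] with ε hε s hs
    have h1 : HasDerivAt (fun z : ℂ => S k (z + ε * Complex.I)) (S (k + 1) (s + ε * Complex.I))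
        (s : ℂ) := (hder k _ (hmem s hs ε hε).2).comp_add_const _ _
    exact h1.comp_ofReal
  refine ⟨g 0, contDiffOn_infty.2 fun n => ?_, hg 0⟩
  suffices h : ∀ k, ContDiffOn ℝ n (g k) (Ioo (t₀ - ρ / 2) (t₀ + ρ / 2)) from h 0
  induction n with
  | zero =>
    exact fun k => contDiffOn_zero.2 fun t ht => (hgder k t ht).continuousAt.continuousWithinAt
  | succ n ih =>
    intro k
    push_cast
    refine (contDiffOn_succ_iff_deriv_of_isOpen isOpen_Ioo).2
      ⟨fun t ht => (hgder k t ht).differentiableAt.differentiableWithinAt, by simp,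
        (ih (k + 1)).congr fun t ht => (hgder k t ht).deriv⟩

/-! ### The trace as a distribution -/

open scoped FourierTransform

/-- The coefficient `ψ(m) ψ(n) χ(m, n)` of the trace. -/
def amplitude (ψ : ℝ → ℂ) (χ : ℝ × ℝ → ℂ) (p : ℤ × ℤ) : ℂ :=
  ψ p.1 * ψ p.2 * χ ((p.1 : ℝ), (p.2 : ℝ))

/-- Far out in the cone `m, n ≥ 1`, so that the cutoffs `ψ` are equal to `1`. -/
lemma conicAmplitude_amplitude {κ₁ κ₂ : ℝ} (hκ₁ : 0 < κ₁) (hκ : κ₁ < κ₂) {ψ : ℝ → ℂ}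
    {χ : ℝ × ℝ → ℂ} (hψ : IsPositiveCutoff ψ) (hχ : IsSymbol 0 χ)
    (hsupp : Function.support χ ⊆ middleSector κ₁ κ₂) :
    ConicAmplitude (κ₁ / 2) (2 * κ₂) (amplitude ψ χ) := by
  have hα : 0 < κ₁ / 2 := half_pos hκ₁
  have hβ : 0 < 2 * κ₂ := by linarith
  refine ⟨fun k => ?_, fun W hW => ?_⟩
  · refine (hχ.diffSymbol (w := fun p : ℤ × ℤ => ((p.1 : ℝ), (p.2 : ℝ)))
      (c := fun v : ℤ × ℤ => ((v.1 : ℝ), (v.2 : ℝ))) (norm_rpow_isBigO hα hβ)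
      (fun v p => by simp) k).congr (shiftSystem_coneFilter _ _) ?_
    filter_upwards [eventually_coneFilter hα hβ] with p hp
    obtain ⟨h1, h2, -⟩ := hp
    have hm0 : (0 : ℝ) < p.1 := lt_of_lt_of_le (by positivity) h2
    have hm : (1 : ℝ) ≤ p.1 := by exact_mod_cast Int.cast_pos.1 hm0
    rw [amplitude, hψ.2.1 _ hm, hψ.2.1 _ h1, one_mul, one_mul]
  · refine (isConic_sector hα (by linarith) W hW).subset fun p hp => ⟨?_, hp.2⟩
    exact hsupp (right_ne_zero_of_mul hp.1)

lemma traceTerm_apply (ψ : ℝ → ℂ) (χ : ℝ × ℝ → ℂ) (p : ℤ × ℤ) (φ : 𝓢(ℝ, ℂ)) :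
    traceTerm ψ χ p φ = amplitude ψ χ p * ∫ t, φ t * phaseExp t p := by
  change amplitude ψ χ p • wave (freq p.1 p.2) φ = _
  rw [wave, Function.HasTemperateGrowth.toTemperedDistribution_apply volume
    (hasTemperateGrowth_wave _), smul_eq_mul]
  congr 2
  ext t
  rw [smul_eq_mul, phaseExp]
  push_cast
  ring_nf

lemma integral_mul_phaseExp (p : ℤ × ℤ) (φ : 𝓢(ℝ, ℂ)) :
    ∫ t : ℝ, φ t * phaseExp t p = 𝓕 φ (-(freq p.1 p.2 / (2 * π))) := by
  rw [SchwartzMap.fourier_coe, Real.fourier_real_eq_integral_exp_smul]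
  congr 1
  ext t
  rw [smul_eq_mul, mul_comm, phaseExp]
  congr 2
  have : (π : ℂ) ≠ 0 := by exact_mod_cast Real.pi_ne_zero
  push_cast
  field_simp

section

variable {α β : ℝ} {a : ℤ × ℤ → ℂ}

lemma ConicAmplitude.summable_norm_mul_rpow (hα : 0 < α) (hβ : 0 < β) (ha : ConicAmplitude α β a) :
    Summable fun p => ‖a p‖ * ((1 + freq p.1 p.2 / (2 * π)) ^ 4)⁻¹ := by
  have h : Summable fun p => a p * ((((1 + freq p.1 p.2 / (2 * π)) ^ 4)⁻¹ : ℝ) : ℂ) := by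
    refine ha.conic.summable (fun p hp => left_ne_zero_of_mul hp) ?_
    have h1 := (ha.diffSymbol 0).isBigO
    have h2 : (fun p : ℤ × ℤ => ((((1 + freq p.1 p.2 / (2 * π)) ^ 4)⁻¹ : ℝ) : ℂ))
        =O[coneFilter α β] fun p => (p.2 : ℝ) ^ (-4 : ℝ) := by
      refine Asymptotics.IsBigO.of_bound ((2 * π) ^ 4) ?_
      filter_upwards [eventually_coneFilter hα hβ] with p hp
      have hn : (0 : ℝ) < p.2 := by linarith [hp.1]
      have hF : (p.2 : ℝ) ≤ freq p.1 p.2 := (le_abs_self _).trans (abs_snd_le_freq p)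
      have hF0 := freq_nonneg p
      rw [Complex.norm_real, Real.norm_of_nonneg (by positivity),
        Real.norm_of_nonneg (by positivity), Real.rpow_neg hn.le,
        show (4 : ℝ) = ((4 : ℕ) : ℝ) by norm_num, Real.rpow_natCast,
        ← div_eq_mul_inv, ← div_pow, ← inv_pow]
      have h3 : (p.2 : ℝ) / (2 * π) ≤ 1 + freq p.1 p.2 / (2 * π) :=
        (div_le_div_of_nonneg_right hF (by positivity)).trans (by linarith)
      have h4 : (1 + freq p.1 p.2 / (2 * π))⁻¹ ≤ 2 * π / p.2 := by
        rw [← inv_div (p.2 : ℝ)]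
        exact inv_anti₀ (by positivity) h3
      gcongr
    have h3 := h1.mul h2
    simp only [Real.rpow_zero, one_mul] at h3
    exact h3.trans (rpow_neg_four_isBigO hα hβ)
  refine h.norm.congr fun p => ?_
  have := freq_nonneg p
  rw [norm_mul, Complex.norm_real, Real.norm_of_nonneg (by positivity)]

lemma norm_apply_freq_le (φ : 𝓢(ℝ, ℂ)) (p : ℤ × ℤ) : ‖φ (-(freq p.1 p.2 / (2 * π)))‖ ≤
    ((1 + freq p.1 p.2 / (2 * π)) ^ 4)⁻¹ *
      (2 ^ 4 * ((Finset.Iic ((4, 0) : ℕ × ℕ)).sup (schwartzSeminormFamily ℂ ℝ ℂ)) φ) := by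
  have h := SchwartzMap.one_add_le_sup_seminorm_apply (𝕜 := ℂ) (m := (4, 0)) (k := 4) (n := 0)
    le_rfl le_rfl φ (-(freq p.1 p.2 / (2 * π)))
  have h0 : 0 ≤ freq p.1 p.2 / (2 * π) := div_nonneg (freq_nonneg p) (by positivity)
  rw [norm_iteratedFDeriv_zero, norm_neg, Real.norm_of_nonneg h0] at h
  rw [le_inv_mul_iff₀ (by positivity)]
  exact h

lemma ConicAmplitude.summable_mul_apply (hα : 0 < α) (hβ : 0 < β) (ha : ConicAmplitude α β a)
    (φ : 𝓢(ℝ, ℂ)) : Summable fun p => a p * φ (-(freq p.1 p.2 / (2 * π))) := by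
  refine Summable.of_norm_bounded ((ha.summable_norm_mul_rpow hα hβ).mul_right
    (2 ^ 4 * ((Finset.Iic ((4, 0) : ℕ × ℕ)).sup (schwartzSeminormFamily ℂ ℝ ℂ)) φ)) fun p => ?_
  rw [norm_mul, mul_assoc]
  exact mul_le_mul_of_nonneg_left (norm_apply_freq_le φ p) (norm_nonneg _)

/-- The continuous functional `φ ↦ ∑ a(p) φ(-F(p) / 2π)`, whose Fourier transform is the trace. -/
def ConicAmplitude.sumCLM (hα : 0 < α) (hβ : 0 < β) (ha : ConicAmplitude α β a) :
    𝓢(ℝ, ℂ) →L[ℂ] ℂ :=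
  SchwartzMap.mkCLMtoNormedSpace (fun φ => ∑' p, a p * φ (-(freq p.1 p.2 / (2 * π))))
    (fun φ θ => by
      rw [← (ha.summable_mul_apply hα hβ φ).tsum_add (ha.summable_mul_apply hα hβ θ)]
      simp only [add_apply, mul_add])
    (fun c φ => by
      rw [RingHom.id_apply, smul_eq_mul, ← tsum_mul_left]
      simp only [smul_apply, smul_eq_mul, mul_left_comm])
    ⟨Finset.Iic (4, 0), (∑' p, ‖a p‖ * ((1 + freq p.1 p.2 / (2 * π)) ^ 4)⁻¹) * 2 ^ 4, by
      refine mul_nonneg (tsum_nonneg fun p => ?_) (by positivity)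
      have := freq_nonneg p
      positivity, fun φ => by
      rw [mul_assoc]
      refine tsum_of_norm_bounded ((ha.summable_norm_mul_rpow hα hβ).hasSum.mul_right _) fun p => ?_
      rw [norm_mul, mul_assoc]
      exact mul_le_mul_of_nonneg_left (norm_apply_freq_le φ p) (norm_nonneg _)⟩

end

/-- The series defining the trace converges, to the Fourier transform of `sumCLM`. -/
lemma hasSum_traceTerm {α β : ℝ} (hα : 0 < α) (hβ : 0 < β) {ψ : ℝ → ℂ} {χ : ℝ × ℝ → ℂ}
    (ha : ConicAmplitude α β (amplitude ψ χ)) :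
    HasSum (traceTerm ψ χ) (ContinuousLinearMap.toPointwiseConvergenceCLM _ _ _ _
      (ha.sumCLM hα hβ ∘L FourierTransform.fourierCLM ℂ 𝓢(ℝ, ℂ)) : 𝓢'(ℝ, ℂ)) := by
  refine PointwiseConvergenceCLM.tendsto_iff_forall_tendsto.2 fun φ => ?_
  have h := (ha.summable_mul_apply hα hβ (𝓕 φ)).hasSum
  refine Tendsto.congr (fun s => ?_) h
  have h1 : ∀ s : Finset (ℤ × ℤ), (∑ p ∈ s, traceTerm ψ χ p) φ = ∑ p ∈ s, traceTerm ψ χ p φ := by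
    intro s
    exact map_sum (PointwiseConvergenceCLM.evalCLM (RingHom.id ℂ) ℂ φ) _ _
  rw [h1]
  refine Finset.sum_congr rfl fun p _ => ?_
  rw [traceTerm_apply, integral_mul_phaseExp]

lemma localTrace_apply {α β : ℝ} (hα : 0 < α) (hβ : 0 < β) {ψ : ℝ → ℂ} {χ : ℝ × ℝ → ℂ}
    (ha : ConicAmplitude α β (amplitude ψ χ)) (φ : 𝓢(ℝ, ℂ)) :
    HasSum (fun p => amplitude ψ χ p * ∫ t : ℝ, φ t * phaseExp t p) (localTrace ψ χ φ) := by
  rw [localTrace, (hasSum_traceTerm hα hβ ha).tsum_eq]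
  simp only [integral_mul_phaseExp]
  exact (ha.summable_mul_apply hα hβ (𝓕 φ)).hasSum

/-! ### Smoothness of the trace at non-resonant times -/

section

variable {α β : ℝ}

/-- Integrating the trace along a line in the upper half plane, term by term. -/
lemma ConicAmplitude.hasSum_integral (hα : 0 < α) (hβ : 0 < β) {a : ℤ × ℤ → ℂ}
    (ha : ConicAmplitude α β a) (φ : 𝓢(ℝ, ℂ)) {ε : ℝ} (hε : 0 < ε) :
    HasSum (fun p => phaseExp (ε * Complex.I) p * (a p * ∫ t : ℝ, φ t * phaseExp t p))
      (∫ t : ℝ, φ t * traceSum a 0 (t + ε * Complex.I)) := by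
  have hexp : ∀ (t : ℝ) (p : ℤ × ℤ),
      phaseExp (t + ε * Complex.I) p = phaseExp (ε * Complex.I) p * phaseExp t p := by
    intro t p
    rw [phaseExp, phaseExp, phaseExp, ← Complex.exp_add]
    ring_nf
  have hnorm : ∀ (t : ℝ) (p : ℤ × ℤ), ‖phaseExp t p‖ = 1 := by
    intro t p
    rw [norm_phaseExp]
    simp
  have hint : ∀ p, Integrable fun t : ℝ => φ t * phaseExp t p := by
    intro p
    refine φ.integrable.mono (Continuous.aestronglyMeasurable ?_) (ae_of_all _ fun t => ?_)
    · have := φ.continuous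
      unfold phaseExp
      fun_prop
    · rw [norm_mul, hnorm, mul_one]
  have hs := ha.summable hα hβ 0 (z := ε * Complex.I) (by simpa using hε)
  simp only [pow_zero, mul_one] at hs
  have h := hasSum_integral_of_summable_integral_norm
    (F := fun (p : ℤ × ℤ) (t : ℝ) => a p * phaseExp (ε * Complex.I) p * (φ t * phaseExp t p))
    (fun p => (hint p).const_mul _) (by
      simp only [norm_mul, hnorm, mul_one, integral_const_mul]
      refine Summable.mul_right _ (hs.norm.congr fun p => ?_)
      rw [norm_mul])
  have e : ∀ t : ℝ, ∑' p, a p * phaseExp (ε * Complex.I) p * (φ t * phaseExp t p) =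
      φ t * traceSum a 0 (t + ε * Complex.I) := by
    intro t
    rw [traceSum, ← tsum_mul_left]
    refine tsum_congr fun p => ?_
    rw [hexp]
    ring
  simp only [e, integral_const_mul] at h
  refine h.congr_fun fun p => ?_
  ring

/-- Abel summation of the series defining the trace. -/
lemma tendsto_integral_traceSum (hα : 0 < α) (hβ : 0 < β) {ψ : ℝ → ℂ} {χ : ℝ × ℝ → ℂ}
    (ha : ConicAmplitude α β (amplitude ψ χ)) (φ : 𝓢(ℝ, ℂ)) :
    Tendsto (fun ε : ℝ => ∫ t : ℝ, φ t * traceSum (amplitude ψ χ) 0 (t + ε * Complex.I))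
      (𝓝[>] 0) (𝓝 (localTrace ψ χ φ)) := by
  have hL := localTrace_apply hα hβ ha φ
  rw [← hL.tsum_eq]
  have hev : ∀ᶠ ε : ℝ in 𝓝[>] 0, 0 < ε := self_mem_nhdsWithin
  refine Tendsto.congr' (hev.mono fun ε hε => (ha.hasSum_integral hα hβ φ hε).tsum_eq) ?_
  refine tendsto_tsum_of_dominated_convergence hL.summable.norm (fun p => ?_)
    (hev.mono fun ε hε p => ?_)
  · have h : Tendsto (fun ε : ℝ => phaseExp (ε * Complex.I) p) (𝓝[>] 0)
        (𝓝 (phaseExp ((0 : ℝ) * Complex.I) p)) :=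
      (Continuous.tendsto (by unfold phaseExp; fun_prop) 0).mono_left nhdsWithin_le_nhds
    have h1 : phaseExp ((0 : ℝ) * Complex.I) p = 1 := by simp [phaseExp]
    rw [h1] at h
    simpa using h.mul_const _
  · rw [norm_mul]
    exact mul_le_of_le_one_left (norm_nonneg _) (norm_phaseExp_le_one (by simpa using hε.le) p)

/-- The trace is smooth on the set of non-resonant times: it is the boundary value of the
holomorphic function `traceSum`. -/
theorem isSmoothOn_localTrace (hα : 0 < α) (hβ : 0 < β) {ψ : ℝ → ℂ} {χ : ℝ × ℝ → ℂ}
    (ha : ConicAmplitude α β (amplitude ψ χ)) {U : Set ℝ} (hU : ∀ t ∈ U, NonResonant α β t) :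
    IsSmoothOn (localTrace ψ χ) U := by
  set S := traceSum (amplitude ψ χ) with hS
  have hder : ∀ k z, 0 < z.im → HasDerivAt (S k) (S (k + 1) z) z := fun k z hz =>
    ha.hasDerivAt_traceSum hα hβ k hz
  have hloc : ∀ t₀ ∈ U, ∃ J ∈ 𝓝 t₀, IsOpen J ∧ (∃ C, ∀ᶠ ε : ℝ in 𝓝[>] 0, ∀ t ∈ J,
      ‖S 0 (t + ε * Complex.I)‖ ≤ C) ∧ ∃ g : ℝ → ℂ, ContDiffOn ℝ ∞ g J ∧ ∀ t ∈ J,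
        Tendsto (fun ε : ℝ => S 0 (t + ε * Complex.I)) (𝓝[>] 0) (𝓝 (g t)) := by
    intro t₀ ht₀
    obtain ⟨ρ, hρ, hbd⟩ := (hU t₀ ht₀).exists_bound_traceSum hα hβ ha
    obtain ⟨C, hC⟩ := hbd 0
    refine ⟨Ioo (t₀ - ρ / 2) (t₀ + ρ / 2), Ioo_mem_nhds (by linarith) (by linarith), isOpen_Ioo,
      ⟨C, ?_⟩, exists_smooth_boundaryValue hρ hder hbd⟩
    filter_upwards [Ioo_mem_nhdsGT (half_pos hρ)] with ε hε t ht
    refine hC _ ?_ (by simpa using hε.1)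
    rw [mem_ball_iff_norm, show (t + ε * Complex.I - t₀ : ℂ) =
      ((t - t₀ : ℝ) : ℂ) + ε * Complex.I by push_cast; ring]
    refine (norm_add_le _ _).trans_lt ?_
    rw [Complex.norm_real, norm_mul, Complex.norm_I, mul_one, Complex.norm_real,
      Real.norm_of_nonneg hε.1.le, Real.norm_eq_abs]
    have : |t - t₀| < ρ / 2 := abs_lt.2 ⟨by linarith [ht.1], by linarith [ht.2]⟩
    linarith [hε.2]
  set G : ℝ → ℂ := fun t => limUnder (𝓝[>] 0) fun ε : ℝ => S 0 (t + ε * Complex.I) with hG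
  have hlim : ∀ t ∈ U, Tendsto (fun ε : ℝ => S 0 (t + ε * Complex.I)) (𝓝[>] 0) (𝓝 (G t)) := by
    intro t ht
    obtain ⟨J, hJ, -, -, g, -, hg⟩ := hloc t ht
    exact tendsto_nhds_limUnder ⟨_, hg t (mem_of_mem_nhds hJ)⟩
  refine ⟨G, fun t₀ ht₀ => ?_, fun φ hφ hφU => ?_⟩
  · obtain ⟨J, hJ, -, -, g, hgs, hg⟩ := hloc t₀ ht₀
    refine ((hgs.contDiffAt hJ).congr_of_eventuallyEq ?_).contDiffWithinAt
    filter_upwards [hJ] with t ht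
    exact (hg t ht).limUnder_eq
  · refine tendsto_nhds_unique (tendsto_integral_traceSum hα hβ ha φ) ?_
    obtain ⟨C, hC⟩ : ∃ C, ∀ᶠ ε : ℝ in 𝓝[>] 0, ∀ t ∈ tsupport φ,
        ‖S 0 (t + ε * Complex.I)‖ ≤ C := by
      refine IsCompact.induction_on (p := fun K : Set ℝ => ∃ C, ∀ᶠ ε : ℝ in 𝓝[>] 0, ∀ t ∈ K,
        ‖S 0 (t + ε * Complex.I)‖ ≤ C) hφ ⟨0, by simp⟩ ?_ ?_ ?_
      · rintro s t hst ⟨C, hC⟩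
        exact ⟨C, hC.mono fun ε h x hx => h x (hst hx)⟩
      · rintro s t ⟨C, hC⟩ ⟨D, hD⟩
        refine ⟨max C D, ?_⟩
        filter_upwards [hC, hD] with ε h1 h2 x hx
        rcases hx with hx | hx
        · exact (h1 x hx).trans (le_max_left _ _)
        · exact (h2 x hx).trans (le_max_right _ _)
      · intro t ht
        obtain ⟨J, hJ, -, hC, -⟩ := hloc t (hφU ht)
        exact ⟨J, mem_nhdsWithin_of_mem_nhds hJ, hC⟩
    have hzero : ∀ t, t ∉ tsupport φ → φ t = 0 := fun t ht => image_eq_zero_of_notMem_tsupport ht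
    have hpos : ∀ᶠ ε : ℝ in 𝓝[>] 0, 0 < ε := self_mem_nhdsWithin
    refine tendsto_integral_filter_of_dominated_convergence (fun t => ‖φ t‖ * C)
      (hpos.mono fun ε hε => ?_) (hC.mono fun ε h => ae_of_all _ fun t => ?_)
      (φ.integrable.norm.mul_const C) (ae_of_all _ fun t => ?_)
    · refine (φ.continuous.mul (continuous_iff_continuousAt.2 fun t => ?_)).aestronglyMeasurable
      have h1 : ContinuousAt (S 0) (t + ε * Complex.I) :=
        (hder 0 _ (by simpa using hε)).continuousAt
      exact ContinuousAt.comp (f := fun t : ℝ => (t + ε * Complex.I : ℂ)) h1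
        (Continuous.continuousAt (by fun_prop))
    · by_cases ht : t ∈ tsupport φ
      · rw [norm_mul]
        exact mul_le_mul_of_nonneg_left (h t ht) (norm_nonneg _)
      · simp [hzero t ht]
    · by_cases ht : t ∈ tsupport φ
      · exact (hlim t (hφU ht)).const_mul _
      · simp [hzero t ht]

end

/-! ### Quadratic equations for `π ^ 2` -/

lemma exists_int_pow_add_pow {u v : ℂ} {s q : ℤ} (hs : u + v = s) (hq : u * v = q) (k : ℕ) :
    ∃ z : ℤ, u ^ k + v ^ k = z := by
  induction k using Nat.strong_induction_on with
  | _ k ih =>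
    match k with
    | 0 => exact ⟨2, by norm_num⟩
    | 1 => exact ⟨s, by simpa using hs⟩
    | k + 2 =>
      obtain ⟨x, hx⟩ := ih (k + 1) (by omega)
      obtain ⟨y, hy⟩ := ih k (by omega)
      refine ⟨s * x - q * y, ?_⟩
      push_cast
      rw [← hx, ← hy, ← hs, ← hq]
      ring

/-- Values of an integer polynomial, summed over `±x` and `±y`, where `x ^ 2` and `y ^ 2` are
conjugate algebraic numbers with denominator `d`. -/
lemma exists_int_sum_aeval {x y : ℂ} {d s q : ℤ} (hs : d * x ^ 2 + d * y ^ 2 = s)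
    (hq : d * x ^ 2 * (d * y ^ 2) = q) (g : Polynomial ℤ) {M : ℕ} (hM : g.natDegree ≤ M) :
    ∃ z : ℤ, (d : ℂ) ^ M * (g.aeval x + g.aeval (-x) + g.aeval y + g.aeval (-y)) = z := by
  have h : ∀ i ∈ Finset.range (M + 1), ∃ z : ℤ,
      (d : ℂ) ^ M * (g.coeff i * (x ^ i + (-x) ^ i + y ^ i + (-y) ^ i)) = z := by
    intro i hi
    rcases Nat.even_or_odd i with he | ho
    · rw [he.neg_pow, he.neg_pow]
      obtain ⟨k, rfl⟩ := he
      obtain ⟨z, hz⟩ := exists_int_pow_add_pow hs hq k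
      have hk : M = (M - k) + k := by
        have := Finset.mem_range.1 hi
        omega
      refine ⟨d ^ (M - k) * g.coeff (k + k) * (2 * z), ?_⟩
      push_cast
      rw [← hz, hk, Nat.add_sub_cancel]
      ring
    · rw [ho.neg_pow, ho.neg_pow]
      exact ⟨0, by push_cast; ring⟩
  choose! z hz using h
  refine ⟨∑ i ∈ Finset.range (M + 1), z i, ?_⟩
  have hlt : g.natDegree < M + 1 := by omega
  simp only [Polynomial.aeval_eq_sum_range' hlt, ← Finset.sum_add_distrib, Finset.mul_sum]
  push_cast
  refine Finset.sum_congr rfl fun i hi => ?_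
  rw [← hz i hi]
  simp only [zsmul_eq_mul]
  ring

/-- The number `π ^ 2` is not a root of a quadratic polynomial with rational coefficients whose
other root is negative. If it were, the numbers `±iπ` and `±θ`, where `-θ ^ 2` is the other root,
would be permuted by the Galois group, and so would the sums `±iπ ± θ`. Expanding
`(2 + e^{iπ} + e^{-iπ}) (2 + e^θ + e^{-θ}) = 0` then gives a relation of the form
`4 + 2 ∑ e^a + ∑ e^b = 0` between exponentials over complete sets of conjugates, which contradicts
Hermite's simultaneous approximation of exponentials. -/
lemma int_mul_pi_pow_four_ne_zero {d s q : ℤ} (hd : 0 < d) (hq : q < 0) :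
    (d : ℝ) * π ^ 4 - s * π ^ 2 + q ≠ 0 := by
  intro h0
  have hdR : (0 : ℝ) < d := by exact_mod_cast hd
  have hqR : (q : ℝ) < 0 := by exact_mod_cast hq
  obtain ⟨θ, hθ⟩ : ∃ θ : ℝ, d * θ ^ 2 = d * π ^ 2 - s := by
    have hpos : 0 < d * π ^ 2 - s := by
      have : 0 < π ^ 2 * (d * π ^ 2 - s) := by nlinarith
      exact pos_of_mul_pos_right this (by positivity)
    refine ⟨√((d * π ^ 2 - s) / d), ?_⟩
    rw [Real.sq_sqrt (by positivity)]
    field_simp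
  obtain ⟨a, ha⟩ : ∃ a : ℂ, a = π * Complex.I := ⟨_, rfl⟩
  obtain ⟨t, ht⟩ : ∃ t : ℂ, t = θ := ⟨_, rfl⟩
  -- `-a ^ 2` and `-t ^ 2` are the two roots of `d X ^ 2 - s X + q`
  have ha2 : a ^ 2 = -(π : ℂ) ^ 2 := by rw [ha, mul_pow, Complex.I_sq]; ring
  have hsum : (d : ℂ) * (a ^ 2 + t ^ 2) = -s := by
    have : (d : ℂ) * θ ^ 2 = d * π ^ 2 - s := by exact_mod_cast congrArg Complex.ofReal hθ
    rw [ha2, ht]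
    linear_combination this
  have hprod : (d : ℂ) * (a ^ 2 * t ^ 2) = q := by
    have h1 : (d : ℂ) * θ ^ 2 = d * π ^ 2 - s := by exact_mod_cast congrArg Complex.ofReal hθ
    have h2 : (d : ℂ) * π ^ 4 - s * π ^ 2 + q = 0 := by exact_mod_cast congrArg Complex.ofReal h0
    rw [ha2, ht]
    linear_combination -(π : ℂ) ^ 2 * h1 - h2
  have he : Complex.exp a = -1 := by rw [ha, Complex.exp_pi_mul_I]
  have he' : Complex.exp (-a) = -1 := by rw [Complex.exp_neg, he]; norm_num
  -- the integer polynomial with the roots `±a`, `±t`, `±(a + t)`, `±(a - t)`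
  obtain ⟨f, hf⟩ : ∃ f : Polynomial ℤ, f = (.C d * .X ^ 4 + .C s * .X ^ 2 + .C q) *
      (.C (d ^ 2) * .X ^ 4 + .C (2 * d * s) * .X ^ 2 + .C (s ^ 2 - 4 * q * d)) := ⟨_, rfl⟩
  have hfe : ∀ r : ℂ, f.aeval r = (d * r ^ 4 + s * r ^ 2 + q) *
      (d ^ 2 * r ^ 4 + 2 * d * s * r ^ 2 + (s ^ 2 - 4 * q * d)) := by
    intro r
    simp only [hf, map_mul, map_add, map_pow, Polynomial.aeval_C, Polynomial.aeval_X]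
    simp
  have hf0 : f.eval 0 ≠ 0 := by
    have h1 : f.eval 0 = q * (s ^ 2 - 4 * q * d) := by simp [hf]
    rw [h1]
    exact mul_ne_zero hq.ne (by nlinarith [sq_nonneg s, mul_pos (neg_pos.2 hq) hd])
  have hfne : f ≠ 0 := fun h => hf0 (by simp [h])
  have hdeg : f.natDegree ≤ 8 := by rw [hf]; compute_degree
  have hroot : ∀ r : ℂ, (r ^ 2 = a ^ 2 ∨ r ^ 2 = t ^ 2 ∨ r ^ 2 = (a + t) ^ 2 ∨
      r ^ 2 = (a - t) ^ 2) → r ∈ f.aroots ℂ := by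
    intro r hr
    rw [Polynomial.mem_aroots, hfe, show r ^ 4 = (r ^ 2) ^ 2 by ring]
    refine ⟨hfne, mul_eq_zero.2 ?_⟩
    rcases hr with h | h | h | h
    · left
      rw [h]
      linear_combination a ^ 2 * hsum - hprod
    · left
      rw [h]
      linear_combination t ^ 2 * hsum - hprod
    · right
      rw [h]
      linear_combination (d * (a ^ 2 + t ^ 2) + 4 * d * a * t + s) * hsum + 4 * d * hprod
    · right
      rw [h]
      linear_combination (d * (a ^ 2 + t ^ 2) - 4 * d * a * t + s) * hsum + 4 * d * hprod
  obtain ⟨c, hc⟩ := LindemannWeierstrass.exp_polynomial_approx f hf0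
  -- a prime large enough for the approximation to be better than the denominators allow
  obtain ⟨p, hpp, hp1, hp2, hp3⟩ : ∃ p : ℕ, p.Prime ∧ (f.eval 0).natAbs < p ∧
      (4 * d).natAbs < p ∧ 12 * (|c| * d ^ 8) ^ p / ((p - 1).factorial : ℝ) < 1 := by
    have h1 := (FloorSemiring.tendsto_pow_div_factorial_atTop (|c| * (d : ℝ) ^ 8)).const_mul
      (12 * (|c| * (d : ℝ) ^ 8))
    rw [mul_zero] at h1
    obtain ⟨n, hn⟩ := eventually_atTop.1 (h1.eventually (gt_mem_nhds one_pos))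
    obtain ⟨p, hle, hpp⟩ := Nat.exists_infinite_primes
      (n + 1 + ((f.eval 0).natAbs + 1) + ((4 * d).natAbs + 1))
    refine ⟨p, hpp, by omega, by omega, ?_⟩
    have h2 := hn (p - 1) (by omega)
    have h3 : p = (p - 1) + 1 := by omega
    refine lt_of_eq_of_lt ?_ h2
    rw [show (|c| * (d : ℝ) ^ 8) ^ p = (|c| * (d : ℝ) ^ 8) ^ (p - 1) * (|c| * (d : ℝ) ^ 8) by
      rw [← pow_succ, ← h3]]
    ring
  obtain ⟨n, hpn, g, hg, hgr⟩ := hc p hp1 hpp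
  have hgM : g.natDegree ≤ 8 * p := by
    have : p * f.natDegree ≤ p * 8 := Nat.mul_le_mul_left p hdeg
    omega
  obtain ⟨z₁, hz₁⟩ := exists_int_sum_aeval (x := a) (y := t) (d := d) (s := -s) (q := d * q)
    (by push_cast; linear_combination hsum) (by push_cast; linear_combination (d : ℂ) * hprod) g hgM
  obtain ⟨z₂, hz₂⟩ := exists_int_sum_aeval (x := a + t) (y := a - t) (d := d) (s := -(2 * s))
    (q := s ^ 2 - 4 * d * q) (by push_cast; linear_combination 2 * hsum)
    (by push_cast; linear_combination (d * (a ^ 2 + t ^ 2) - s) * hsum - 4 * d * hprod) g hgM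
  set E : ℂ → ℂ := fun r => n • Complex.exp r - p • g.aeval r with hE
  -- the errors of the approximation, and the relation between exponentials
  have hErel : 4 * (n : ℂ) + p * (2 * (g.aeval a + g.aeval (-a) + g.aeval t + g.aeval (-t)) +
      (g.aeval (a + t) + g.aeval (-(a + t)) + g.aeval (a - t) + g.aeval (-(a - t)))) =
      -(2 * (E a + E (-a) + E t + E (-t)) +
        (E (a + t) + E (-(a + t)) + E (a - t) + E (-(a - t)))) := by
    have e1 : Complex.exp (a + t) = -Complex.exp t := by rw [Complex.exp_add, he]; ring
    have e2 : Complex.exp (-(a + t)) = -Complex.exp (-t) := by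
      rw [neg_add, Complex.exp_add, he']; ring
    have e3 : Complex.exp (a - t) = -Complex.exp (-t) := by
      rw [sub_eq_add_neg, Complex.exp_add, he]; ring
    have e4 : Complex.exp (-(a - t)) = -Complex.exp t := by
      rw [neg_sub, sub_eq_add_neg, Complex.exp_add, he']; ring
    simp only [hE, e1, e2, e3, e4, he, he', zsmul_eq_mul, nsmul_eq_mul]
    ring
  have hEle : ∀ r : ℂ, (r ^ 2 = a ^ 2 ∨ r ^ 2 = t ^ 2 ∨ r ^ 2 = (a + t) ^ 2 ∨
      r ^ 2 = (a - t) ^ 2) → ‖E r‖ ≤ |c| ^ p / ((p - 1).factorial : ℝ) := by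
    intro r hr
    refine (hgr (hroot r hr)).trans ?_
    gcongr ?_ / _
    exact (le_abs_self _).trans_eq (abs_pow c p)
  have hfinal : ‖((4 * n * d ^ (8 * p) + p * (2 * z₁ + z₂) : ℤ) : ℂ)‖ < 1 := by
    have e : ((4 * n * d ^ (8 * p) + p * (2 * z₁ + z₂) : ℤ) : ℂ) = (d : ℂ) ^ (8 * p) *
        -(2 * (E a + E (-a) + E t + E (-t)) +
        (E (a + t) + E (-(a + t)) + E (a - t) + E (-(a - t)))) := by
      rw [← hErel]
      push_cast
      rw [← hz₁, ← hz₂]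
      ring
    have hn8 : ∀ x₁ x₂ x₃ x₄ y₁ y₂ y₃ y₄ : ℂ, ‖-(2 * (x₁ + x₂ + x₃ + x₄) + (y₁ + y₂ + y₃ + y₄))‖ ≤
        2 * (‖x₁‖ + ‖x₂‖ + ‖x₃‖ + ‖x₄‖) + (‖y₁‖ + ‖y₂‖ + ‖y₃‖ + ‖y₄‖) := by
      intro x₁ x₂ x₃ x₄ y₁ y₂ y₃ y₄
      rw [norm_neg]
      refine (norm_add_le _ _).trans (add_le_add ?_ norm_add₄_le)
      rw [norm_mul, Complex.norm_ofNat]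
      exact mul_le_mul_of_nonneg_left norm_add₄_le zero_le_two
    have h8 := hn8 (E a) (E (-a)) (E t) (E (-t)) (E (a + t)) (E (-(a + t))) (E (a - t))
      (E (-(a - t)))
    have b1 := hEle a (by tauto)
    have b2 := hEle (-a) (by rw [neg_sq]; tauto)
    have b3 := hEle t (by tauto)
    have b4 := hEle (-t) (by rw [neg_sq]; tauto)
    have b5 := hEle (a + t) (by tauto)
    have b6 := hEle (-(a + t)) (by rw [neg_sq]; tauto)
    have b7 := hEle (a - t) (by tauto)
    have b8 := hEle (-(a - t)) (by rw [neg_sq]; tauto)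
    rw [e, norm_mul]
    refine lt_of_le_of_lt ?_ hp3
    have hdn : ‖(d : ℂ) ^ (8 * p)‖ = ((d : ℝ) ^ 8) ^ p := by
      rw [norm_pow, Complex.norm_intCast, abs_of_pos hdR, pow_mul]
    rw [hdn]
    refine (mul_le_mul_of_nonneg_left (h8.trans (c := 12 * (|c| ^ p / ((p - 1).factorial : ℝ)))
      (by linarith)) (by positivity)).trans_eq ?_
    rw [mul_pow]
    ring
  -- an integer of modulus less than `1` vanishes, and so `p` divides `4 n d ^ (8 p)`
  have hzero : 4 * n * d ^ (8 * p) + p * (2 * z₁ + z₂) = 0 := by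
    rw [Complex.norm_intCast] at hfinal
    exact Int.abs_lt_one_iff.1 (by exact_mod_cast hfinal)
  have hdvd : (p : ℤ) ∣ 4 * n * d ^ (8 * p) :=
    ⟨-(2 * z₁ + z₂), by linear_combination hzero⟩
  have hprime := Nat.prime_iff_prime_int.1 hpp
  have hnd : ∀ m : ℤ, 0 < m → m ≤ 4 * d → ¬(p : ℤ) ∣ m := fun m hm hmd h => by
    have := Int.le_of_dvd hm h
    omega
  rcases hprime.dvd_or_dvd hdvd with h | h
  · rcases hprime.dvd_or_dvd h with h | h
    · exact hnd 4 (by norm_num) (by omega) h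
    · exact hpn h
  · exact hnd d hd (by omega) (hprime.dvd_of_dvd_pow h)

/-- The rational form of `int_mul_pi_pow_four_ne_zero`; there is no rational quadratic equation for
`π ^ 2` with a negative product of its roots. -/
lemma pi_pow_four_ne_zero {S P : ℚ} (hP : P < 0) : π ^ 4 - S * π ^ 2 + P ≠ 0 := by
  intro h
  refine int_mul_pi_pow_four_ne_zero (d := S.den * P.den) (s := S.num * P.den)
    (q := P.num * S.den) (by positivity) ?_ ?_
  · exact mul_neg_of_neg_of_pos (Rat.num_neg.2 hP) (by exact_mod_cast S.pos)
  · have h1 : (S : ℝ) * S.den = S.num := by exact_mod_cast Rat.mul_den_eq_num S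
    have h2 : (P : ℝ) * P.den = P.num := by exact_mod_cast Rat.mul_den_eq_num P
    push_cast
    rw [← h1, ← h2]
    linear_combination (S.den : ℝ) * P.den * h

/-! ### Resonant times and closed geodesics -/

lemma exists_nat_of_exp_eq_one {x : ℝ} (hx : 0 < x) (h : Complex.exp (Complex.I * x) = 1) :
    ∃ n : ℕ, 1 ≤ n ∧ x = n * (2 * π) := by
  obtain ⟨n, hn⟩ := Complex.exp_eq_one_iff.1 h
  have hxn : x = n * (2 * π) := by
    have h1 : (x : ℂ) = n * (2 * π) :=
      mul_left_cancel₀ Complex.I_ne_zero (by linear_combination hn)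
    exact_mod_cast h1
  have hn0 : 0 < n := by
    have : (0 : ℝ) < n := pos_of_mul_pos_left (hxn ▸ hx) (by positivity)
    exact_mod_cast this
  refine ⟨n.toNat, by omega, ?_⟩
  rw [hxn, ← Int.cast_natCast, Int.toNat_of_nonneg hn0.le]

/-- A positive time at which both components of `t ∇F` are multiples of `2π` satisfies the length
equations, written in terms of `f = (1 + σ) ^ (1/2)`, where `σ` is `raySq r`. -/
lemma exists_nat_of_resonant {r t : ℝ} (hr : 0 < r) (ht : 0 < t)
    (h : Complex.exp (Complex.I * t * slopeFst r) = 1 ∧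
      Complex.exp (Complex.I * t * slopeSnd r) = 1) :
    ∃ k l : ℕ, 1 ≤ k ∧ 1 ≤ l ∧ t = 4 * k * (√(raySq r) * √(1 + raySq r)) ∧
      t * (1 + 2 * √(1 + raySq r) ^ 2) = 6 * π * l * √(1 + raySq r) := by
  have hσ := raySq_pos hr
  have hs := Real.sqrt_pos.2 hσ
  have hf : 0 < √(1 + raySq r) := Real.sqrt_pos.2 (by positivity)
  have hf2 : √(1 + raySq r) ^ 2 = 1 + raySq r := Real.sq_sqrt (by positivity)
  have h1 : 0 < slopeFst r := by unfold slopeFst; positivity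
  have h2 : 0 < slopeSnd r := by unfold slopeSnd; positivity
  obtain ⟨k, hk, hk'⟩ := exists_nat_of_exp_eq_one (mul_pos ht h1)
    (by push_cast; rw [← mul_assoc]; exact h.1)
  obtain ⟨l, hl, hl'⟩ := exists_nat_of_exp_eq_one (mul_pos ht h2)
    (by push_cast; rw [← mul_assoc]; exact h.2)
  refine ⟨k, l, hk, hl, ?_, ?_⟩
  · unfold slopeFst at hk'
    field_simp at hk'
    linarith
  · unfold slopeSnd at hl'
    field_simp at hl'
    rw [hf2]
    linarith

/-- A positive resonant time is the length of a closed geodesic, with `η₀ = (1 + σ) ^ (-1/2)`. -/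
lemma exists_isGeodesicLength_of_resonant {r t : ℝ} (hr : 0 < r) (ht : 0 < t)
    (h : Complex.exp (Complex.I * t * slopeFst r) = 1 ∧
      Complex.exp (Complex.I * t * slopeSnd r) = 1) :
    ∃ k l : ℕ, 1 ≤ k ∧ 1 ≤ l ∧ (k : ℝ) ≤ π / (2 * √(raySq r)) * l ∧ IsGeodesicLength k l t := by
  obtain ⟨k, l, hk, hl, h1, h2⟩ := exists_nat_of_resonant hr ht h
  have hσ := raySq_pos hr
  have hs := Real.sqrt_pos.2 hσ
  have hs2 : √(raySq r) ^ 2 = raySq r := Real.sq_sqrt hσ.le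
  have hf1 : 1 < √(1 + raySq r) := Real.lt_sqrt_of_sq_lt (by linarith)
  have hf2 : √(1 + raySq r) ^ 2 = 1 + √(raySq r) ^ 2 := by
    rw [hs2]
    exact Real.sq_sqrt (by positivity)
  generalize √(raySq r) = s at *
  generalize √(1 + raySq r) = f at *
  have hf0 : 0 < f := by linarith
  have hfi : 0 < f⁻¹ := inv_pos.2 hf0
  refine ⟨k, l, hk, hl, ?_, ht, f⁻¹, by linarith, inv_lt_one_of_one_lt₀ hf1, hfi.ne', ?_, ?_⟩
  · have h3 : 4 * (k : ℝ) * s * (1 + 2 * f ^ 2) = 6 * π * l := by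
      refine mul_right_cancel₀ hf0.ne' ?_
      rw [← h2, h1]
      ring
    have h4 : (3 : ℝ) ≤ 1 + 2 * f ^ 2 := by nlinarith
    rw [div_mul_eq_mul_div, le_div_iff₀ (by positivity)]
    have h5 := mul_le_mul_of_nonneg_left h4 (show 0 ≤ 4 * (k : ℝ) * s by positivity)
    linarith
  · have h3 : √(1 - f⁻¹ ^ 2) = s / f := by
      rw [Real.sqrt_eq_iff_mul_self_eq_of_pos (by positivity)]
      field_simp
      linarith
    rw [h3, h1]
    field_simp
  · have h3 : t * (1 / 3 * f⁻¹ + 2 / (3 * f⁻¹)) = t * (1 + 2 * f ^ 2) / (3 * f) := by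
      field_simp
    rw [h3, h2]
    field_simp
    norm_num

lemma nonResonant_neg {α β t : ℝ} (h : NonResonant α β (-t)) : NonResonant α β t := by
  intro r hr hexp
  refine h r hr ?_
  have e : ∀ x : ℝ, Complex.exp (Complex.I * ((-t : ℝ) : ℂ) * x) =
      (Complex.exp (Complex.I * t * x))⁻¹ := by
    intro x
    rw [← Complex.exp_neg]
    push_cast
    ring_nf
  rw [e, e, hexp.1, hexp.2]
  simp

lemma raySq_le_raySq {r r' : ℝ} (hr : 0 ≤ r) (h : r ≤ r') : raySq r ≤ raySq r' := by
  unfold raySq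
  gcongr

lemma nonResonant_of_notMem_lengthSpectrum {α β M t : ℝ} (hα : 0 < α)
    (hM : π / (2 * √(raySq α)) ≤ M)
    (ht : t ∉ lengthSpectrum M ∪ {t : ℝ | -t ∈ lengthSpectrum M} ∪ {0}) : NonResonant α β t := by
  have key : ∀ t, 0 < t → t ∉ lengthSpectrum M → NonResonant α β t := by
    intro t ht0 ht r hr h
    have hr0 : 0 < r := hα.trans_le hr.1
    obtain ⟨k, l, hk, hl, hkl, hL⟩ := exists_isGeodesicLength_of_resonant hr0 ht0 h
    refine ht ⟨k, l, hk, hl, hkl.trans ?_, hL⟩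
    have hs : 0 < √(raySq α) := Real.sqrt_pos.2 (raySq_pos hα)
    have hle : √(raySq α) ≤ √(raySq r) := Real.sqrt_le_sqrt (raySq_le_raySq hα.le hr.1)
    refine mul_le_mul_of_nonneg_right (le_trans ?_ hM) (Nat.cast_nonneg l)
    gcongr
  simp only [mem_union, mem_singleton_iff, not_or] at ht
  obtain ⟨⟨h1, h2⟩, h3⟩ := ht
  rcases lt_or_gt_of_ne h3 with hneg | hpos
  · exact nonResonant_neg (key (-t) (by linarith) h2)
  · exact key t hpos h1

/-! ### The times `2πℓ` -/

/-- No closed geodesic has a length in `2πℕ`. The length equations with `t = 2πℓ` say that `f` is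
a root of `2 f ^ 2 - 3 q f + 1` with `q` rational, and that `π ^ 2` is `ρ f ^ 2 (f ^ 2 - 1)` with
`ρ` rational. The conjugate of `f` is `1 / (2 f) < 1`, so the conjugate of `π ^ 2` would be
negative. -/
lemma two_pi_mul_nat_ne {f s : ℝ} (hf : 1 < f) (hfs : f ^ 2 = 1 + s ^ 2) {k l ℓ : ℕ} (hk : 1 ≤ k)
    (hℓ : 1 ≤ ℓ) (h1 : 2 * π * ℓ = 4 * k * (s * f))
    (h2 : 2 * π * ℓ * (1 + 2 * f ^ 2) = 6 * π * l * f) : False := by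
  have hf0 : 0 < f := by linarith
  have hℓR : (0 : ℝ) < ℓ := by exact_mod_cast hℓ
  have hkR : (0 : ℝ) < k := by exact_mod_cast hk
  -- the conjugate of `f`
  obtain ⟨f', hf'⟩ : ∃ f' : ℝ, f' = 1 / (2 * f) := ⟨_, rfl⟩
  have hff : f * f' = 1 / 2 := by
    rw [hf']
    field_simp
  have hf'0 : 0 < f' := by rw [hf']; positivity
  have hf'1 : f' < 1 := by nlinarith
  have hsum : f + f' = 3 * (l / ℓ) / 2 := by
    have h3 : (ℓ : ℝ) * (1 + 2 * f ^ 2) = 3 * l * f :=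
      mul_left_cancel₀ (show 2 * π ≠ 0 by positivity) (by linear_combination h2)
    rw [hf']
    field_simp
    linear_combination h3
  obtain ⟨ρ, hρ⟩ : ∃ ρ : ℚ, ρ = 4 * k ^ 2 / ℓ ^ 2 := ⟨_, rfl⟩
  obtain ⟨e, he⟩ : ∃ e : ℚ, e = 3 * (l / ℓ) / 2 := ⟨_, rfl⟩
  have hρR : (ρ : ℝ) = 4 * k ^ 2 / ℓ ^ 2 := by rw [hρ]; push_cast; ring
  have heR : f + f' = e := by rw [hsum, he]; push_cast; ring
  have hρ0 : (0 : ℝ) < ρ := by rw [hρR]; positivity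
  have hπ : π ^ 2 = ρ * (f ^ 2 * (f ^ 2 - 1)) := by
    have h3 : π * ℓ = 2 * k * (s * f) := by linarith
    rw [hρR]
    field_simp
    calc π ^ 2 * (ℓ : ℝ) ^ 2 = (π * ℓ) ^ 2 := by ring
      _ = _ := by rw [h3, hfs]; ring_nf; rw [show f ^ 2 = 1 + s ^ 2 from hfs]; ring
  have hS : (ρ : ℝ) * (f ^ 2 * (f ^ 2 - 1)) + ρ * (f' ^ 2 * (f' ^ 2 - 1)) =
      ((ρ * ((e ^ 2 - 1) ^ 2 - 1 / 2 - (e ^ 2 - 1)) : ℚ) : ℝ) := by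
    push_cast
    rw [← heR]
    have h4 : f ^ 2 + f' ^ 2 = (f + f') ^ 2 - 1 := by linear_combination -2 * hff
    have h5 : f ^ 4 + f' ^ 4 = ((f + f') ^ 2 - 1) ^ 2 - 1 / 2 := by
      rw [← h4]
      linear_combination (-2 * f * f' - 1) * hff
    linear_combination (ρ : ℝ) * h5 - ρ * h4
  have hP : (ρ : ℝ) * (f ^ 2 * (f ^ 2 - 1)) * (ρ * (f' ^ 2 * (f' ^ 2 - 1))) =
      ((ρ ^ 2 / 4 * (9 / 4 - e ^ 2) : ℚ) : ℝ) := by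
    push_cast
    rw [← heR]
    have h4 : f ^ 2 + f' ^ 2 = (f + f') ^ 2 - 1 := by linear_combination -2 * hff
    have h5 : f ^ 2 * f' ^ 2 = 1 / 4 := by
      rw [← mul_pow, hff]
      norm_num
    linear_combination (ρ : ℝ) ^ 2 * (f ^ 2 * f' ^ 2 + 1 / 4 - (f ^ 2 + f' ^ 2) + 1) * h5 -
      ρ ^ 2 / 4 * h4
  have hPneg : (ρ ^ 2 / 4 * (9 / 4 - e ^ 2) : ℚ) < 0 := by
    have h6 : ((ρ ^ 2 / 4 * (9 / 4 - e ^ 2) : ℚ) : ℝ) < 0 := by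
      rw [← hP]
      refine mul_neg_of_pos_of_neg ?_ ?_
      · rw [← hπ]
        positivity
      · exact mul_neg_of_pos_of_neg hρ0
          (mul_neg_of_pos_of_neg (by positivity) (by nlinarith))
    exact_mod_cast h6
  refine pi_pow_four_ne_zero (S := ρ * ((e ^ 2 - 1) ^ 2 - 1 / 2 - (e ^ 2 - 1))) hPneg ?_
  rw [← hS, ← hP, ← hπ]
  ring

lemma nonResonant_two_pi_mul {α : ℝ} (hα : 0 < α) (β : ℝ) {ℓ : ℕ} (hℓ : 1 ≤ ℓ) :
    NonResonant α β (2 * π * ℓ) := by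
  intro r hr h
  have hr0 : 0 < r := hα.trans_le hr.1
  have hσ := raySq_pos hr0
  have hℓR : (0 : ℝ) < ℓ := by exact_mod_cast hℓ
  obtain ⟨k, l, hk, -, h1, h2⟩ := exists_nat_of_resonant hr0 (by positivity) h
  refine two_pi_mul_nat_ne (Real.lt_sqrt_of_sq_lt (by linarith)) ?_ hk hℓ h1 h2
  rw [Real.sq_sqrt (by positivity), Real.sq_sqrt hσ.le]

lemma NonResonant.eventually {α β t : ℝ} (hα : 0 < α) (ht : NonResonant α β t) :
    ∀ᶠ t' in 𝓝 t, NonResonant α β t' := by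
  obtain ⟨δ, hδ, hev⟩ := exists_pos_eventually_lt (isCompact_slopes hα) (y := (t : ℂ))
    (f := fun x => limitEnergy x.1 x.2) continuous_limitEnergy (by
      rintro d ⟨r, hr, rfl⟩
      exact limitEnergy_pos (ht r hr))
  obtain ⟨P, hP, D, hD, hPD⟩ := eventually_prod_iff.1 hev
  filter_upwards [(Complex.continuous_ofReal.tendsto t).eventually hP] with t' ht' r hr h
  have h1 := hPD ht' (subset_of_mem_nhdsSet hD ⟨r, hr, rfl⟩)
  simp only [limitEnergy, h.1, h.2] at h1
  norm_num at h1
  linarith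

/-- For a bounded range of times, steep slopes are never resonant. -/
lemma exists_nonResonant_of_le {α : ℝ} (hα : 0 < α) (T : ℝ) : ∃ r₁, ∀ t, 0 < t → t ≤ T →
    NonResonant α r₁ t → ∀ β, NonResonant α β t := by
  have htend : Tendsto raySq atTop atTop :=
    (tendsto_rpow_atTop (by norm_num)).comp (tendsto_id.const_mul_atTop (by positivity))
  obtain ⟨r₁, hr₁⟩ := eventually_atTop.1 (htend.eventually_gt_atTop T)
  refine ⟨r₁, fun t ht htT hnon β r hr h => ?_⟩
  have hr0 : 0 < r := hα.trans_le hr.1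
  rcases le_total r r₁ with hle | hle
  · exact hnon r ⟨hr.1, hle⟩ h
  · obtain ⟨k, -, hk, -, h1, -⟩ := exists_nat_of_resonant hr0 ht h
    have hσ := raySq_pos hr0
    have hkR : (1 : ℝ) ≤ k := by exact_mod_cast hk
    have hsf : raySq r ≤ √(raySq r) * √(1 + raySq r) := by
      rw [← Real.sqrt_mul hσ.le]
      exact Real.le_sqrt_of_sq_le (by nlinarith)
    have := hr₁ r hle
    nlinarith

/-- The neighbourhood of `2πℓ` does not depend on the upper bound `β` for the slopes. -/
lemma exists_uniform_nonResonant {α : ℝ} (hα : 0 < α) {ℓ : ℕ} (hℓ : 1 ≤ ℓ) :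
    ∃ ε > 0, ∀ t ∈ Ioo (2 * π * ℓ - ε) (2 * π * ℓ + ε), ∀ β, NonResonant α β t := by
  obtain ⟨r₁, hr₁⟩ := exists_nonResonant_of_le hα (2 * π * ℓ + 1)
  obtain ⟨ε, hε, hball⟩ := Metric.eventually_nhds_iff_ball.1
    ((nonResonant_two_pi_mul hα r₁ hℓ).eventually hα)
  have hℓR : (1 : ℝ) ≤ ℓ := by exact_mod_cast hℓ
  have h1 := min_le_left ε 1
  have h2 := min_le_right ε 1
  refine ⟨min ε 1, lt_min hε one_pos, fun t ht => hr₁ t ?_ ?_ (hball t ?_)⟩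
  · nlinarith [ht.1, Real.pi_gt_three]
  · linarith [ht.2]
  · rw [Real.ball_eq_Ioo]
    exact ⟨by linarith [ht.1], by linarith [ht.2]⟩

end Friedlander

end

theorem mainTheorem8 (κ₁ : ℝ) (hκ₁ : 0 < κ₁) :
    (∃ M₀ : ℝ, ∀ M : ℝ, M₀ ≤ M →
      ∀ κ₂ : ℝ, κ₁ < κ₂ →
      ∀ (ψ : ℝ → ℂ) (χ₂ : ℝ × ℝ → ℂ), Friedlander.IsPositiveCutoff ψ →
        Friedlander.IsSymbol 0 χ₂ →
        Function.support χ₂ ⊆ Friedlander.middleSector κ₁ κ₂ →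
        Summable (Friedlander.traceTerm ψ χ₂) ∧
        Friedlander.IsSmoothOn (Friedlander.localTrace ψ χ₂)
          (Friedlander.lengthSpectrum M ∪ {t : ℝ | -t ∈ Friedlander.lengthSpectrum M} ∪ {0})ᶜ) ∧
    (∀ ℓ : ℕ, 1 ≤ ℓ → ∃ ε : ℝ, 0 < ε ∧
      ∀ κ₂ : ℝ, κ₁ < κ₂ →
      ∀ (ψ : ℝ → ℂ) (χ₂ : ℝ × ℝ → ℂ), Friedlander.IsPositiveCutoff ψ →
        Friedlander.IsSymbol 0 χ₂ →
        Function.support χ₂ ⊆ Friedlander.middleSector κ₁ κ₂ →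
        Friedlander.IsSmoothOn (Friedlander.localTrace ψ χ₂)
          (Set.Ioo (2 * Real.pi * ℓ - ε) (2 * Real.pi * ℓ + ε))) := by
  have hα : 0 < κ₁ / 2 := half_pos hκ₁
  refine ⟨⟨Real.pi / (2 * √(Friedlander.raySq (κ₁ / 2))), fun M hM κ₂ hκ ψ χ hψ hχ hsupp => ?_⟩,
    fun ℓ hℓ => ?_⟩
  · have hβ : 0 < 2 * κ₂ := by linarith
    have ha := Friedlander.conicAmplitude_amplitude hκ₁ hκ hψ hχ hsupp
    exact ⟨(Friedlander.hasSum_traceTerm hα hβ ha).summable,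
      Friedlander.isSmoothOn_localTrace hα hβ ha fun t ht =>
        Friedlander.nonResonant_of_notMem_lengthSpectrum hα hM ht⟩
  · obtain ⟨ε, hε, hnon⟩ := Friedlander.exists_uniform_nonResonant hα hℓ
    refine ⟨ε, hε, fun κ₂ hκ ψ χ hψ hχ hsupp => ?_⟩
    exact Friedlander.isSmoothOn_localTrace hα (by linarith)
      (Friedlander.conicAmplitude_amplitude hκ₁ hκ hψ hχ hsupp) fun t ht => hnon t ht _
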